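/- Let $\mathcal H$ be a separable complex Hilbert space and $\mathfrak M_2\subset\mathfrak M_1$ von Neumann algebras on $\mathcal H$ with a common cyclic and separating unit vector $\Omega$. For $j=1,2$ let $S_j$ be the closure of the antilinear operator $a\Omega\mapsto a^*\Omega$ ($a\in\mathfrak M_j$), let $\Delta_j=S_j^*S_j$ be the modular operator, with spectral decomposition $\log\Delta_j=\int_{\mathbb R}k\,E_j(dk)$, and let $\sigma_j^t(a)=\Delta_j^{it}a\Delta_j^{-it}$ be the modular flow. Write $E_1^-\log\Delta_1=\int_{\mathbb R}\min(k,0)\,E_1(dk)$. Expectation values $\langle x,f(\log\Delta_j)x\rangle$ are understood in the sense of quadratic forms, i.e. as $\int f(k)\,\langle x,E_j(dk)x\rangle$. Let $\eta:(-\infty,0]\to[0,\infty)$ be continuous and such that $$u\mapsto\Big[\inf_{k\ge 0}(1+e^{u-k})\,\eta(-k)\Big]^{-1}$$ is integrable on $(0,\infty)$ (where $0^{-1}=\infty$), and for $\tau\ge0$ put $$K_\eta(\tau)=\int_{\pi\tau}^\infty\Big[\inf_{k\ge 0}(1+e^{u-k})\,\eta(-k)\Big]^{-1}du .$$ Then there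 is a constant $C$, independent of $\tau$ and $U$, such that for every $\tau\ge 0$ and every unitary $U\in\mathfrak M_2$ with $\sigma_1^t(U)\in\mathfrak M_2$ for all $|t|\le\tau$, and with $U\Omega$ in the form domain of $\eta(E_1^-\log\Delta_1)$ (otherwise the right-hand side below is infinite), the expectation values $\langle U\Omega,\log\Delta_j\,U\Omega\rangle$, $j=1,2$, are finite and $$\big|\langle U\Omega,(\log\Delta_1)U\Omega\rangle-\langle U\Omega,(\log\Delta_2)U\Omega\rangle\big|\le C\,K_\eta(\tau)\,\big(1+\langle U\Omega,\eta(E_1^-\log\Delta_1)U\Omega\rangle\big).$$ -/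

import Mathlib

open MeasureTheory Set
open scoped ENNReal InnerProductSpace

universe u

noncomputable section

/-! ### Projection-valued measures and their scalar spectral measures -/

/-- A projection-valued measure on the Borel sets of `ℝ`, with values in the orthogonal projections
of the Hilbert space `H`: normalised and strongly countably additive. -/
structure ProjValuedMeasure (H : Type u) [NormedAddCommGroup H] [InnerProductSpace ℂ H]
    [CompleteSpace H] where
  /-- The projection of a Borel set (irrelevant for sets that are not Borel). -/
  proj : Set ℝ → H →L[ℂ] H
  isStarProjection : ∀ B, MeasurableSet B → IsStarProjection (proj B)
  proj_univ : proj univ = 1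
  hasSum_iUnion : ∀ B : ℕ → Set ℝ, (∀ n, MeasurableSet (B n)) →
    Pairwise (Function.onFun Disjoint B) → ∀ x : H,
      HasSum (fun n => proj (B n) x) (proj (⋃ n, B n) x)

namespace ProjValuedMeasure

variable {H : Type u} [NormedAddCommGroup H] [InnerProductSpace ℂ H] [CompleteSpace H]

lemma proj_empty (E : ProjValuedMeasure H) (x : H) : E.proj ∅ x = 0 := by
  have h := (E.hasSum_iUnion (fun _ => ∅) (fun _ => MeasurableSet.empty)
    (fun _ _ _ => disjoint_bot_left) x).summable
  exact (summable_const_iff _).1 h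

lemma re_inner_nonneg (E : ProjValuedMeasure H) {B : Set ℝ} (hB : MeasurableSet B) (x : H) :
    0 ≤ (⟪x, E.proj B x⟫_ℂ).re := by
  have hp := E.isStarProjection B hB
  have h1 : E.proj B (E.proj B x) = E.proj B x :=
    congrArg (fun T : H →L[ℂ] H => T x) hp.isIdempotentElem.eq
  have h2 : ContinuousLinearMap.adjoint (E.proj B) = E.proj B := hp.isSelfAdjoint.star_eq
  have h3 : ⟪x, E.proj B x⟫_ℂ = ⟪E.proj B x, E.proj B x⟫_ℂ := by
    conv_lhs => rw [← h1, ← ContinuousLinearMap.adjoint_inner_left, h2]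
  rw [h3]
  exact inner_self_nonneg (𝕜 := ℂ)

/-- The scalar spectral measure `B ↦ ⟨x, E(B) x⟩` of the vector `x`. -/
def scalar (E : ProjValuedMeasure H) (x : H) : Measure ℝ :=
  Measure.ofMeasurable (fun B _ => ENNReal.ofReal (⟪x, E.proj B x⟫_ℂ).re)
    (by simp [E.proj_empty x])
    (by
      intro f hf hd
      have h := ((E.hasSum_iUnion f hf hd x).mapL (innerSL ℂ x)).mapL Complex.reCLM
      simp only [innerSL_apply_apply, Complex.reCLM_apply] at h
      rw [← h.tsum_eq]
      exact ENNReal.ofReal_tsum_of_nonneg (fun n => E.re_inner_nonneg (hf n) x) h.summable)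

lemma scalar_apply (E : ProjValuedMeasure H) (x : H) {B : Set ℝ} (hB : MeasurableSet B) :
    E.scalar x B = ENNReal.ofReal (⟪x, E.proj B x⟫_ℂ).re :=
  Measure.ofMeasurable_apply B hB

/-- The projection-valued measure concentrated at `0`. -/
instance : Inhabited (ProjValuedMeasure H) :=
  ⟨{ proj := fun B => indicator B (fun _ => (1 : H →L[ℂ] H)) 0
     isStarProjection := by
      intro B _
      by_cases h : (0 : ℝ) ∈ B
      · simp only [indicator_of_mem h]
        exact IsStarProjection.one _
      · simp only [indicator_of_notMem h]
        exact IsStarProjection.zero _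
     proj_univ := by simp
     hasSum_iUnion := by
      intro B _ hd x
      by_cases h : (0 : ℝ) ∈ ⋃ n, B n
      · obtain ⟨m, hm⟩ := mem_iUnion.1 h
        simp only [indicator_of_mem h]
        have := hasSum_single (f := fun n => (indicator (B n) (fun _ => (1 : H →L[ℂ] H)) 0) x) m
          (fun n hn => by
            have h0 : (0 : ℝ) ∉ B n := fun h0 => disjoint_left.1 (hd hn) h0 hm
            simp [indicator_of_notMem h0])
        simpa [indicator_of_mem hm] using this
      · have h0 : ∀ n, (0 : ℝ) ∉ B n := fun n hn => h (mem_iUnion.2 ⟨n, hn⟩)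
        simp only [indicator_of_notMem h, fun n => indicator_of_notMem (h0 n)
          (fun _ => (1 : H →L[ℂ] H))]
        simp }⟩

/-- The image of a projection-valued measure under a Borel function `f`, i.e. the spectral measure
of `f(A)` when `E` is the spectral measure of `A`. -/
def map (E : ProjValuedMeasure H) (f : ℝ → ℝ) (hf : Measurable f) : ProjValuedMeasure H where
  proj B := E.proj (f ⁻¹' B)
  isStarProjection B hB := E.isStarProjection _ (hf hB)
  proj_univ := E.proj_univ
  hasSum_iUnion B hB hd x := by
    rw [preimage_iUnion]
    exact E.hasSum_iUnion _ (fun n => hf (hB n)) (fun i j hij => (hd hij).preimage f) x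

open Classical in
/-- The bounded operator `∫ f(k) E(dk)` for a bounded Borel function `f`, i.e. the unique bounded
operator `T` with `⟨x, T x⟩ = ∫ f(k) ⟨x, E(dk) x⟩` for all `x` (and `0` if there is none, which
does not happen for bounded Borel `f`). -/
def integralOp (E : ProjValuedMeasure H) (f : ℝ → ℂ) : H →L[ℂ] H :=
  if h : ∃ T : H →L[ℂ] H, ∀ x, ⟪x, T x⟫_ℂ = ∫ k, f k ∂(E.scalar x) then h.choose else 0

/-- `E` is the spectral measure of the operator `A` with graph `G`, i.e. `A = ∫ k E(dk)`: the domain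
of `A` consists of the vectors with `∫ k² ⟨x, E(dk) x⟩ < ∞`, and there
`⟨x, A x⟩ = ∫ k ⟨x, E(dk) x⟩`. By polarisation the diagonal matrix elements determine `A`. -/
def IsSpectralMeasureOf (E : ProjValuedMeasure H) (G : Set (H × H)) : Prop :=
  (∀ x, (∃ y, (x, y) ∈ G) ↔ Integrable (fun k : ℝ => k ^ 2) (E.scalar x)) ∧
  ∀ x y, (x, y) ∈ G → ⟪x, y⟫_ℂ = ((∫ k, k ∂(E.scalar x) : ℝ) : ℂ)

end ProjValuedMeasure

open Classical in
/-- The spectral measure of the self-adjoint operator with graph `G`. It exists and is unique by the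
spectral theorem; the default value is only reached when `G` is not the graph of a self-adjoint
operator. -/
def spectralMeasure {H : Type u} [NormedAddCommGroup H] [InnerProductSpace ℂ H] [CompleteSpace H]
    (G : Set (H × H)) : ProjValuedMeasure H :=
  if h : ∃ E : ProjValuedMeasure H, E.IsSpectralMeasureOf G then h.choose else default

/-! ### Modular theory of a von Neumann algebra with a cyclic and separating vector -/

namespace VonNeumannAlgebra

variable {H : Type u} [NormedAddCommGroup H] [InnerProductSpace ℂ H] [CompleteSpace H]

/-- `Ω` is a cyclic and separating unit vector for `M`. -/
structure IsCyclicSeparating (M : VonNeumannAlgebra H) (Ω : H) : Prop where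
  norm_eq_one : ‖Ω‖ = 1
  cyclic : Dense {x : H | ∃ a ∈ M, a Ω = x}
  separating : ∀ a ∈ M, a Ω = 0 → a = 0

/-- The graph of the closure `S` of the antilinear operator `a Ω ↦ a* Ω`, `a ∈ M`
(the Tomita operator). -/
def tomitaGraph (M : VonNeumannAlgebra H) (Ω : H) : Set (H × H) :=
  closure {p | ∃ a ∈ M, p = (a Ω, star a Ω)}

/-- The graph of the modular operator `Δ = S* S`, where `S = J Δ^{1/2}` is the Tomita operator:
`x ∈ dom Δ` and `Δ x = z` iff `x ∈ dom S`, `S x ∈ dom S*` and `S* S x = z`, the adjoint of the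
antilinear `S` being defined by `⟨w, S* y⟩ = ⟨y, S w⟩` for all `w ∈ dom S`. -/
def modularGraph (M : VonNeumannAlgebra H) (Ω : H) : Set (H × H) :=
  {p | ∃ y, (p.1, y) ∈ M.tomitaGraph Ω ∧
    ∀ q ∈ M.tomitaGraph Ω, ⟪q.1, p.2⟫_ℂ = ⟪y, q.2⟫_ℂ}

/-- The spectral measure of `log Δ`: the image under `log` of the spectral measure of `Δ`
(which lives on `(0, ∞)`). -/
def logModular (M : VonNeumannAlgebra H) (Ω : H) : ProjValuedMeasure H :=
  (spectralMeasure (M.modularGraph Ω)).map Real.log Real.measurable_log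

/-- The scalar spectral measure `⟨x, E(dk) x⟩` of `log Δ = ∫ k E(dk)` in the vector `x`. The
expectation value `⟨x, f(log Δ) x⟩` is the integral of `f` with respect to it, for `x` in the form
domain of `f(log Δ)`. -/
def logModularMeasure (M : VonNeumannAlgebra H) (Ω x : H) : Measure ℝ :=
  (M.logModular Ω).scalar x

/-- The unitary `Δ^{it}`. -/
def modularUnitary (M : VonNeumannAlgebra H) (Ω : H) (t : ℝ) : H →L[ℂ] H :=
  (M.logModular Ω).integralOp (fun k => Complex.exp (Complex.I * t * k))

/-- The modular flow `σ^t(a) = Δ^{it} a Δ^{-it}`. -/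
def modularFlow (M : VonNeumannAlgebra H) (Ω : H) (t : ℝ) (a : H →L[ℂ] H) : H →L[ℂ] H :=
  M.modularUnitary Ω t * a * M.modularUnitary Ω (-t)

end VonNeumannAlgebra

/-! ### The weight function -/

/-- `inf_{k ≥ 0} (1 + e^{u-k}) η(-k)`, as an extended nonnegative number, so that the inverse of a
vanishing infimum is `∞`. -/
def etaInf (η : ℝ → ℝ) (u : ℝ) : ℝ≥0∞ :=
  ⨅ (k : ℝ) (_ : 0 ≤ k), ENNReal.ofReal ((1 + Real.exp (u - k)) * η (-k))

/-- `K_η(τ) = ∫_{πτ}^∞ [inf_{k ≥ 0} (1 + e^{u-k}) η(-k)]^{-1} du` (finite for `τ ≥ 0` if the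
integral over the positive half line is). -/
def etaTail (η : ℝ → ℝ) (τ : ℝ) : ℝ :=
  (∫⁻ u in Ioi (Real.pi * τ), (etaInf η u)⁻¹).toReal

end

/-!
Write `μⱼ` for the spectral measure of `log Δⱼ` in the vector `x = U Ω` and `f κ = 1 / (1 + e^κ)`, so
that `f (log Δ + u)` is the resolvent `s (s + Δ)⁻¹` with `s = e^{-u}`. The logarithm is an integral
of resolvents, `k = ∫ (1_{u ≤ 0} - f (k + u)) du`, hence
`⟨log Δ₂⟩ - ⟨log Δ₁⟩ = ∫ d(u) du` with `d(u) = ⟨f (log Δ₁ + u)⟩ - ⟨f (log Δ₂ + u)⟩`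
(`integral_sub_integral_eq`), and the theorem is an estimate of `d`.

*Comparison of the resolvents.* The Tomita operators satisfy `S₂ ⊂ S₁`, and `Δⱼ = Sⱼ* Sⱼ`. The
vector `Rⱼ = s (s + Δⱼ)⁻¹ x` solves `s ⟨w, x - Rⱼ⟩ = ⟨Sⱼ Rⱼ, Sⱼ w⟩` for all `w ∈ dom Sⱼ`, so `R₂` is
the orthogonal projection of `R₁` onto `dom S₂` for the graph norm `s ‖w‖² + ‖S₁ w‖²`, and `s d(u)` is
the squared distance. Therefore `d ≥ 0`, and replacing `R₂` by any vector `φ (log Δ₁) x ∈ dom S₂`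
gives `d(u) ≤ ∫ |f (k + u) - φ k|² (1 + e^{k + u}) μ₁(dk)` (`fermi_integral_sub_bounds`).

*Band-limited functions.* Since `Δ₁^{it} U Ω = σ₁^t(U) Ω` lies in `dom S₂` for `|t| ≤ τ`, so does
`φ (log Δ₁) U Ω` for every `φ` that is a superposition of the exponentials `e^{itk}`, `|t| ≤ τ`: these
are the functions called admissible below. By the Mittag-Leffler expansion of the cotangent, `f` is
the Fourier transform of a kernel which decays like `e^{-π|t|}`, and cutting it off at `|t| = τ` costs
a uniform error `O(e^{-πτ})` (`IsAdmissible.exists_approx`). As `⟨x, Δ₁ x⟩ ≤ 1`, this proves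
`d(u) = O(e^{-2πτ}) (1 + e^u)`, which is `O(e^{-πτ})` after integration over `|u| ≤ πτ`.

*Tails.* For `u ≤ -πτ` one has `d(u) ≤ 1 - ⟨f (log Δ₂ + u)⟩ ≤ e^u ⟨Δ₂⟩ ≤ e^u`. For `u > πτ` the
definition of the infimum gives `f (k + u) ≤ η (min k 0) / inf_k (1 + e^{u - k}) η (-k)`, whose
integral is `K_η(τ)` times the expectation value of `η`. Finally `e^{-πτ} ≤ 2 η(0) K_η(τ)`.

The modular operators enter through their spectral measures. Their existence is proved here: the
spectral theorem for a bounded self-adjoint operator follows from the continuous functional calculus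
and the Riesz–Markov–Kakutani theorem, and the one for a positive self-adjoint operator `A` from the
bounded one for `(1 + A)⁻¹`. That `S* S` is self-adjoint is the orthogonal decomposition of `H × H`
along the closed graph of `S`.
-/

open Filter Topology ComplexConjugate

/-! ### Bounded Borel functional calculus of a projection-valued measure -/

section StrongLimits

variable {H : Type u} [NormedAddCommGroup H] [InnerProductSpace ℂ H]

/-- A sequence of bounded operators that is pointwise Cauchy has a bounded strong limit. -/
lemma exists_strongLimit [CompleteSpace H] (T : ℕ → H →L[ℂ] H) (h : ∀ x, CauchySeq fun n => T n x) :
    ∃ S : H →L[ℂ] H, ∀ x, Tendsto (fun n => T n x) atTop (𝓝 (S x)) := by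
  choose f hf using fun x => cauchySeq_tendsto_of_complete (h x)
  exact ⟨continuousLinearMapOfTendsto T (f := f) (tendsto_pi_nhds.2 hf), hf⟩

/-- Vectors that depend contractively, in the `L²` sense, on a sequence of functions that converges
pointwise with a square integrable bound form a Cauchy sequence. -/
lemma cauchySeq_of_normSq_sub_le_integral {V X F : Type*} [NormedAddCommGroup V]
    [MeasurableSpace X] {μ : Measure X} [NormedAddCommGroup F] {f : ℕ → X → F} {g : X → F}
    (hf : ∀ n, AEStronglyMeasurable (f n) μ) {b : X → ℝ} (hb : Integrable (fun k => b k ^ 2) μ)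
    (hfb : ∀ n k, ‖f n k‖ ≤ b k) (hlim : ∀ k, Tendsto (fun n => f n k) atTop (𝓝 (g k)))
    {v : ℕ → V} (hv : ∀ n m, ‖v n - v m‖ ^ 2 ≤ ∫ k, ‖f n k - f m k‖ ^ 2 ∂μ) : CauchySeq v := by
  rw [cauchySeq_iff_tendsto_dist_atTop_0]
  have h0 : Tendsto (fun p : ℕ × ℕ => ∫ k, ‖f p.1 k - f p.2 k‖ ^ 2 ∂μ) atTop
      (𝓝 (∫ _, (0 : ℝ) ∂μ)) := by
    refine tendsto_integral_filter_of_dominated_convergence (fun k => 4 * b k ^ 2) ?_ ?_ ?_ ?_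
    · exact Eventually.of_forall fun p => ((hf p.1).sub (hf p.2)).norm.pow 2
    · refine Eventually.of_forall fun p => Eventually.of_forall fun k => ?_
      rw [Real.norm_of_nonneg (by positivity)]
      have h1 : ‖f p.1 k - f p.2 k‖ ≤ 2 * b k :=
        (norm_sub_le _ _).trans ((add_le_add (hfb _ _) (hfb _ _)).trans_eq (two_mul _).symm)
      calc _ ≤ (2 * b k) ^ 2 := pow_le_pow_left₀ (norm_nonneg _) h1 2
        _ = _ := by ring
    · exact hb.const_mul 4
    · refine Eventually.of_forall fun k => ?_
      have h1 : Tendsto (fun p : ℕ × ℕ => f p.1 k - f p.2 k) atTop (𝓝 (g k - g k)) := by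
        rw [← prod_atTop_atTop_eq]
        exact ((hlim k).comp tendsto_fst).sub ((hlim k).comp tendsto_snd)
      simpa using (h1.norm.pow 2)
  rw [integral_zero] at h0
  have h1 : Tendsto (fun p : ℕ × ℕ => Real.sqrt (∫ k, ‖f p.1 k - f p.2 k‖ ^ 2 ∂μ)) atTop (𝓝 0) := by
    simpa using h0.sqrt
  refine squeeze_zero (fun _ => dist_nonneg) (fun p => ?_) h1
  rw [dist_eq_norm]
  exact Real.le_sqrt_of_sq_le (hv _ _)

lemma inner_self_eq_ofReal_normSq (x : H) : ⟪x, x⟫_ℂ = ((‖x‖ ^ 2 : ℝ) : ℂ) := by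
  rw [inner_self_eq_norm_sq_to_K]
  push_cast
  rfl

lemma eq_of_forall_inner_self {S T : H →L[ℂ] H} (h : ∀ x, ⟪x, S x⟫_ℂ = ⟪x, T x⟫_ℂ) : S = T := by
  have h1 : (S : H →ₗ[ℂ] H) = (T : H →ₗ[ℂ] H) := by
    refine (ext_inner_map _ _).1 fun x => ?_
    have := congrArg conj (h x)
    simpa [inner_conj_symm] using this
  ext x
  exact congrArg (fun f : H →ₗ[ℂ] H => f x) h1

end StrongLimits

/-- A bounded Borel function on the line. -/
structure IsBddMeasurable (f : ℝ → ℂ) : Prop where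
  measurable : Measurable f
  exists_bound : ∃ C : ℝ, ∀ k, ‖f k‖ ≤ C

namespace IsBddMeasurable

variable {f g : ℝ → ℂ}

lemma integrable (hf : IsBddMeasurable f) (μ : Measure ℝ) [IsFiniteMeasure μ] :
    Integrable f μ := by
  obtain ⟨C, hC⟩ := hf.exists_bound
  exact Integrable.of_bound hf.measurable.aestronglyMeasurable C (Eventually.of_forall hC)

lemma const (c : ℂ) : IsBddMeasurable fun _ => c :=
  ⟨measurable_const, ‖c‖, fun _ => le_rfl⟩

lemma add (hf : IsBddMeasurable f) (hg : IsBddMeasurable g) :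
    IsBddMeasurable fun k => f k + g k := by
  obtain ⟨C, hC⟩ := hf.exists_bound
  obtain ⟨D, hD⟩ := hg.exists_bound
  exact ⟨hf.measurable.add hg.measurable, C + D,
    fun k => (norm_add_le _ _).trans (add_le_add (hC k) (hD k))⟩

lemma mul (hf : IsBddMeasurable f) (hg : IsBddMeasurable g) :
    IsBddMeasurable fun k => f k * g k := by
  obtain ⟨C, hC⟩ := hf.exists_bound
  obtain ⟨D, hD⟩ := hg.exists_bound
  refine ⟨hf.measurable.mul hg.measurable, C * D, fun k => ?_⟩
  rw [norm_mul]
  exact mul_le_mul (hC k) (hD k) (norm_nonneg _) ((norm_nonneg _).trans (hC k))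

lemma const_mul (c : ℂ) (hf : IsBddMeasurable f) : IsBddMeasurable fun k => c * f k :=
  (const c).mul hf

lemma sub (hf : IsBddMeasurable f) (hg : IsBddMeasurable g) :
    IsBddMeasurable fun k => f k - g k := by
  simpa [sub_eq_add_neg] using hf.add (hg.const_mul (-1))

lemma star (hf : IsBddMeasurable f) : IsBddMeasurable fun k => conj (f k) := by
  obtain ⟨C, hC⟩ := hf.exists_bound
  exact ⟨Complex.continuous_conj.measurable.comp hf.measurable, C, fun k => by simpa using hC k⟩

lemma indicator (hf : IsBddMeasurable f) {B : Set ℝ} (hB : MeasurableSet B) :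
    IsBddMeasurable (B.indicator f) := by
  obtain ⟨C, hC⟩ := hf.exists_bound
  exact ⟨hf.measurable.indicator hB, C, fun k => (norm_indicator_le_norm_self f k).trans (hC k)⟩

lemma simpleFunc (s : SimpleFunc ℝ ℂ) : IsBddMeasurable s := by
  obtain ⟨C, hC⟩ := s.exists_forall_norm_le
  exact ⟨s.measurable, C, hC⟩

lemma comp (hf : IsBddMeasurable f) {h : ℝ → ℝ} (hh : Measurable h) :
    IsBddMeasurable fun k => f (h k) := by
  obtain ⟨C, hC⟩ := hf.exists_bound
  exact ⟨hf.measurable.comp hh, C, fun k => hC _⟩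

lemma integrable_normSq (hf : IsBddMeasurable f) (μ : Measure ℝ) [IsFiniteMeasure μ] :
    Integrable (fun k => ‖f k‖ ^ 2) μ := by
  obtain ⟨C, hC⟩ := hf.exists_bound
  refine Integrable.of_bound (hf.measurable.norm.pow_const 2).aestronglyMeasurable (C ^ 2)
    (Eventually.of_forall fun k => ?_)
  rw [Real.norm_of_nonneg (by positivity)]
  exact pow_le_pow_left₀ (norm_nonneg _) (hC k) 2

/-- A bounded Borel function is the bounded pointwise limit of simple functions. -/
lemma exists_simpleFunc_approx (hf : IsBddMeasurable f) :
    ∃ (s : ℕ → SimpleFunc ℝ ℂ) (C : ℝ), (∀ n k, ‖s n k‖ ≤ C) ∧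
      ∀ k, Tendsto (fun n => s n k) atTop (𝓝 (f k)) := by
  obtain ⟨C, hC⟩ := hf.exists_bound
  refine ⟨fun n => SimpleFunc.approxOn f hf.measurable univ 0 (mem_univ _) n, C + C,
    fun n k => ?_, fun k => ?_⟩
  · exact (SimpleFunc.norm_approxOn_zero_le hf.measurable (mem_univ _) k n).trans
      (add_le_add (hC k) (hC k))
  · exact SimpleFunc.tendsto_approxOn hf.measurable (mem_univ _) (by simp)

end IsBddMeasurable

namespace ProjValuedMeasure

variable {H : Type u} [NormedAddCommGroup H] [InnerProductSpace ℂ H] [CompleteSpace H]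
  (E : ProjValuedMeasure H)

lemma inner_proj_eq_normSq {B : Set ℝ} (hB : MeasurableSet B) (x : H) :
    ⟪x, E.proj B x⟫_ℂ = ((‖E.proj B x‖ ^ 2 : ℝ) : ℂ) := by
  have hp := E.isStarProjection B hB
  have h1 : E.proj B (E.proj B x) = E.proj B x :=
    congrArg (fun T : H →L[ℂ] H => T x) hp.isIdempotentElem.eq
  have h2 : ContinuousLinearMap.adjoint (E.proj B) = E.proj B := hp.isSelfAdjoint.star_eq
  conv_lhs => rw [← h1, ← ContinuousLinearMap.adjoint_inner_left, h2]
  rw [inner_self_eq_ofReal_normSq]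

lemma scalar_eq_normSq {B : Set ℝ} (hB : MeasurableSet B) (x : H) :
    E.scalar x B = ENNReal.ofReal (‖E.proj B x‖ ^ 2) := by
  rw [E.scalar_apply x hB, E.inner_proj_eq_normSq hB, Complex.ofReal_re]

lemma scalar_univ (x : H) : E.scalar x univ = ENNReal.ofReal (‖x‖ ^ 2) := by
  simp [E.scalar_eq_normSq MeasurableSet.univ, E.proj_univ]

instance isFiniteMeasure_scalar (x : H) : IsFiniteMeasure (E.scalar x) :=
  ⟨by rw [scalar_univ]; exact ENNReal.ofReal_lt_top⟩

lemma scalar_real_apply {B : Set ℝ} (hB : MeasurableSet B) (x : H) :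
    (E.scalar x).real B = ‖E.proj B x‖ ^ 2 := by
  rw [measureReal_def, E.scalar_eq_normSq hB, ENNReal.toReal_ofReal (by positivity)]

lemma scalar_real_univ (x : H) : (E.scalar x).real univ = ‖x‖ ^ 2 := by
  simp [E.scalar_real_apply MeasurableSet.univ, E.proj_univ]

lemma inner_proj {B : Set ℝ} (hB : MeasurableSet B) (x : H) :
    ⟪x, E.proj B x⟫_ℂ = ((E.scalar x).real B : ℂ) := by
  rw [E.scalar_real_apply hB, E.inner_proj_eq_normSq hB]

lemma proj_union {A B : Set ℝ} (hA : MeasurableSet A) (hB : MeasurableSet B)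
    (hd : Disjoint A B) : E.proj (A ∪ B) = E.proj A + E.proj B := by
  refine eq_of_forall_inner_self fun x => ?_
  rw [add_apply, inner_add_right, E.inner_proj hA, E.inner_proj hB,
    E.inner_proj (hA.union hB), measureReal_union hd hB]
  push_cast
  rfl

lemma proj_mul_of_disjoint {A B : Set ℝ} (hA : MeasurableSet A) (hB : MeasurableSet B)
    (hd : Disjoint A B) : E.proj A * E.proj B = 0 := by
  ext x
  set y := E.proj B x with hy
  have hBy : E.proj B y = y :=
    congrArg (fun T : H →L[ℂ] H => T x) (E.isStarProjection B hB).isIdempotentElem.eq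
  have h1 : (E.scalar y).real (A ∪ B) ≤ (E.scalar y).real univ :=
    measureReal_mono (subset_univ _)
  rw [measureReal_union hd hB, E.scalar_real_apply hA, E.scalar_real_apply hB,
    E.scalar_real_univ, hBy] at h1
  have h2 : ‖E.proj A y‖ ^ 2 = 0 := le_antisymm (by linarith) (by positivity)
  simpa using h2

lemma proj_mul {A B : Set ℝ} (hA : MeasurableSet A) (hB : MeasurableSet B) :
    E.proj A * E.proj B = E.proj (A ∩ B) := by
  have h1 : E.proj A = E.proj (A ∩ B) + E.proj (A \ B) := by
    rw [← E.proj_union (hA.inter hB) (hA.diff hB) disjoint_inf_sdiff, inter_union_sdiff]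
  have h2 : E.proj B = E.proj (A ∩ B) + E.proj (B \ A) := by
    rw [← E.proj_union (hA.inter hB) (hB.diff hA), inter_comm, inter_union_sdiff]
    rw [inter_comm]
    exact disjoint_inf_sdiff
  have hid := (E.isStarProjection _ (hA.inter hB)).isIdempotentElem.eq
  rw [h1, h2, add_mul, mul_add, mul_add, hid,
    E.proj_mul_of_disjoint (hA.inter hB) (hB.diff hA) (disjoint_sdiff_right.mono_left inter_subset_left),
    E.proj_mul_of_disjoint (hA.diff hB) (hA.inter hB) (disjoint_sdiff_left.mono_right inter_subset_right),
    E.proj_mul_of_disjoint (hA.diff hB) (hB.diff hA) (disjoint_sdiff_left.mono_right sdiff_subset)]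
  simp

/-- `T = ∫ f dE` in the sense of the diagonal matrix elements. -/
def Represents (f : ℝ → ℂ) (T : H →L[ℂ] H) : Prop :=
  ∀ x, ⟪x, T x⟫_ℂ = ∫ k, f k ∂(E.scalar x)

variable {E}

namespace Represents

variable {f g : ℝ → ℂ} {S T : H →L[ℂ] H}

lemma unique (hS : E.Represents f S) (hT : E.Represents f T) : S = T :=
  eq_of_forall_inner_self fun x => (hS x).trans (hT x).symm

lemma add (hf : IsBddMeasurable f) (hg : IsBddMeasurable g) (hS : E.Represents f S)
    (hT : E.Represents g T) : E.Represents (fun k => f k + g k) (S + T) := fun x => by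
  rw [add_apply, inner_add_right, hS, hT, integral_add (hf.integrable _) (hg.integrable _)]

lemma const_mul (c : ℂ) (hS : E.Represents f S) :
    E.Represents (fun k => c * f k) (c • S) := fun x => by
  rw [smul_apply, inner_smul_right, hS, integral_const_mul]

lemma sub (hf : IsBddMeasurable f) (hg : IsBddMeasurable g) (hS : E.Represents f S)
    (hT : E.Represents g T) : E.Represents (fun k => f k - g k) (S - T) := fun x => by
  rw [sub_apply, inner_sub_right, hS, hT, integral_sub (hf.integrable _) (hg.integrable _)]

lemma star (hS : E.Represents f S) :
    E.Represents (fun k => conj (f k)) (ContinuousLinearMap.adjoint S) := fun x => by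
  rw [ContinuousLinearMap.adjoint_inner_right, ← inner_conj_symm, hS, integral_conj]

lemma indicator_one {B : Set ℝ} (hB : MeasurableSet B) :
    E.Represents (B.indicator fun _ => 1) (E.proj B) := fun x => by
  rw [E.inner_proj hB, integral_indicator_const _ hB]
  simp

lemma indicator_const {B : Set ℝ} (hB : MeasurableSet B) (c : ℂ) :
    E.Represents (B.indicator fun _ => c) (c • E.proj B) := by
  have h := (indicator_one (E := E) hB).const_mul c
  convert h using 2 with k
  by_cases hk : k ∈ B <;> simp [hk]

lemma exists_simpleFunc (s : SimpleFunc ℝ ℂ) : ∃ T, E.Represents s T := by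
  induction s using SimpleFunc.induction with
  | @const c A hs =>
    refine ⟨c • E.proj A, ?_⟩
    simpa [SimpleFunc.coe_piecewise, Set.piecewise_eq_indicator] using! indicator_const hs c
  | add hd hf hg =>
    obtain ⟨S, hS⟩ := hf
    obtain ⟨T, hT⟩ := hg
    exact ⟨S + T, hS.add (.simpleFunc _) (.simpleFunc _) hT⟩

lemma simpleFunc_mul_proj (s : SimpleFunc ℝ ℂ) {B : Set ℝ} (hB : MeasurableSet B)
    {T : H →L[ℂ] H} (hT : E.Represents s T) :
    E.Represents (B.indicator s) (T * E.proj B) := by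
  induction s using SimpleFunc.induction generalizing T with
  | @const c A hs =>
    have h1 : E.Represents (A.indicator fun _ => c) T := by
      simpa [SimpleFunc.coe_piecewise, Set.piecewise_eq_indicator] using! hT
    rw [h1.unique (indicator_const hs c), smul_mul_assoc, E.proj_mul hs hB]
    have h2 := indicator_const (E := E) (hs.inter hB) c
    rw [inter_comm, ← Set.indicator_indicator, inter_comm] at h2
    simpa [SimpleFunc.coe_piecewise, Set.piecewise_eq_indicator] using! h2
  | add hd hf hg =>
    obtain ⟨S₁, hS₁⟩ := exists_simpleFunc (E := E) _
    obtain ⟨S₂, hS₂⟩ := exists_simpleFunc (E := E) _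
    rw [hT.unique (hS₁.add (.simpleFunc _) (.simpleFunc _) hS₂), add_mul]
    have := (hf hS₁).add ((IsBddMeasurable.simpleFunc _).indicator hB)
      ((IsBddMeasurable.simpleFunc _).indicator hB) (hg hS₂)
    convert this using 1
    exact Set.indicator_add _ _ _

lemma simpleFunc_mul (s t : SimpleFunc ℝ ℂ) {S T : H →L[ℂ] H} (hS : E.Represents s S)
    (hT : E.Represents t T) : E.Represents (fun k => s k * t k) (S * T) := by
  induction t using SimpleFunc.induction generalizing T with
  | @const c A hs =>
    have h1 : E.Represents (A.indicator fun _ => c) T := by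
      simpa [SimpleFunc.coe_piecewise, Set.piecewise_eq_indicator] using! hT
    rw [h1.unique (indicator_const hs c), mul_smul_comm]
    convert (simpleFunc_mul_proj s hs hS).const_mul c using 2 with k
    by_cases hk : k ∈ A <;> simp [hk, mul_comm, SimpleFunc.coe_piecewise]
  | add hd hf hg =>
    obtain ⟨S₁, hS₁⟩ := exists_simpleFunc (E := E) _
    obtain ⟨S₂, hS₂⟩ := exists_simpleFunc (E := E) _
    rw [hT.unique (hS₁.add (.simpleFunc _) (.simpleFunc _) hS₂), mul_add]
    have := (hf hS₁).add ((IsBddMeasurable.simpleFunc s).mul (.simpleFunc _))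
      ((IsBddMeasurable.simpleFunc s).mul (.simpleFunc _)) (hg hS₂)
    convert this using 2 with k
    simp [mul_add]

lemma simpleFunc_normSq (s : SimpleFunc ℝ ℂ) {S : H →L[ℂ] H} (hS : E.Represents s S) (x : H) :
    ‖S x‖ ^ 2 = ∫ k, ‖s k‖ ^ 2 ∂(E.scalar x) := by
  have h1 : E.Represents (s.map conj) (ContinuousLinearMap.adjoint S) := hS.star
  have h2 := simpleFunc_mul _ _ h1 hS x
  have h3 : ⟪x, (ContinuousLinearMap.adjoint S * S) x⟫_ℂ = ((‖S x‖ ^ 2 : ℝ) : ℂ) := by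
    rw [mul_apply_eq_comp, ContinuousLinearMap.adjoint_inner_right, inner_self_eq_ofReal_normSq]
  rw [h3] at h2
  have h4 : (fun k => (s.map conj) k * s k) = fun k => ((‖s k‖ ^ 2 : ℝ) : ℂ) := by
    funext k
    simp [Complex.conj_mul']
  rw [h4, integral_complex_ofReal] at h2
  exact_mod_cast h2

/-- The operators of boundedly convergent simple functions converge strongly. -/
lemma exists_tendsto {s : ℕ → SimpleFunc ℝ ℂ} {C : ℝ}
    (hC : ∀ n k, ‖s n k‖ ≤ C) (hlim : ∀ k, Tendsto (fun n => s n k) atTop (𝓝 (f k)))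
    {T : ℕ → H →L[ℂ] H} (hT : ∀ n, E.Represents (s n) (T n)) :
    ∃ S, E.Represents f S ∧ ∀ x, Tendsto (fun n => T n x) atTop (𝓝 (S x)) := by
  obtain ⟨S, hS⟩ := exists_strongLimit T fun x => by
    refine cauchySeq_of_normSq_sub_le_integral (μ := E.scalar x)
      (fun n => (s n).measurable.aestronglyMeasurable) (integrable_const (C ^ 2)) hC hlim fun n m => le_of_eq ?_
    exact simpleFunc_normSq (s n - s m) ((hT n).sub (.simpleFunc _) (.simpleFunc _) (hT m)) x
  refine ⟨S, fun x => ?_, hS⟩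
  refine tendsto_nhds_unique (tendsto_const_nhds.inner (hS x)) ?_
  simp_rw [hT _ x]
  exact tendsto_integral_of_dominated_convergence (fun _ => C)
    (fun n => (s n).measurable.aestronglyMeasurable) (integrable_const _)
    (fun n => Eventually.of_forall (hC n)) (Eventually.of_forall hlim)

end Represents

variable (E)

/-- The operator `∫ f dE` exists for bounded Borel `f`. -/
lemma represents_integralOp {f : ℝ → ℂ} (hf : IsBddMeasurable f) :
    E.Represents f (E.integralOp f) := by
  have h : ∃ T : H →L[ℂ] H, ∀ x, ⟪x, T x⟫_ℂ = ∫ k, f k ∂(E.scalar x) := by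
    obtain ⟨s, C, hC, hlim⟩ := hf.exists_simpleFunc_approx
    choose T hT using fun n => Represents.exists_simpleFunc (E := E) (s n)
    obtain ⟨S, hS, -⟩ := Represents.exists_tendsto hC hlim hT
    exact ⟨S, hS⟩
  rw [integralOp, dif_pos h]
  exact h.choose_spec

lemma inner_integralOp {f : ℝ → ℂ} (hf : IsBddMeasurable f) (x : H) :
    ⟪x, E.integralOp f x⟫_ℂ = ∫ k, f k ∂(E.scalar x) :=
  E.represents_integralOp hf x

variable {E} in
lemma Represents.eq_integralOp {f : ℝ → ℂ} (hf : IsBddMeasurable f) {T : H →L[ℂ] H}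
    (hT : E.Represents f T) : T = E.integralOp f :=
  hT.unique (E.represents_integralOp hf)

variable {f g : ℝ → ℂ}

lemma integralOp_add (hf : IsBddMeasurable f) (hg : IsBddMeasurable g) :
    E.integralOp (fun k => f k + g k) = E.integralOp f + E.integralOp g :=
  (((E.represents_integralOp hf).add hf hg (E.represents_integralOp hg)).eq_integralOp
    (hf.add hg)).symm

lemma integralOp_sub (hf : IsBddMeasurable f) (hg : IsBddMeasurable g) :
    E.integralOp (fun k => f k - g k) = E.integralOp f - E.integralOp g :=
  (((E.represents_integralOp hf).sub hf hg (E.represents_integralOp hg)).eq_integralOp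
    (hf.sub hg)).symm

lemma integralOp_const_mul (c : ℂ) (hf : IsBddMeasurable f) :
    E.integralOp (fun k => c * f k) = c • E.integralOp f :=
  (((E.represents_integralOp hf).const_mul c).eq_integralOp (hf.const_mul c)).symm

lemma integralOp_conj (hf : IsBddMeasurable f) :
    E.integralOp (fun k => conj (f k)) = ContinuousLinearMap.adjoint (E.integralOp f) :=
  ((E.represents_integralOp hf).star.eq_integralOp hf.star).symm

lemma integralOp_indicator_one {B : Set ℝ} (hB : MeasurableSet B) :
    E.integralOp (B.indicator fun _ => 1) = E.proj B :=
  ((Represents.indicator_one hB).eq_integralOp ((IsBddMeasurable.const 1).indicator hB)).symm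

lemma integralOp_one : E.integralOp (fun _ => 1) = 1 := by
  have h := E.integralOp_indicator_one MeasurableSet.univ
  rwa [indicator_univ, E.proj_univ] at h

lemma integralOp_const (c : ℂ) : E.integralOp (fun _ => c) = c • (1 : H →L[ℂ] H) := by
  have := E.integralOp_const_mul c (.const 1)
  simpa [E.integralOp_one] using this

lemma integralOp_mul (hf : IsBddMeasurable f) (hg : IsBddMeasurable g) :
    E.integralOp (fun k => f k * g k) = E.integralOp f * E.integralOp g := by
  obtain ⟨s, C, hC, hs⟩ := hf.star.exists_simpleFunc_approx
  obtain ⟨t, D, hD, ht⟩ := hg.exists_simpleFunc_approx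
  choose S hS using fun n => Represents.exists_simpleFunc (E := E) (s n)
  choose T hT using fun n => Represents.exists_simpleFunc (E := E) (t n)
  obtain ⟨S', hS', hSlim⟩ := Represents.exists_tendsto hC hs hS
  obtain ⟨T', hT', hTlim⟩ := Represents.exists_tendsto hD ht hT
  rw [hS'.eq_integralOp hf.star, E.integralOp_conj hf] at hSlim
  rw [hT'.eq_integralOp hg] at hTlim
  symm
  refine Represents.eq_integralOp (hf.mul hg) fun x => ?_
  refine tendsto_nhds_unique (f := fun n => ⟪S n x, T n x⟫_ℂ) (l := atTop) ?_ ?_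
  · rw [mul_apply_eq_comp, ← ContinuousLinearMap.adjoint_inner_left]
    exact (hSlim x).inner (hTlim x)
  · have h1 : ∀ n, ⟪S n x, T n x⟫_ℂ = ∫ k, conj (s n k) * t n k ∂(E.scalar x) := fun n => by
      have h := Represents.simpleFunc_mul ((s n).map conj) (t n) (hS n).star (hT n) x
      rw [mul_apply_eq_comp, ContinuousLinearMap.adjoint_inner_right] at h
      exact h
    simp_rw [h1]
    refine tendsto_integral_of_dominated_convergence (fun _ => C * D)
      (fun n => ((Complex.continuous_conj.measurable.comp (s n).measurable).mul
        (t n).measurable).aestronglyMeasurable) (integrable_const _)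
      (fun n => Eventually.of_forall fun k => ?_) (Eventually.of_forall fun k => ?_)
    · rw [norm_mul, RCLike.norm_conj]
      exact mul_le_mul (hC n k) (hD n k) (norm_nonneg _) ((norm_nonneg _).trans (hC n k))
    · simpa using! ((Complex.continuous_conj.tendsto _).comp (hs k)).mul (ht k)

lemma integralOp_mul_apply (hf : IsBddMeasurable f) (hg : IsBddMeasurable g) (x : H) :
    E.integralOp f (E.integralOp g x) = E.integralOp (fun k => f k * g k) x := by
  rw [E.integralOp_mul hf hg, mul_apply_eq_comp]

lemma inner_integralOp_integralOp (hf : IsBddMeasurable f) (hg : IsBddMeasurable g) (x : H) :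
    ⟪E.integralOp f x, E.integralOp g x⟫_ℂ = ∫ k, conj (f k) * g k ∂(E.scalar x) := by
  rw [← ContinuousLinearMap.adjoint_inner_right, ← E.integralOp_conj hf,
    E.integralOp_mul_apply hf.star hg, E.inner_integralOp (hf.star.mul hg)]

lemma normSq_integralOp (hf : IsBddMeasurable f) (x : H) :
    ‖E.integralOp f x‖ ^ 2 = ∫ k, ‖f k‖ ^ 2 ∂(E.scalar x) := by
  have h := E.inner_integralOp_integralOp hf hf x
  have h4 : (fun k => conj (f k) * f k) = fun k => ((‖f k‖ ^ 2 : ℝ) : ℂ) := by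
    funext k
    simp [Complex.conj_mul']
  rw [h4, integral_complex_ofReal, inner_self_eq_ofReal_normSq] at h
  exact_mod_cast h

/-- The spectral measure of `f(A) x` is `|f|²` times that of `x`. -/
lemma scalar_integralOp (hf : IsBddMeasurable f) (x : H) :
    E.scalar (E.integralOp f x) =
      (E.scalar x).withDensity fun k => ENNReal.ofReal (‖f k‖ ^ 2) := by
  ext B hB
  rw [withDensity_apply _ hB, E.scalar_eq_normSq hB, ← E.integralOp_indicator_one hB,
    E.integralOp_mul_apply ((IsBddMeasurable.const 1).indicator hB) hf,
    E.normSq_integralOp (((IsBddMeasurable.const 1).indicator hB).mul hf),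
    ← ofReal_integral_eq_lintegral_ofReal (hf.integrable_normSq _)
      (Eventually.of_forall fun k => by positivity), ← integral_indicator hB]
  congr 2
  funext k
  by_cases hk : k ∈ B <;> simp [hk]

/-- Bounded pointwise convergence of functions gives strong convergence of the operators. -/
lemma tendsto_integralOp {φ : ℕ → ℝ → ℂ} (hφ : ∀ n, IsBddMeasurable (φ n))
    (hf : IsBddMeasurable f) {C : ℝ} (hC : ∀ n k, ‖φ n k‖ ≤ C)
    (hlim : ∀ k, Tendsto (fun n => φ n k) atTop (𝓝 (f k))) (x : H) :
    Tendsto (fun n => E.integralOp (φ n) x) atTop (𝓝 (E.integralOp f x)) := by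
  obtain ⟨D, hD⟩ := hf.exists_bound
  have h0 : Tendsto (fun n => ∫ k, ‖φ n k - f k‖ ^ 2 ∂(E.scalar x)) atTop
      (𝓝 (∫ _, (0 : ℝ) ∂(E.scalar x))) := by
    refine tendsto_integral_of_dominated_convergence (fun _ => (C + D) ^ 2)
      (fun n => (((hφ n).sub hf).measurable.norm.pow_const 2).aestronglyMeasurable)
      (integrable_const _) (fun n => Eventually.of_forall fun k => ?_)
      (Eventually.of_forall fun k => ?_)
    · rw [Real.norm_of_nonneg (by positivity)]
      gcongr
      exact (norm_sub_le _ _).trans (add_le_add (hC n k) (hD k))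
    · simpa using (((hlim k).sub_const (f k)).norm.pow 2)
  rw [tendsto_iff_norm_sub_tendsto_zero]
  have h1 : ∀ n, ‖E.integralOp (φ n) x - E.integralOp f x‖ =
      Real.sqrt (∫ k, ‖φ n k - f k‖ ^ 2 ∂(E.scalar x)) := fun n => by
    rw [← E.normSq_integralOp ((hφ n).sub hf), E.integralOp_sub (hφ n) hf, sub_apply,
      Real.sqrt_sq (norm_nonneg _)]
  simp_rw [h1]
  simpa using h0.sqrt

lemma integralOp_apply_eq_of_ae {x : H} (hf : IsBddMeasurable f) (hg : IsBddMeasurable g)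
    (h : f =ᵐ[E.scalar x] g) : E.integralOp f x = E.integralOp g x := by
  rw [← sub_eq_zero, ← sub_apply, ← E.integralOp_sub hf hg, ← norm_eq_zero,
    ← sq_eq_zero_iff, E.normSq_integralOp (hf.sub hg)]
  refine integral_eq_zero_of_ae ?_
  filter_upwards [h] with k hk
  simp [hk]

lemma scalar_map {h : ℝ → ℝ} (hh : Measurable h) (x : H) :
    (E.map h hh).scalar x = (E.scalar x).map h := by
  ext B hB
  rw [Measure.map_apply hh hB, scalar_apply _ _ hB, scalar_apply _ _ (hh hB)]
  rfl

lemma integralOp_map {h : ℝ → ℝ} (hh : Measurable h) (hf : IsBddMeasurable f) :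
    (E.map h hh).integralOp f = E.integralOp fun k => f (h k) := by
  refine (Represents.eq_integralOp hf fun x => ?_).symm
  rw [E.inner_integralOp (hf.comp hh), scalar_map,
    integral_map hh.aemeasurable hf.measurable.aestronglyMeasurable]

end ProjValuedMeasure

/-! ### The spectral theorem for bounded self-adjoint operators -/

section SpectralTheorem

variable {H : Type u} [NormedAddCommGroup H] [InnerProductSpace ℂ H] [CompleteSpace H]

/-- Given a family of measures `μ x` indexed by the vectors `x`, the orthogonal projection `T` has
the diagonal matrix elements `⟨x, T x⟩ = μ x B`. -/
structure IsProjectionFor {X : Type*} [MeasurableSpace X] (μ : H → Measure X) (B : Set X)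
    (T : H →L[ℂ] H) : Prop where
  isStarProjection : IsStarProjection T
  inner_eq : ∀ x, ⟪x, T x⟫_ℂ = ((μ x).real B : ℂ)

lemma isStarProjection_of_inner_eq_normSq {T : H →L[ℂ] H}
    (h : ∀ x, ⟪x, T x⟫_ℂ = ((‖T x‖ ^ 2 : ℝ) : ℂ)) : IsStarProjection T := by
  have h1 : T = star T * T := eq_of_forall_inner_self fun x => by
    rw [h, mul_apply_eq_comp, ContinuousLinearMap.star_eq_adjoint,
      ContinuousLinearMap.adjoint_inner_right, inner_self_eq_ofReal_normSq]
  have h2 : star T = T := by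
    conv_lhs => rw [h1]
    rw [star_mul, star_star, ← h1]
  refine ⟨?_, h2⟩
  rw [h2] at h1
  exact h1.symm

namespace IsProjectionFor

variable {X : Type*} [MeasurableSpace X] {μ : H → Measure X} {A B : Set X} {S T : H →L[ℂ] H}

lemma apply_apply (hT : IsProjectionFor μ B T) (x : H) : T (T x) = T x :=
  congrArg (fun T : H →L[ℂ] H => T x) hT.isStarProjection.isIdempotentElem.eq

lemma inner_left_eq (hT : IsProjectionFor μ B T) (x y : H) : ⟪T x, y⟫_ℂ = ⟪x, T y⟫_ℂ := by
  have h2 : ContinuousLinearMap.adjoint T = T := hT.isStarProjection.isSelfAdjoint.star_eq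
  rw [← ContinuousLinearMap.adjoint_inner_right, h2]

lemma normSq_eq (hT : IsProjectionFor μ B T) (x : H) : ‖T x‖ ^ 2 = (μ x).real B := by
  have h := hT.inner_eq x
  rw [← hT.apply_apply, ← hT.inner_left_eq, inner_self_eq_ofReal_normSq] at h
  exact_mod_cast h

variable [∀ x, IsFiniteMeasure (μ x)] (hμ : ∀ x, (μ x).real univ = ‖x‖ ^ 2)
include hμ

lemma compl (hB : MeasurableSet B) (hT : IsProjectionFor μ B T) :
    IsProjectionFor μ Bᶜ (1 - T) := by
  refine ⟨hT.isStarProjection.one_sub, fun x => ?_⟩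
  rw [sub_apply, inner_sub_right, hT.inner_eq, measureReal_compl hB, hμ, one_apply_eq_self,
    inner_self_eq_ofReal_normSq]
  push_cast
  rfl

lemma mul_of_disjoint (hB : MeasurableSet B) (hS : IsProjectionFor μ A S)
    (hT : IsProjectionFor μ B T) (hd : Disjoint A B) : S * T = 0 := by
  ext x
  have h1 : (μ (T x)).real (A ∪ B) ≤ (μ (T x)).real univ := measureReal_mono (subset_univ _)
  rw [measureReal_union hd hB, ← hS.normSq_eq, ← hT.normSq_eq, hμ, hT.apply_apply] at h1
  have h2 : ‖S (T x)‖ ^ 2 = 0 := le_antisymm (by linarith) (by positivity)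
  simpa using h2

lemma union_of_disjoint (hB : MeasurableSet B) (hS : IsProjectionFor μ A S)
    (hT : IsProjectionFor μ B T) (hd : Disjoint A B) : IsProjectionFor μ (A ∪ B) (S + T) := by
  refine ⟨hS.isStarProjection.add hT.isStarProjection (hS.mul_of_disjoint hμ hB hT hd),
    fun x => ?_⟩
  rw [add_apply, inner_add_right, hS.inner_eq, hT.inner_eq, measureReal_union hd hB]
  push_cast
  rfl

lemma biUnion_finset {B : ℕ → Set X} {T : ℕ → H →L[ℂ] H} (hB : ∀ n, MeasurableSet (B n))
    (hd : Pairwise (Function.onFun Disjoint B)) (hT : ∀ n, IsProjectionFor μ (B n) (T n))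
    (s : Finset ℕ) : IsProjectionFor μ (⋃ n ∈ s, B n) (∑ n ∈ s, T n) := by
  classical
  induction s using Finset.induction_on with
  | empty =>
    exact ⟨by simp, fun x => by simp⟩
  | insert a s ha ih =>
    rw [Finset.sum_insert ha, add_comm, Finset.set_biUnion_insert, union_comm]
    refine ih.union_of_disjoint hμ (hB a) (hT a) ?_
    rw [disjoint_iUnion₂_left]
    intro i hi
    exact hd (by rintro rfl; exact ha hi)

lemma normSq_sub (hB : MeasurableSet B) (hS : IsProjectionFor μ A S)
    (hT : IsProjectionFor μ B T) (hAB : A ⊆ B) (x : H) :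
    ‖T x - S x‖ ^ 2 = (μ x).real B - (μ x).real A := by
  have h1 := hS.mul_of_disjoint hμ hB.compl (hT.compl hμ hB) (disjoint_compl_right_iff_subset.2 hAB)
  rw [mul_sub, mul_one, sub_eq_zero] at h1
  have h2 : ⟪T x, S x⟫_ℂ = ((μ x).real A : ℂ) := by
    rw [← hS.apply_apply, ← hS.inner_left_eq, ← mul_apply_eq_comp, ← h1,
      inner_self_eq_ofReal_normSq, hS.normSq_eq]
  rw [@norm_sub_sq ℂ, h2, hS.normSq_eq, hT.normSq_eq, RCLike.re_to_complex, Complex.ofReal_re]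
  ring

lemma exists_iUnion {B : ℕ → Set X} (hB : ∀ n, MeasurableSet (B n))
    (hd : Pairwise (Function.onFun Disjoint B)) (h : ∀ n, ∃ T, IsProjectionFor μ (B n) T) :
    ∃ T, IsProjectionFor μ (⋃ n, B n) T := by
  choose T hT using h
  set A : ℕ → Set X := fun N => ⋃ n ∈ Finset.range N, B n with hA
  have hAm : ∀ N, MeasurableSet (A N) := fun N => Finset.measurableSet_biUnion _ fun n _ => hB n
  have hmono : Monotone A := fun N M h => biUnion_subset_biUnion_left fun n hn => by
    simp only [Finset.coe_range, mem_Iio] at hn ⊢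
    omega
  have hAU : ⋃ N, A N = ⋃ n, B n := by
    ext k
    simp only [hA, mem_iUnion, Finset.mem_range, exists_prop]
    exact ⟨fun ⟨N, n, _, hn⟩ => ⟨n, hn⟩, fun ⟨n, hn⟩ => ⟨n + 1, n, Nat.lt_succ_self n, hn⟩⟩
  have hS : ∀ N, IsProjectionFor μ (A N) (∑ n ∈ Finset.range N, T n) := fun N =>
    biUnion_finset hμ hB hd hT _
  have hlim : ∀ x, Tendsto (fun N => (μ x).real (A N)) atTop (𝓝 ((μ x).real (⋃ n, B n))) := by
    intro x
    rw [← hAU]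
    exact (ENNReal.tendsto_toReal (measure_ne_top _ _)).comp (tendsto_measure_iUnion_atTop hmono)
  obtain ⟨S, hSlim⟩ := exists_strongLimit (fun N => ∑ n ∈ Finset.range N, T n) fun x => by
    have hcs := (hlim x).cauchySeq
    rw [cauchySeq_iff_tendsto_dist_atTop_0] at hcs ⊢
    have h1 : ∀ p : ℕ × ℕ, dist ((∑ n ∈ Finset.range p.1, T n) x)
        ((∑ n ∈ Finset.range p.2, T n) x) =
        Real.sqrt (dist ((μ x).real (A p.1)) ((μ x).real (A p.2))) := fun p => by
      rw [eq_comm, Real.sqrt_eq_iff_eq_sq dist_nonneg dist_nonneg]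
      rcases le_total p.1 p.2 with hp | hp
      · rw [dist_comm, dist_comm (α := H), dist_eq_norm (E := H),
          (hS p.1).normSq_sub hμ (hAm _) (hS p.2) (hmono hp), Real.dist_eq, abs_of_nonneg]
        exact sub_nonneg.2 (measureReal_mono (hmono hp) (measure_ne_top _ _))
      · rw [dist_eq_norm (E := H),
          (hS p.2).normSq_sub hμ (hAm _) (hS p.1) (hmono hp), Real.dist_eq, abs_of_nonneg]
        exact sub_nonneg.2 (measureReal_mono (hmono hp) (measure_ne_top _ _))
    simp_rw [h1]
    simpa using hcs.sqrt
  have h1 : ∀ x, ⟪x, S x⟫_ℂ = ((μ x).real (⋃ n, B n) : ℂ) := fun x => by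
    refine tendsto_nhds_unique (tendsto_const_nhds.inner (hSlim x)) ?_
    simp_rw [(hS _).inner_eq x]
    exact (Complex.continuous_ofReal.tendsto _).comp (hlim x)
  have h2 : ∀ x, ‖S x‖ ^ 2 = (μ x).real (⋃ n, B n) := fun x => by
    refine tendsto_nhds_unique ((hSlim x).norm.pow 2) ?_
    simp_rw [(hS _).normSq_eq x]
    exact hlim x
  exact ⟨S, isStarProjection_of_inner_eq_normSq fun x => by rw [h1, h2], h1⟩

end IsProjectionFor

/-- A family of measures whose projections exist for all measurable sets is the family of scalar
spectral measures of a projection-valued measure, after transport to the line. -/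
lemma exists_projValuedMeasure {X : Type*} [MeasurableSpace X] {μ : H → Measure X}
    [∀ x, IsFiniteMeasure (μ x)] (hμ : ∀ x, (μ x).real univ = ‖x‖ ^ 2)
    (h : ∀ B, MeasurableSet B → ∃ T, IsProjectionFor μ B T) {f : X → ℝ} (hf : Measurable f) :
    ∃ E : ProjValuedMeasure H, ∀ x, E.scalar x = (μ x).map f := by
  classical
  choose! P hP using h
  refine ⟨⟨fun B => P (f ⁻¹' B), fun B hB => (hP _ (hf hB)).isStarProjection, ?_, ?_⟩, ?_⟩
  · refine eq_of_forall_inner_self fun x => ?_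
    rw [(hP _ (hf MeasurableSet.univ)).inner_eq, preimage_univ, hμ, one_apply_eq_self,
      inner_self_eq_ofReal_normSq]
  · intro B hB hd x
    have hB' : ∀ n, MeasurableSet (f ⁻¹' B n) := fun n => hf (hB n)
    have hd' : Pairwise (Function.onFun Disjoint fun n => f ⁻¹' B n) :=
      fun i j hij => (hd hij).preimage f
    rw [preimage_iUnion]
    have hU := hP _ (MeasurableSet.iUnion hB')
    have hsum : HasSum (fun n => (μ x).real (f ⁻¹' B n)) ((μ x).real (⋃ n, f ⁻¹' B n)) := by
      have h1 := measure_iUnion (μ := μ x) hd' hB'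
      have h2 : ∑' n, μ x (f ⁻¹' B n) ≠ ∞ := h1 ▸ measure_ne_top _ _
      rw [measureReal_def, h1, ENNReal.tsum_toReal_eq fun n => measure_ne_top _ _]
      exact (ENNReal.summable_toReal h2).hasSum
    rw [HasSum, SummationFilter.unconditional_filter, tendsto_iff_norm_sub_tendsto_zero]
    have h1 : ∀ s : Finset ℕ, ‖∑ n ∈ s, P (f ⁻¹' B n) x - P (⋃ n, f ⁻¹' B n) x‖ =
        Real.sqrt ((μ x).real (⋃ n, f ⁻¹' B n) - ∑ n ∈ s, (μ x).real (f ⁻¹' B n)) := fun s => by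
      have hs := IsProjectionFor.biUnion_finset hμ hB' hd' (fun n => hP _ (hB' n)) s
      rw [eq_comm, Real.sqrt_eq_iff_eq_sq _ (norm_nonneg _), norm_sub_rev,
        ← sum_apply, hs.normSq_sub hμ (MeasurableSet.iUnion hB') hU,
        measureReal_biUnion_finset (fun i _ j _ hij => hd' hij) (fun n _ => hB' n)]
      · exact iUnion₂_subset fun n _ => subset_iUnion (fun n => f ⁻¹' B n) n
      · exact sub_nonneg.2 (sum_le_hasSum _ (fun _ _ => measureReal_nonneg) hsum)
    simp_rw [h1]
    have h2 : Tendsto (fun s : Finset ℕ => ∑ n ∈ s, (μ x).real (f ⁻¹' B n)) atTop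
      (𝓝 ((μ x).real (⋃ n, f ⁻¹' B n))) := hsum
    simpa using (h2.const_sub ((μ x).real (⋃ n, f ⁻¹' B n))).sqrt
  · intro x
    ext B hB
    rw [ProjValuedMeasure.scalar_apply _ _ hB, Measure.map_apply hf hB]
    change ENNReal.ofReal (⟪x, P (f ⁻¹' B) x⟫_ℂ).re = _
    rw [(hP _ (hf hB)).inner_eq, Complex.ofReal_re, ofReal_measureReal]

section ContinuousFunctionalCalculus

variable {X : Type*} [TopologicalSpace X] (Φ : C(X, ℝ) →⋆ₐ[ℝ] (H →L[ℂ] H))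

lemma inner_starAlgHom_mul_self (f : C(X, ℝ)) (x : H) :
    ⟪x, Φ (f * f) x⟫_ℂ = ((‖Φ f x‖ ^ 2 : ℝ) : ℂ) := by
  have h : ContinuousLinearMap.adjoint (Φ f) = Φ f := by
    rw [← ContinuousLinearMap.star_eq_adjoint, ← map_star]
    rfl
  rw [map_mul, mul_apply_eq_comp, ← ContinuousLinearMap.adjoint_inner_left, h,
    inner_self_eq_ofReal_normSq]

/-- The scalar spectral measures of a representation of `C(X, ℝ)`, by Riesz–Markov–Kakutani. -/
lemma exists_measure_starAlgHom [CompactSpace X] [T2Space X] [MeasurableSpace X] [BorelSpace X]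
    (x : H) :
    ∃ μ : Measure X, IsFiniteMeasure μ ∧ ∀ f : C(X, ℝ), ∫ k, f k ∂μ = (⟪x, Φ f x⟫_ℂ).re := by
  let L : CompactlySupportedContinuousMap X ℝ →ₗ[ℝ] ℝ :=
    { toFun := fun f => (⟪x, Φ f.toContinuousMap x⟫_ℂ).re
      map_add' := fun f g => by
        have : (f + g).toContinuousMap = f.toContinuousMap + g.toContinuousMap := rfl
        rw [this, map_add, add_apply, inner_add_right, Complex.add_re]
      map_smul' := fun c f => by
        have : (c • f).toContinuousMap = c • f.toContinuousMap := rfl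
        rw [this, map_smul, smul_apply, RCLike.real_smul_eq_coe_smul (K := ℂ) c, inner_smul_right]
        simp }
  let Λ := PositiveLinearMap.mk₀ L fun f hf => by
    let g : C(X, ℝ) := ⟨fun k => Real.sqrt (f k), by fun_prop⟩
    have hg : f.toContinuousMap = g * g := by
      ext k
      exact (Real.mul_self_sqrt (hf k)).symm
    change 0 ≤ (⟪x, Φ f.toContinuousMap x⟫_ℂ).re
    rw [hg, inner_starAlgHom_mul_self, Complex.ofReal_re]
    positivity
  refine ⟨RealRMK.rieszMeasure Λ, inferInstance, fun f => ?_⟩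
  exact RealRMK.integral_rieszMeasure Λ (CompactlySupportedContinuousMap.continuousMapEquiv f)

/-- Existence of the spectral projections of closed sets, as strong limits of continuous
functions, and of all Borel sets by induction. -/
lemma exists_isProjectionFor [MeasurableSpace X] [BorelSpace X] [HasOuterApproxClosed X] {μ : H → Measure X}
    [∀ x, IsFiniteMeasure (μ x)]
    (hμ : ∀ x, ∀ f : C(X, ℝ), ∫ k, f k ∂(μ x) = (⟪x, Φ f x⟫_ℂ).re) {B : Set X}
    (hB : MeasurableSet B) : ∃ T, IsProjectionFor μ B T := by
  have hΦ : ∀ (f : C(X, ℝ)) x, ⟪x, Φ f x⟫_ℂ = ((∫ k, f k ∂(μ x) : ℝ) : ℂ) := fun f x => by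
    rw [hμ]
    refine (Complex.conj_eq_iff_re.1 ?_).symm
    rw [inner_conj_symm, ← ContinuousLinearMap.adjoint_inner_right,
      ← ContinuousLinearMap.star_eq_adjoint, ← map_star]
    rfl
  have hnorm : ∀ (f : C(X, ℝ)) x, ‖Φ f x‖ ^ 2 = ∫ k, f k ^ 2 ∂(μ x) := fun f x => by
    have h := (inner_starAlgHom_mul_self Φ f x).symm.trans (hΦ _ x)
    rw [Complex.ofReal_inj] at h
    rw [h]
    refine integral_congr_ae (Eventually.of_forall fun k => ?_)
    simp [sq]
  have huniv : ∀ x, (μ x).real univ = ‖x‖ ^ 2 := fun x => by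
    have h := hμ x 1
    rw [map_one, one_apply_eq_self, inner_self_eq_ofReal_normSq, Complex.ofReal_re] at h
    simpa using h
  refine MeasurableSpace.induction_on_inter (C := fun B _ => ∃ T, IsProjectionFor μ B T)
    (BorelSpace.measurable_eq.trans borel_eq_generateFrom_isClosed) isPiSystem_isClosed
    ?_ ?_ ?_ ?_ B hB
  · exact ⟨0, IsStarProjection.zero _, fun x => by simp⟩
  · intro F hF
    have hF' : IsClosed F := hF
    let f : ℕ → C(X, ℝ) := fun n => ⟨fun k => (hF'.apprSeq n k : ℝ), by fun_prop⟩
    have hf1 : ∀ n k, ‖f n k‖ ≤ 1 := fun n k => by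
      change ‖((hF'.apprSeq n k : NNReal) : ℝ)‖ ≤ 1
      rw [Real.norm_of_nonneg (NNReal.coe_nonneg _)]
      exact_mod_cast HasOuterApproxClosed.apprSeq_apply_le_one hF' n k
    have hflim : ∀ k, Tendsto (fun n => f n k) atTop (𝓝 (F.indicator (fun _ => (1 : ℝ)) k)) := by
      intro k
      have h := (tendsto_pi_nhds.1 (HasOuterApproxClosed.tendsto_apprSeq hF')) k
      have h2 := (NNReal.continuous_coe.tendsto _).comp h
      by_cases hk : k ∈ F <;> simpa [hk] using! h2
    have hfm : ∀ n x, AEStronglyMeasurable (f n) (μ x) := fun n x =>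
      (f n).continuous.measurable.aestronglyMeasurable
    obtain ⟨S, hS⟩ := exists_strongLimit (fun n => Φ (f n)) fun x => by
      refine cauchySeq_of_normSq_sub_le_integral (μ := μ x) (fun n => hfm n x)
        (integrable_const (1 ^ 2)) hf1 hflim
        fun n m => ?_
      rw [← sub_apply, ← map_sub, hnorm]
      simp
    have h0 : ∀ x, ∫ k, F.indicator (fun _ => (1 : ℝ)) k ∂(μ x) = (μ x).real F := fun x => by
      rw [integral_indicator_const _ hF'.measurableSet]
      simp
    have h1 : ∀ x, ⟪x, S x⟫_ℂ = ((μ x).real F : ℂ) := fun x => by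
      refine tendsto_nhds_unique (tendsto_const_nhds.inner (hS x)) ?_
      simp_rw [hΦ _ x]
      refine (Complex.continuous_ofReal.tendsto _).comp ?_
      rw [← h0]
      exact tendsto_integral_of_dominated_convergence (fun _ => 1) (fun n => hfm n x)
        (integrable_const _) (fun n => Eventually.of_forall (hf1 n)) (Eventually.of_forall hflim)
    have h2 : ∀ x, ‖S x‖ ^ 2 = (μ x).real F := fun x => by
      refine tendsto_nhds_unique ((hS x).norm.pow 2) ?_
      simp_rw [hnorm _ x]
      rw [← h0]
      refine tendsto_integral_of_dominated_convergence (fun _ => 1) (fun n => (hfm n x).pow 2)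
        (integrable_const _) (fun n => Eventually.of_forall fun k => ?_)
        (Eventually.of_forall fun k => ?_)
      · rw [norm_pow]
        exact pow_le_one₀ (norm_nonneg _) (hf1 n k)
      · have := (hflim k).pow 2
        by_cases hk : k ∈ F <;> simpa [hk] using this
    exact ⟨S, isStarProjection_of_inner_eq_normSq fun x => by rw [h1, h2], h1⟩
  · intro B hB ih
    obtain ⟨T, hT⟩ := ih
    exact ⟨1 - T, hT.compl huniv hB⟩
  · intro B hd hB ih
    exact IsProjectionFor.exists_iUnion huniv hB hd ih

end ContinuousFunctionalCalculus

/-- The spectral theorem for a bounded self-adjoint operator, with spectral measure carried by the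
spectrum. -/
theorem IsSelfAdjoint.exists_projValuedMeasure {R : H →L[ℂ] H} (hR : IsSelfAdjoint R) :
    ∃ E : ProjValuedMeasure H, (∀ x, E.scalar x (spectrum ℝ R)ᶜ = 0) ∧
      ∀ x, ⟪x, R x⟫_ℂ = ((∫ r, r ∂(E.scalar x) : ℝ) : ℂ) := by
  let Φ : C(spectrum ℝ R, ℝ) →⋆ₐ[ℝ] (H →L[ℂ] H) := cfcHom hR
  choose μ hfin hμ using exists_measure_starAlgHom Φ
  have huniv : ∀ x, (μ x).real univ = ‖x‖ ^ 2 := fun x => by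
    have h := hμ x 1
    rw [map_one, one_apply_eq_self, inner_self_eq_ofReal_normSq, Complex.ofReal_re] at h
    simpa using h
  obtain ⟨E, hE⟩ := _root_.exists_projValuedMeasure huniv
    (fun B hB => exists_isProjectionFor Φ hμ hB) (f := Subtype.val) measurable_subtype_coe
  have hcl : MeasurableSet (spectrum ℝ R) := (spectrum.isClosed R).measurableSet
  refine ⟨E, fun x => ?_, fun x => ?_⟩
  · rw [hE, Measure.map_apply measurable_subtype_coe hcl.compl]
    simp
  · rw [hE, integral_map measurable_subtype_coe.aemeasurable
      (f := fun r : ℝ => r) measurable_id.aestronglyMeasurable]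
    have h := hμ x (ContinuousMap.restrict (spectrum ℝ R) (ContinuousMap.id ℝ))
    have h2 : Φ (ContinuousMap.restrict (spectrum ℝ R) (ContinuousMap.id ℝ)) = R := cfcHom_id hR
    rw [h2] at h
    have h3 : (⟪x, R x⟫_ℂ).re = ⟪x, R x⟫_ℂ := by
      refine Complex.conj_eq_iff_re.1 ?_
      rw [inner_conj_symm, ← ContinuousLinearMap.adjoint_inner_right,
        ← ContinuousLinearMap.star_eq_adjoint, hR.star_eq]
    rw [← h3, ← h]
    simp

end SpectralTheorem

/-! ### The spectral theorem for positive self-adjoint operators given by their graphs -/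

section PositiveSelfAdjoint

variable {H : Type u} [NormedAddCommGroup H] [InnerProductSpace ℂ H]

/-- `G` is the graph of a positive self-adjoint operator `A`. Self-adjointness is encoded as
symmetry together with surjectivity of `1 + A`. -/
structure IsPositiveSelfAdjointGraph (G : Set (H × H)) : Prop where
  add_mem : ∀ p ∈ G, ∀ q ∈ G, p + q ∈ G
  smul_mem : ∀ (c : ℂ), ∀ p ∈ G, c • p ∈ G
  symm : ∀ p ∈ G, ∀ q ∈ G, ⟪p.1, q.2⟫_ℂ = ⟪p.2, q.1⟫_ℂ
  nonneg : ∀ p ∈ G, 0 ≤ (⟪p.1, p.2⟫_ℂ).re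
  exists_mem : ∀ x, ∃ w, (w, x - w) ∈ G
  eq_zero_of_mem : ∀ z, ((0 : H), z) ∈ G → z = 0

namespace IsPositiveSelfAdjointGraph

variable {G : Set (H × H)} (hG : IsPositiveSelfAdjointGraph G)
include hG

lemma sub_mem {p q : H × H} (hp : p ∈ G) (hq : q ∈ G) : p - q ∈ G := by
  have := hG.add_mem _ hp _ (hG.smul_mem (-1) _ hq)
  simpa [sub_eq_add_neg] using this

lemma unique_resolvent {x w w' : H} (h : (w, x - w) ∈ G) (h' : (w', x - w') ∈ G) : w = w' := by
  have h1 := hG.nonneg _ (hG.sub_mem h h')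
  have h2 : ((w, x - w) - (w', x - w') : H × H) = (w - w', -(w - w')) := by
    ext
    · rfl
    · change x - w - (x - w') = -(w - w')
      abel
  rw [h2, inner_neg_right, inner_self_eq_ofReal_normSq, ← Complex.ofReal_neg,
    Complex.ofReal_re] at h1
  have h3 : ‖w - w'‖ ^ 2 = 0 := le_antisymm (by linarith) (by positivity)
  simpa [sub_eq_zero] using h3

/-- The resolvent `(1 + A)⁻¹` of a positive self-adjoint operator, together with the fact that it
determines the graph. -/
lemma exists_resolvent [CompleteSpace H] : ∃ R : H →L[ℂ] H, IsSelfAdjoint R ∧ 0 ≤ R ∧ ‖R‖ ≤ 1 ∧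
    (∀ w z, (w, z) ∈ G ↔ R (w + z) = w) ∧ ∀ x, R x = 0 → x = 0 := by
  choose r hr using hG.exists_mem
  have huniq : ∀ x w, (w, x - w) ∈ G → r x = w := fun x w h => hG.unique_resolvent (hr x) h
  have hbound : ∀ x, ‖r x‖ ≤ 1 * ‖x‖ := fun x => by
    have h1 := hG.nonneg _ (hr x)
    have h2 : ‖x‖ ^ 2 = ‖r x + (x - r x)‖ ^ 2 := by congr 2; abel
    rw [@norm_add_sq ℂ, RCLike.re_to_complex] at h2
    rw [one_mul]
    refine le_of_sq_le_sq ?_ (norm_nonneg _)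
    nlinarith [sq_nonneg ‖x - r x‖]
  let L : H →ₗ[ℂ] H :=
    { toFun := r
      map_add' := fun x y => huniq _ _ (by
        have := hG.add_mem _ (hr x) _ (hr y)
        rw [Prod.mk_add_mk] at this
        convert this using 2
        abel)
      map_smul' := fun c x => huniq _ _ (by
        have := hG.smul_mem c _ (hr x)
        rw [Prod.smul_mk, smul_sub] at this
        exact this) }
  let R : H →L[ℂ] H := L.mkContinuous 1 hbound
  have hRr : ∀ x, R x = r x := fun x => rfl
  have hsymm : ∀ x y, ⟪r x, y⟫_ℂ = ⟪x, r y⟫_ℂ := fun x y => by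
    have h := hG.symm _ (hr x) _ (hr y)
    simp only [inner_sub_left, inner_sub_right] at h
    linear_combination h
  have hsa : IsSelfAdjoint R := by
    rw [ContinuousLinearMap.isSelfAdjoint_iff_isSymmetric]
    exact fun x y => hsymm x y
  refine ⟨R, hsa, ?_, L.mkContinuous_norm_le zero_le_one hbound, fun w z => ⟨fun h => ?_,
    fun h => ?_⟩, fun x hx => ?_⟩
  · rw [ContinuousLinearMap.nonneg_iff_isPositive, ContinuousLinearMap.isPositive_iff_complex]
    intro x
    have h1 := hG.nonneg _ (hr x)
    have h2 : ⟪r x, x⟫_ℂ = ⟪r x, r x⟫_ℂ + ⟪r x, x - r x⟫_ℂ := by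
      rw [← inner_add_right]
      congr 1
      abel
    refine ⟨?_, ?_⟩
    · rw [RCLike.re_to_complex]
      refine Complex.conj_eq_iff_re.1 ?_
      rw [inner_conj_symm, hRr, hsymm]
    · rw [RCLike.re_to_complex, hRr, h2, Complex.add_re, inner_self_eq_ofReal_normSq,
        Complex.ofReal_re]
      positivity
  · exact huniq _ _ (by simpa using h)
  · have := hr (w + z)
    rw [hRr] at h
    rw [h] at this
    simpa using this
  · have := hr x
    rw [hRr] at hx
    rw [hx, sub_zero] at this
    exact hG.eq_zero_of_mem _ this

lemma isClosed [CompleteSpace H] : IsClosed G := by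
  obtain ⟨R, -, -, -, hR, -⟩ := hG.exists_resolvent
  have : G = {p : H × H | R (p.1 + p.2) = p.1} := by
    ext ⟨w, z⟩
    exact hR w z
  rw [this]
  exact isClosed_eq (by fun_prop) (by fun_prop)

/-- The spectral theorem for positive self-adjoint operators, obtained from the bounded one for
`R = (1 + A)⁻¹` by the substitution `k = r⁻¹ - 1`. -/
theorem exists_isSpectralMeasureOf [CompleteSpace H] :
    ∃ E : ProjValuedMeasure H, E.IsSpectralMeasureOf G := by
  obtain ⟨R, hsa, hpos, hle, hmem, hinj⟩ := hG.exists_resolvent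
  obtain ⟨E, hsupp, hE⟩ := hsa.exists_projValuedMeasure
  have hspec : spectrum ℝ R ⊆ Icc 0 1 := fun r hr =>
    ⟨spectrum_nonneg_of_nonneg hpos hr, by
      have h1 : IsUnit (algebraMap ℝ (H →L[ℂ] H) r - R) → False := hr
      by_contra! hlt
      refine h1 ?_
      have h0 : (0 : ℝ) < r := lt_trans one_pos hlt
      have h2 : ‖(r⁻¹ : ℝ) • R‖ < 1 := by
        rw [norm_smul, Real.norm_of_nonneg (inv_nonneg.2 h0.le)]
        calc r⁻¹ * ‖R‖ ≤ r⁻¹ * 1 := by gcongr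
          _ < 1 := by rw [mul_one]; exact inv_lt_one_of_one_lt₀ hlt
      have h3 := (isUnit_one_sub_of_norm_lt_one h2).smul (Units.mk0 r h0.ne')
      convert h3 using 1
      rw [Units.smul_def, Units.val_mk0, smul_sub, smul_smul, mul_inv_cancel₀ h0.ne', one_smul,
        Algebra.algebraMap_eq_smul_one]⟩
  have hIcc : ∀ x, ∀ᵐ r ∂(E.scalar x), r ∈ Icc (0 : ℝ) 1 := fun x => by
    have h0 : ∀ᵐ r ∂(E.scalar x), r ∈ spectrum ℝ R := hsupp x
    filter_upwards [h0] with r hr using hspec hr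
  -- the bounded function `r ↦ r` on the unit interval, so that `R = ρ(R)`
  set ρ : ℝ → ℂ := (Icc (0 : ℝ) 1).indicator fun r => (r : ℂ) with hρdef
  have hρ_of : ∀ {r : ℝ}, r ∈ Icc (0 : ℝ) 1 → ρ r = (r : ℂ) := fun hr => indicator_of_mem hr _
  have hρ : IsBddMeasurable ρ := by
    refine ⟨Complex.measurable_ofReal.indicator measurableSet_Icc, 1, fun r => ?_⟩
    by_cases hr : r ∈ Icc (0 : ℝ) 1
    · rw [hρ_of hr, Complex.norm_real, Real.norm_of_nonneg hr.1]
      exact hr.2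
    · rw [hρdef, indicator_of_notMem hr]
      simp
  have hR : R = E.integralOp ρ := by
    refine ProjValuedMeasure.Represents.eq_integralOp hρ fun x => ?_
    rw [hE, ← integral_complex_ofReal]
    refine integral_congr_ae ?_
    filter_upwards [hIcc x] with r hr
    rw [hρ_of hr]
  have hzero : ∀ x, ∀ᵐ r ∂(E.scalar x), r ≠ 0 := fun x => by
    have h1 : E.proj {0} x = 0 := by
      refine hinj _ ?_
      have hm : IsBddMeasurable (({0} : Set ℝ).indicator fun _ => (1 : ℂ)) :=
        (IsBddMeasurable.const 1).indicator (measurableSet_singleton 0)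
      rw [hR, ← E.integralOp_indicator_one (measurableSet_singleton 0),
        E.integralOp_mul_apply hρ hm]
      have : (fun k => ρ k * ({0} : Set ℝ).indicator (fun _ => (1 : ℂ)) k) = fun _ => 0 := by
        funext k
        by_cases hk : k = 0
        · subst hk
          rw [hρ_of ⟨le_rfl, zero_le_one⟩]
          simp
        · simp [hk]
      rw [this, E.integralOp_const]
      simp
    have h2 := E.scalar_eq_normSq (measurableSet_singleton 0) x
    rw [h1] at h2
    rw [ae_iff]
    simpa using h2
  have hIoc : ∀ x, ∀ᵐ r ∂(E.scalar x), 0 < r ∧ r ≤ 1 := fun x => by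
    filter_upwards [hIcc x, hzero x] with r h1 h2
    exact ⟨lt_of_le_of_ne h1.1 (Ne.symm h2), h1.2⟩
  set f : ℝ → ℝ := fun r => r⁻¹ - 1 with hfdef
  have hf : Measurable f := measurable_inv.sub_const 1
  have hint_iff : ∀ x, Integrable (fun k : ℝ => k ^ 2) ((E.map f hf).scalar x) ↔
      Integrable (fun r => f r ^ 2) (E.scalar x) := fun x => by
    rw [E.scalar_map hf, integrable_map_measure (by fun_prop) hf.aemeasurable]
    rfl
  have hdens : ∀ v, E.scalar (R v) =
      (E.scalar v).withDensity fun k => ENNReal.ofReal (‖ρ k‖ ^ 2) := fun v => by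
    rw [hR, E.scalar_integralOp hρ]
  have hdm : Measurable fun k => ENNReal.ofReal (‖ρ k‖ ^ 2) :=
    (hρ.measurable.norm.pow_const 2).ennreal_ofReal
  refine ⟨E.map f hf, fun x => ⟨?_, ?_⟩, ?_⟩
  · rintro ⟨y, hy⟩
    rw [hint_iff, ← (hmem x y).1 hy, hdens, integrable_withDensity_iff hdm
      (Eventually.of_forall fun k => ENNReal.ofReal_lt_top)]
    refine Integrable.of_bound (C := 1)
      ((hf.pow_const 2).mul hdm.ennreal_toReal).aestronglyMeasurable ?_
    filter_upwards [hIoc (x + y)] with r hr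
    rw [ENNReal.toReal_ofReal (by positivity), hρ_of ⟨hr.1.le, hr.2⟩, Complex.norm_real,
      Real.norm_of_nonneg hr.1.le, Real.norm_of_nonneg (by positivity), ← mul_pow]
    have h1 : f r * r = 1 - r := by
      rw [hfdef, sub_mul, inv_mul_cancel₀ hr.1.ne', one_mul]
    rw [h1]
    exact pow_le_one₀ (by linarith [hr.2]) (by linarith [hr.1])
  · intro h
    rw [hint_iff] at h
    have hb : Integrable (fun r => r⁻¹ ^ 2) (E.scalar x) := by
      refine Integrable.mono' ((h.const_mul 2).add (integrable_const 2))
        (measurable_inv.pow_const 2).aestronglyMeasurable (Eventually.of_forall fun r => ?_)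
      rw [Real.norm_of_nonneg (by positivity)]
      have : r⁻¹ = f r + 1 := by simp [hfdef]
      rw [this]
      simp only [Pi.add_apply]
      nlinarith [sq_nonneg (f r - 1)]
    -- truncations of `r ↦ r⁻¹`
    set A : ℕ → Set ℝ := fun n => Ioc (1 / ((n : ℝ) + 1)) 1 with hAdef
    have hA : ∀ n, MeasurableSet (A n) := fun n => measurableSet_Ioc
    set g : ℕ → ℝ → ℂ := fun n => (A n).indicator fun r => ((r⁻¹ : ℝ) : ℂ) with hgdef
    have hgle : ∀ n r, ‖g n r‖ ≤ |r⁻¹| := fun n r => by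
      refine (norm_indicator_le_norm_self _ _).trans ?_
      rw [Complex.norm_real, Real.norm_eq_abs]
    have hApos : ∀ {n r}, r ∈ A n → 0 < r := fun {n r} hr => lt_trans (by positivity) hr.1
    have hg : ∀ n, IsBddMeasurable (g n) := fun n => by
      refine ⟨(Complex.measurable_ofReal.comp measurable_inv).indicator (hA n), n + 1,
        fun r => ?_⟩
      by_cases hr : r ∈ A n
      · refine (hgle n r).trans ?_
        rw [abs_of_pos (inv_pos.2 (hApos hr))]
        have := hr.1
        rw [one_div] at this
        exact (inv_lt_of_inv_lt₀ (by positivity) this).le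
      · rw [hgdef]
        simp only [indicator_of_notMem hr, norm_zero]
        positivity
    have hmemA : ∀ {r : ℝ}, 0 < r → r ≤ 1 → ∀ᶠ n in atTop, r ∈ A n := fun {r} h0 h1 => by
      have := (tendsto_one_div_add_atTop_nhds_zero_nat (𝕜 := ℝ)).eventually (gt_mem_nhds h0)
      filter_upwards [this] with n hn
      exact ⟨hn, h1⟩
    have hglim : ∀ r, Tendsto (fun n => g n r) atTop
        (𝓝 ((Ioc (0 : ℝ) 1).indicator (fun r => ((r⁻¹ : ℝ) : ℂ)) r)) := fun r => by
      refine tendsto_const_nhds.congr' ?_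
      by_cases hr : r ∈ Ioc (0 : ℝ) 1
      · filter_upwards [hmemA hr.1 hr.2] with n hn
        rw [indicator_of_mem hr, hgdef]
        simp only [indicator_of_mem hn]
      · refine Eventually.of_forall fun n => ?_
        have hn : r ∉ A n := fun hn => hr ⟨hApos hn, hn.2⟩
        rw [indicator_of_notMem hr, hgdef]
        simp only [indicator_of_notMem hn]
    have hcs : CauchySeq fun n => E.integralOp (g n) x := by
      refine cauchySeq_of_normSq_sub_le_integral (μ := E.scalar x) (b := fun r => |r⁻¹|)
        (fun n => (hg n).measurable.aestronglyMeasurable) (by simpa only [sq_abs] using hb) hgle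
        hglim fun n m => le_of_eq ?_
      rw [← sub_apply, ← E.integralOp_sub (hg n) (hg m), E.normSq_integralOp ((hg n).sub (hg m))]
    obtain ⟨y, hy⟩ := cauchySeq_tendsto_of_complete hcs
    have h1 : ∀ n, R (E.integralOp (g n) x) = E.integralOp ((A n).indicator fun _ => 1) x :=
      fun n => by
        rw [hR, E.integralOp_mul_apply hρ (hg n)]
        congr 2
        funext r
        by_cases hr : r ∈ A n
        · rw [hρ_of ⟨(hApos hr).le, hr.2⟩, hgdef]
          simp only [indicator_of_mem hr]
          rw [← Complex.ofReal_mul, mul_inv_cancel₀ (hApos hr).ne', Complex.ofReal_one]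
        · rw [hgdef]
          simp only [indicator_of_notMem hr, mul_zero]
    have h2 : Tendsto (fun n => E.integralOp ((A n).indicator fun _ => (1 : ℂ)) x) atTop
        (𝓝 (E.integralOp ((Ioc (0 : ℝ) 1).indicator fun _ => (1 : ℂ)) x)) := by
      refine E.tendsto_integralOp (C := 1) (fun n => (IsBddMeasurable.const 1).indicator (hA n))
        ((IsBddMeasurable.const 1).indicator measurableSet_Ioc) (fun n r => ?_) (fun r => ?_) x
      · exact (norm_indicator_le_norm_self _ _).trans (by simp)
      · refine tendsto_const_nhds.congr' ?_
        by_cases hr : r ∈ Ioc (0 : ℝ) 1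
        · filter_upwards [hmemA hr.1 hr.2] with n hn
          rw [indicator_of_mem hr, indicator_of_mem hn]
        · refine Eventually.of_forall fun n => ?_
          have hn : r ∉ A n := fun hn => hr ⟨hApos hn, hn.2⟩
          exact (indicator_of_notMem hr _).trans (indicator_of_notMem hn _).symm
    have h3 : E.integralOp ((Ioc (0 : ℝ) 1).indicator fun _ => (1 : ℂ)) x = x := by
      rw [E.integralOp_apply_eq_of_ae ((IsBddMeasurable.const 1).indicator measurableSet_Ioc)
        (.const 1) (g := fun _ => 1), E.integralOp_one, one_apply_eq_self]
      filter_upwards [hIoc x] with r hr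
      rw [indicator_of_mem (show r ∈ Ioc (0 : ℝ) 1 from hr)]
    have h4 : R y = x := by
      refine tendsto_nhds_unique ((R.continuous.tendsto y).comp hy) ?_
      rw [h3] at h2
      exact h2.congr fun n => (h1 n).symm
    exact ⟨y - x, (hmem _ _).2 (by rw [add_sub_cancel, h4])⟩
  · intro x y hxy
    set v := x + y with hv
    have hx : x = R v := ((hmem x y).1 hxy).symm
    have hy : y = E.integralOp (fun r => 1 - ρ r) v := by
      rw [E.integralOp_sub (.const 1) hρ, E.integralOp_one, sub_apply, ← hR, ← hx, hv,
        one_apply_eq_self]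
      abel
    rw [E.scalar_map hf, integral_map hf.aemeasurable (f := fun r : ℝ => r)
      measurable_id.aestronglyMeasurable]
    conv_rhs => rw [hx, hdens]
    rw [integral_withDensity_eq_integral_toReal_smul hdm
      (Eventually.of_forall fun k => ENNReal.ofReal_lt_top), ← integral_complex_ofReal]
    conv_lhs => rw [hy, hx, hR, E.inner_integralOp_integralOp hρ ((IsBddMeasurable.const 1).sub hρ)]
    refine integral_congr_ae ?_
    filter_upwards [hIoc v] with r hr
    rw [ENNReal.toReal_ofReal (by positivity), hρ_of ⟨hr.1.le, hr.2⟩, Complex.norm_real,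
      Real.norm_of_nonneg hr.1.le, Complex.conj_ofReal, smul_eq_mul, hfdef]
    have : (r : ℂ) ≠ 0 := Complex.ofReal_ne_zero.2 hr.1.ne'
    push_cast
    field_simp

end IsPositiveSelfAdjointGraph

end PositiveSelfAdjoint

/-! ### Functional calculus of a positive self-adjoint operator from its spectral measure -/

namespace ProjValuedMeasure

variable {H : Type u} [NormedAddCommGroup H] [InnerProductSpace ℂ H] [CompleteSpace H]
  {E : ProjValuedMeasure H} {G : Set (H × H)}

lemma isBddMeasurable_indicator_Icc (n : ℕ) :
    IsBddMeasurable ((Icc (-(n : ℝ)) n).indicator fun k => (k : ℂ)) := by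
  refine ⟨Complex.measurable_ofReal.indicator measurableSet_Icc, n, fun k => ?_⟩
  by_cases hk : k ∈ Icc (-(n : ℝ)) n
  · rw [indicator_of_mem hk, Complex.norm_real, Real.norm_eq_abs]
    exact abs_le.2 hk
  · rw [indicator_of_notMem hk, norm_zero]
    positivity

lemma ae_mem_of_proj_eq {B : Set ℝ} (hB : MeasurableSet B) {w : H} (hw : E.proj B w = w) :
    ∀ᵐ k ∂(E.scalar w), k ∈ B := by
  have h1 : (E.scalar w).real Bᶜ = 0 := by
    rw [measureReal_compl hB, E.scalar_real_apply hB, E.scalar_real_univ, hw, sub_self]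
  rw [measureReal_eq_zero_iff] at h1
  exact h1

/-- On the range of the spectral projection of `[-n, n]`, the operator is the bounded operator
`∫_{[-n, n]} k E(dk)`, in the sense of the diagonal matrix elements. -/
lemma IsSpectralMeasureOf.inner_sub_eq_zero (hE : E.IsSpectralMeasureOf G) {n : ℕ} {w v : H}
    (hw : E.proj (Icc (-(n : ℝ)) n) w = w) (hwv : (w, v) ∈ G) :
    ⟪w, v - E.integralOp ((Icc (-(n : ℝ)) n).indicator fun k => (k : ℂ)) w⟫_ℂ = 0 := by
  rw [inner_sub_right, hE.2 _ _ hwv, E.inner_integralOp (isBddMeasurable_indicator_Icc n),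
    ← integral_complex_ofReal, sub_eq_zero]
  refine integral_congr_ae ?_
  filter_upwards [ae_mem_of_proj_eq measurableSet_Icc hw] with k hk
  rw [indicator_of_mem hk]

lemma proj_Icc_of_le {n m : ℕ} (h : n ≤ m) {w : H} (hw : E.proj (Icc (-(n : ℝ)) n) w = w) :
    E.proj (Icc (-(m : ℝ)) m) w = w := by
  have hnm : (n : ℝ) ≤ m := by exact_mod_cast h
  conv_lhs => rw [← hw]
  rw [← mul_apply_eq_comp, E.proj_mul measurableSet_Icc measurableSet_Icc,
    inter_eq_self_of_subset_right (Icc_subset_Icc (neg_le_neg hnm) hnm), hw]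

lemma proj_Icc_tendsto (x : H) :
    Tendsto (fun n : ℕ => E.proj (Icc (-(n : ℝ)) n) x) atTop (𝓝 x) := by
  have h := E.tendsto_integralOp (C := 1) (f := fun _ => 1)
    (φ := fun n : ℕ => (Icc (-(n : ℝ)) n).indicator fun _ => (1 : ℂ))
    (fun n => (IsBddMeasurable.const 1).indicator measurableSet_Icc) (.const 1)
    (fun n r => (norm_indicator_le_norm_self _ _).trans (by simp)) (fun k => ?_) x
  · simp_rw [E.integralOp_indicator_one measurableSet_Icc, E.integralOp_one] at h
    exact h
  · refine tendsto_const_nhds.congr' ?_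
    filter_upwards [eventually_ge_atTop ⌈|k|⌉₊] with n hn
    have : |k| ≤ n := (Nat.le_ceil _).trans (by exact_mod_cast hn)
    rw [indicator_of_mem (show k ∈ Icc (-(n : ℝ)) n from abs_le.1 this)]

/-- The operator with spectral measure `E` acts on the range of the spectral projection of
`[-n, n]` as `∫_{[-n, n]} k E(dk)`: the diagonal matrix elements are polarised. -/
lemma IsSpectralMeasureOf.mem_of_proj_eq (hE : E.IsSpectralMeasureOf G)
    (hG : IsPositiveSelfAdjointGraph G) {n : ℕ} {w : H}
    (hw : E.proj (Icc (-(n : ℝ)) n) w = w) :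
    (w, E.integralOp ((Icc (-(n : ℝ)) n).indicator fun k => (k : ℂ)) w) ∈ G := by
  have hdom : ∀ (m : ℕ) (u : H), E.proj (Icc (-(m : ℝ)) m) u = u → ∃ y, (u, y) ∈ G :=
    fun m u hu => by
      rw [hE.1]
      refine Integrable.of_bound (C := (m : ℝ) ^ 2) (by fun_prop) ?_
      filter_upwards [ae_mem_of_proj_eq measurableSet_Icc hu] with k hk
      rw [Real.norm_of_nonneg (by positivity), ← sq_abs]
      exact pow_le_pow_left₀ (abs_nonneg _) (abs_le.2 hk) 2
  obtain ⟨v, hv⟩ := hdom n w hw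
  set T : ℕ → H →L[ℂ] H := fun m =>
    E.integralOp ((Icc (-(m : ℝ)) m).indicator fun k => (k : ℂ)) with hT
  have key : ∀ m, n ≤ m → ∀ w', E.proj (Icc (-(m : ℝ)) m) w' = w' → ⟪w', v - T m w⟫_ℂ = 0 := by
    intro m hm w' hw'
    obtain ⟨v', hv'⟩ := hdom m w' hw'
    have hwm := proj_Icc_of_le hm hw
    have h1 := hE.inner_sub_eq_zero hwm hv
    have h2 := hE.inner_sub_eq_zero hw' hv'
    have h3 := hE.inner_sub_eq_zero (n := m) (w := w + w') (v := v + v')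
      (by rw [map_add, hwm, hw']) (hG.add_mem _ hv _ hv')
    have h4 := hE.inner_sub_eq_zero (n := m) (w := w + Complex.I • w') (v := v + Complex.I • v')
      (by rw [map_add, map_smul, hwm, hw']) (hG.add_mem _ hv _ (hG.smul_mem Complex.I _ hv'))
    rw [map_add, add_sub_add_comm, inner_add_left, inner_add_right, inner_add_right, h1, h2]
      at h3
    rw [map_add, map_smul, add_sub_add_comm, ← smul_sub, inner_add_left, inner_add_right,
      inner_add_right, inner_smul_left, inner_smul_left, inner_smul_right, inner_smul_right, h1,
      h2, Complex.conj_I] at h4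
    linear_combination (1 / 2 : ℂ) * h3 + (Complex.I / 2) * h4 +
      (1 / 2 * ⟪w', v - T m w⟫_ℂ - 1 / 2 * ⟪w, v' - T m w'⟫_ℂ) * Complex.I_sq
  have hTm : ∀ m, n ≤ m → T m w = T n w := fun m hm => by
    refine E.integralOp_apply_eq_of_ae (isBddMeasurable_indicator_Icc m)
      (isBddMeasurable_indicator_Icc n) ?_
    filter_upwards [ae_mem_of_proj_eq measurableSet_Icc hw,
      ae_mem_of_proj_eq measurableSet_Icc (proj_Icc_of_le hm hw)] with k h1 h2
    rw [indicator_of_mem h1, indicator_of_mem h2]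
  have hzero : v - T n w = 0 := by
    refine ext_inner_left ℂ fun z => ?_
    rw [inner_zero_right]
    refine tendsto_nhds_unique ((proj_Icc_tendsto (E := E) z).inner tendsto_const_nhds) ?_
    refine tendsto_const_nhds.congr' ?_
    filter_upwards [eventually_ge_atTop n] with m hm
    rw [← hTm m hm, key m hm]
    rw [← mul_apply_eq_comp, E.proj_mul measurableSet_Icc measurableSet_Icc, inter_self]
  rw [sub_eq_zero] at hzero
  rwa [hzero] at hv

/-- If `f` and `k ↦ k f(k)` are bounded, then `f(A) x` is in the domain of `A` and
`A f(A) x = (k f)(A) x`. -/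
lemma IsSpectralMeasureOf.integralOp_mem (hE : E.IsSpectralMeasureOf G)
    (hG : IsPositiveSelfAdjointGraph G) {f : ℝ → ℂ} (hf : IsBddMeasurable f)
    (hkf : IsBddMeasurable fun k => (k : ℂ) * f k) (x : H) :
    (E.integralOp f x, E.integralOp (fun k => (k : ℂ) * f k) x) ∈ G := by
  have h1 : ∀ n : ℕ, (E.proj (Icc (-(n : ℝ)) n) (E.integralOp f x),
      E.proj (Icc (-(n : ℝ)) n) (E.integralOp (fun k => (k : ℂ) * f k) x)) ∈ G := fun n => by
    have h2 := hE.mem_of_proj_eq hG (n := n) (w := E.proj (Icc (-(n : ℝ)) n) (E.integralOp f x))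
      (by rw [← mul_apply_eq_comp, E.proj_mul measurableSet_Icc measurableSet_Icc, inter_self])
    have hi : IsBddMeasurable ((Icc (-(n : ℝ)) n).indicator fun _ => (1 : ℂ)) :=
      (IsBddMeasurable.const 1).indicator measurableSet_Icc
    convert h2 using 2
    rw [← E.integralOp_indicator_one measurableSet_Icc, E.integralOp_mul_apply hi hkf,
      E.integralOp_mul_apply hi hf, E.integralOp_mul_apply (isBddMeasurable_indicator_Icc n)
        (hi.mul hf)]
    congr 2
    funext k
    by_cases hk : k ∈ Icc (-(n : ℝ)) n
    · simp [indicator_of_mem hk]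
    · simp [indicator_of_notMem hk]
  refine hG.isClosed.mem_of_tendsto ((proj_Icc_tendsto _).prodMk_nhds (proj_Icc_tendsto _))
    (Eventually.of_forall h1)

/-- The spectral measure of an injective positive operator lives on `(0, ∞)`. -/
lemma IsSpectralMeasureOf.ae_pos (hE : E.IsSpectralMeasureOf G)
    (hG : IsPositiveSelfAdjointGraph G) (hinj : ∀ w, (w, (0 : H)) ∈ G → w = 0) (x : H) :
    ∀ᵐ k ∂(E.scalar x), 0 < k := by
  have hzero : ∀ᵐ k ∂(E.scalar x), k ≠ 0 := by
    have hi : IsBddMeasurable (({0} : Set ℝ).indicator fun _ => (1 : ℂ)) :=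
      (IsBddMeasurable.const 1).indicator (measurableSet_singleton 0)
    have h0 : (fun k : ℝ => (k : ℂ) * ({0} : Set ℝ).indicator (fun _ => (1 : ℂ)) k) =
        fun _ => 0 := by
      funext k
      by_cases hk : k = 0 <;> simp [hk]
    have h1 := hE.integralOp_mem hG hi (by rw [h0]; exact .const 0) x
    rw [h0, E.integralOp_const, zero_smul, zero_apply,
      E.integralOp_indicator_one (measurableSet_singleton 0)] at h1
    have h2 := E.scalar_eq_normSq (measurableSet_singleton 0) x
    rw [hinj _ h1] at h2
    rw [ae_iff]
    simpa using h2
  have hneg : ∀ n : ℕ, ∀ᵐ k ∂(E.scalar x), ¬(-(n : ℝ) ≤ k ∧ k < 0) := fun n => by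
    set B : Set ℝ := Ico (-(n : ℝ)) 0 with hB
    have hi : IsBddMeasurable (B.indicator fun _ => (1 : ℂ)) :=
      (IsBddMeasurable.const 1).indicator measurableSet_Ico
    have hki : IsBddMeasurable fun k => (k : ℂ) * B.indicator (fun _ => (1 : ℂ)) k := by
      refine ⟨Complex.measurable_ofReal.mul hi.measurable, n, fun k => ?_⟩
      by_cases hk : k ∈ B
      · rw [indicator_of_mem hk, mul_one, Complex.norm_real, Real.norm_eq_abs, abs_le]
        exact ⟨hk.1, by linarith [hk.2, (Nat.cast_nonneg n : (0 : ℝ) ≤ n)]⟩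
      · rw [indicator_of_notMem hk, mul_zero, norm_zero]
        positivity
    have h1 := hG.nonneg _ (hE.integralOp_mem hG hi hki x)
    rw [E.inner_integralOp_integralOp hi hki] at h1
    have h2 : (fun k => conj (B.indicator (fun _ => (1 : ℂ)) k) *
        ((k : ℂ) * B.indicator (fun _ => (1 : ℂ)) k)) =
        fun k => ((B.indicator (fun k => k) k : ℝ) : ℂ) := by
      funext k
      by_cases hk : k ∈ B
      · simp [indicator_of_mem hk]
      · simp [indicator_of_notMem hk]
    rw [h2, integral_complex_ofReal, Complex.ofReal_re] at h1
    have h3 : 0 ≤ fun k => -B.indicator (fun k : ℝ => k) k := fun k => by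
      by_cases hk : k ∈ B
      · simp only [indicator_of_mem hk]
        exact neg_nonneg.2 hk.2.le
      · simp [indicator_of_notMem hk]
    have h4 : Integrable (fun k => -B.indicator (fun k : ℝ => k) k) (E.scalar x) := by
      refine Integrable.of_bound (C := n)
        (measurable_id.indicator measurableSet_Ico).neg.aestronglyMeasurable
        (Eventually.of_forall fun k => ?_)
      by_cases hk : k ∈ B
      · rw [indicator_of_mem hk, norm_neg, Real.norm_eq_abs, abs_le]
        exact ⟨hk.1, by linarith [hk.2, (Nat.cast_nonneg n : (0 : ℝ) ≤ n)]⟩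
      · rw [indicator_of_notMem hk, neg_zero, norm_zero]
        positivity
    have h5 : ∫ k, -B.indicator (fun k : ℝ => k) k ∂(E.scalar x) = 0 :=
      le_antisymm (by rw [integral_neg]; linarith) (integral_nonneg h3)
    filter_upwards [(integral_eq_zero_iff_of_nonneg h3 h4).1 h5] with k hk hkB
    rw [indicator_of_mem (show k ∈ B from hkB)] at hk
    exact absurd hk (by simpa using hkB.2.ne)
  filter_upwards [hzero, ae_all_iff.2 hneg] with k h1 h2
  by_contra hk
  refine h2 ⌈|k|⌉₊ ⟨?_, lt_of_le_of_ne (not_lt.1 hk) h1⟩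
  exact neg_le.1 ((neg_le_abs k).trans (Nat.le_ceil _))

end ProjValuedMeasure

lemma IsPositiveSelfAdjointGraph.isSpectralMeasureOf_spectralMeasure {H : Type u}
    [NormedAddCommGroup H] [InnerProductSpace ℂ H] [CompleteSpace H] {G : Set (H × H)}
    (hG : IsPositiveSelfAdjointGraph G) : (spectralMeasure G).IsSpectralMeasureOf G := by
  rw [spectralMeasure, dif_pos hG.exists_isSpectralMeasureOf]
  exact hG.exists_isSpectralMeasureOf.choose_spec

/-! ### The Tomita operator and the modular operator -/

namespace VonNeumannAlgebra

variable {H : Type u} [NormedAddCommGroup H] [InnerProductSpace ℂ H] [CompleteSpace H]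
  {M : VonNeumannAlgebra H} {Ω : H}

lemma isClosed_tomitaGraph : IsClosed (M.tomitaGraph Ω) := isClosed_closure

lemma mem_tomitaGraph {a : H →L[ℂ] H} (ha : a ∈ M) : (a Ω, star a Ω) ∈ M.tomitaGraph Ω :=
  subset_closure ⟨a, ha, rfl⟩

lemma tomitaGraph_mono {N : VonNeumannAlgebra H} (h : N ≤ M) :
    N.tomitaGraph Ω ⊆ M.tomitaGraph Ω :=
  closure_mono fun _ ⟨a, ha, hp⟩ => ⟨a, h ha, hp⟩

lemma tomitaGraph_add_mem {p q : H × H} (hp : p ∈ M.tomitaGraph Ω) (hq : q ∈ M.tomitaGraph Ω) :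
    p + q ∈ M.tomitaGraph Ω := by
  refine map_mem_closure₂ continuous_add hp hq ?_
  rintro _ ⟨a, ha, rfl⟩ _ ⟨b, hb, rfl⟩
  exact ⟨a + b, add_mem ha hb, by simp⟩

lemma tomitaGraph_smul_mem (c : ℂ) {p : H × H} (hp : p ∈ M.tomitaGraph Ω) :
    (c • p.1, conj c • p.2) ∈ M.tomitaGraph Ω := by
  refine map_mem_closure (f := fun p : H × H => (c • p.1, conj c • p.2)) (by fun_prop) hp ?_
  rintro _ ⟨a, ha, rfl⟩
  exact ⟨c • a, M.toStarSubalgebra.smul_mem ha c, by simp [star_smul]⟩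

lemma tomitaGraph_sub_mem {p q : H × H} (hp : p ∈ M.tomitaGraph Ω) (hq : q ∈ M.tomitaGraph Ω) :
    p - q ∈ M.tomitaGraph Ω := by
  have h := tomitaGraph_add_mem hp (tomitaGraph_smul_mem (-1) hq)
  rw [sub_eq_add_neg]
  convert h using 2
  ext <;> simp

lemma tomitaGraph_swap_mem {p : H × H} (hp : p ∈ M.tomitaGraph Ω) :
    p.swap ∈ M.tomitaGraph Ω := by
  refine map_mem_closure continuous_swap hp ?_
  rintro _ ⟨a, ha, rfl⟩
  exact ⟨star a, star_mem ha, by simp⟩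

/-- The Tomita operator `S` of `M` and that of the commutant are formally adjoint. -/
lemma inner_commutant_eq {b : H →L[ℂ] H} (hb : b ∈ M.commutant) {p : H × H}
    (hp : p ∈ M.tomitaGraph Ω) : ⟪b Ω, p.2⟫_ℂ = ⟪p.1, star b Ω⟫_ℂ := by
  refine closure_minimal (t := {p : H × H | ⟪b Ω, p.2⟫_ℂ = ⟪p.1, star b Ω⟫_ℂ}) ?_
    (isClosed_eq (by fun_prop) (by fun_prop)) hp
  rintro _ ⟨a, ha, rfl⟩
  rw [mem_ofPred_eq, ContinuousLinearMap.star_eq_adjoint, ContinuousLinearMap.star_eq_adjoint,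
    ContinuousLinearMap.adjoint_inner_right, ContinuousLinearMap.adjoint_inner_right]
  rw [← mul_apply_eq_comp, ← mul_apply_eq_comp, mem_commutant_iff.1 hb a ha]

/-- A separating vector of `M` is cyclic for the commutant. -/
lemma IsCyclicSeparating.dense_commutant (h : M.IsCyclicSeparating Ω) :
    Dense {x : H | ∃ b ∈ M.commutant, b Ω = x} := by
  let K₀ : Submodule ℂ H :=
    { carrier := {x | ∃ b ∈ M.commutant, b Ω = x}
      add_mem' := by
        rintro _ _ ⟨a, ha, rfl⟩ ⟨b, hb, rfl⟩
        exact ⟨a + b, add_mem ha hb, rfl⟩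
      zero_mem' := ⟨0, zero_mem _, rfl⟩
      smul_mem' := by
        rintro c _ ⟨a, ha, rfl⟩
        exact ⟨c • a, M.commutant.toStarSubalgebra.smul_mem ha c, rfl⟩ }
  set K : Submodule ℂ H := K₀.topologicalClosure with hK
  have hKc : IsClosed (K : Set H) := K₀.isClosed_topologicalClosure
  have : CompleteSpace K := hKc.completeSpace_coe
  set P : H →L[ℂ] H := K.starProjection with hP
  have hPM : P ∈ M := by
    rw [IsStarProjection.mem_iff (isStarProjection_starProjection)]
    intro y hy
    rw [Module.End.mem_invtSubmodule]
    rintro _ ⟨v, rfl⟩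
    refine ⟨y (P v), ?_⟩
    have hx : P v ∈ K := K.starProjection_apply_mem v
    generalize P v = x at hx ⊢
    refine Submodule.starProjection_eq_self_iff.2 ?_
    have hx' : x ∈ closure (K₀ : Set H) := hx
    change y x ∈ closure (K₀ : Set H)
    refine map_mem_closure y.continuous hx' ?_
    rintro _ ⟨b, hb, rfl⟩
    exact ⟨y * b, mul_mem hy hb, rfl⟩
  have hΩ : P Ω = Ω := by
    rw [hP, Submodule.starProjection_eq_self_iff]
    exact subset_closure ⟨1, one_mem _, rfl⟩
  have h1 : 1 - P = 0 := h.separating _ (sub_mem (one_mem _) hPM) (by simp [hΩ])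
  intro x
  have h2 : P x = x := by
    rw [← sub_eq_zero.1 h1]
    rfl
  rw [hP, Submodule.starProjection_eq_self_iff] at h2
  exact h2

/-- The Tomita operator is closable. -/
lemma IsCyclicSeparating.eq_zero_of_tomitaGraph (h : M.IsCyclicSeparating Ω) {y : H}
    (hy : ((0 : H), y) ∈ M.tomitaGraph Ω) : y = 0 := by
  refine h.dense_commutant.eq_zero_of_inner_right ℂ ?_
  rintro _ ⟨b, hb, rfl⟩
  have := inner_commutant_eq hb hy
  rwa [inner_zero_left] at this

lemma IsCyclicSeparating.tomitaGraph_unique (h : M.IsCyclicSeparating Ω) {x y z : H}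
    (hy : (x, y) ∈ M.tomitaGraph Ω) (hz : (x, z) ∈ M.tomitaGraph Ω) : y = z := by
  have h1 := tomitaGraph_sub_mem hy hz
  rw [Prod.mk_sub_mk, sub_self] at h1
  exact sub_eq_zero.1 (h.eq_zero_of_tomitaGraph h1)

lemma self_mem_modularGraph : (Ω, Ω) ∈ M.modularGraph Ω := by
  refine ⟨Ω, by simpa using mem_tomitaGraph (M := M) (Ω := Ω) (one_mem M), fun q hq => ?_⟩
  have := inner_commutant_eq (M := M) (Ω := Ω) (one_mem M.commutant) hq
  simpa using this.symm

/-- The equation `(1 + S* S) w = x` is solved by the orthogonal projection of `(x, 0)` onto the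
graph of `S`, which is a closed real subspace. -/
lemma exists_mem_modularGraph (x : H) : ∃ w, (w, x - w) ∈ M.modularGraph Ω := by
  let _ : InnerProductSpace ℝ H := InnerProductSpace.complexToReal
  let K : Submodule ℝ (WithLp 2 (H × H)) :=
    { carrier := {p | (p.fst, p.snd) ∈ M.tomitaGraph Ω}
      add_mem' := fun {p q} hp hq => tomitaGraph_add_mem hp hq
      zero_mem' := by simpa using mem_tomitaGraph (M := M) (Ω := Ω) (zero_mem M)
      smul_mem' := fun c p hp => by
        have := tomitaGraph_smul_mem (c : ℂ) hp
        rw [Complex.conj_ofReal] at this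
        exact this }
  have hKc : IsClosed (K : Set (WithLp 2 (H × H))) :=
    isClosed_tomitaGraph.preimage
      (f := fun p : WithLp 2 (H × H) => (p.fst, p.snd)) (by fun_prop)
  have : CompleteSpace K := hKc.completeSpace_coe
  obtain ⟨p, hp, z, hz, hpz⟩ := K.exists_add_mem_mem_orthogonal (WithLp.toLp 2 (x, (0 : H)))
  have h1 : x = p.fst + z.fst := congrArg (fun q => WithLp.fst q) hpz
  have h2 : 0 = p.snd + z.snd := congrArg (fun q => WithLp.snd q) hpz
  refine ⟨p.fst, p.snd, hp, fun q hq => ?_⟩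
  have hz1 : x - p.fst = z.fst := by rw [h1]; abel
  have hz2 : p.snd = -z.snd := eq_neg_of_add_eq_zero_left h2.symm
  have hre : ∀ q ∈ M.tomitaGraph Ω, (⟪q.1, z.fst⟫_ℂ).re = (⟪p.snd, q.2⟫_ℂ).re := by
    intro q hq
    have h := (Submodule.mem_orthogonal K z).1 hz (WithLp.toLp 2 q) hq
    rw [WithLp.prod_inner_apply] at h
    change (⟪q.1, z.fst⟫_ℂ).re + (⟪q.2, z.snd⟫_ℂ).re = 0 at h
    rw [hz2, inner_neg_left, Complex.neg_re, ← Complex.conj_re ⟪z.snd, q.2⟫_ℂ, inner_conj_symm]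
    exact eq_neg_of_add_eq_zero_left h
  rw [hz1]
  refine Complex.ext (hre q hq) ?_
  have h3 := hre _ (tomitaGraph_smul_mem Complex.I hq)
  rw [inner_smul_left, inner_smul_right, Complex.conj_I] at h3
  simpa using h3

lemma IsCyclicSeparating.isPositiveSelfAdjointGraph (h : M.IsCyclicSeparating Ω) :
    IsPositiveSelfAdjointGraph (M.modularGraph Ω) where
  add_mem := by
    rintro p ⟨y, hy, hp⟩ q ⟨z, hz, hq⟩
    refine ⟨y + z, tomitaGraph_add_mem hy hz, fun r hr => ?_⟩
    rw [Prod.snd_add, inner_add_right, inner_add_left, hp r hr, hq r hr]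
  smul_mem := by
    rintro c p ⟨y, hy, hp⟩
    refine ⟨conj c • y, tomitaGraph_smul_mem c hy, fun r hr => ?_⟩
    rw [Prod.smul_snd, inner_smul_right, inner_smul_left, hp r hr, Complex.conj_conj]
  symm := by
    rintro p ⟨y, hy, hp⟩ q ⟨z, hz, hq⟩
    rw [← inner_conj_symm p.2, hp _ hz, inner_conj_symm]
    exact hq _ hy
  nonneg := by
    rintro p ⟨y, hy, hp⟩
    rw [hp _ hy, inner_self_eq_ofReal_normSq, Complex.ofReal_re]
    positivity
  exists_mem := exists_mem_modularGraph
  eq_zero_of_mem := by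
    rintro z ⟨y, hy, hp⟩
    have hy0 : y = 0 := h.eq_zero_of_tomitaGraph hy
    refine h.cyclic.eq_zero_of_inner_right ℂ ?_
    rintro _ ⟨a, ha, rfl⟩
    rw [hp _ (mem_tomitaGraph ha), hy0, inner_zero_left]

lemma IsCyclicSeparating.eq_zero_of_modularGraph (h : M.IsCyclicSeparating Ω) {w : H}
    (hw : (w, (0 : H)) ∈ M.modularGraph Ω) : w = 0 := by
  obtain ⟨y, hy, hp⟩ := hw
  have h1 := hp _ hy
  rw [inner_zero_right] at h1
  have hy0 : y = 0 := inner_self_eq_zero.1 h1.symm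
  rw [hy0] at hy
  exact h.eq_zero_of_tomitaGraph (tomitaGraph_swap_mem hy)

/-! ### Functional calculus of the modular operator -/

lemma IsCyclicSeparating.integralOp_mem_modularGraph (h : M.IsCyclicSeparating Ω) {φ : ℝ → ℂ}
    (hφ : IsBddMeasurable φ) (hφe : IsBddMeasurable fun k => (Real.exp k : ℂ) * φ k) (x : H) :
    ((M.logModular Ω).integralOp φ x,
      (M.logModular Ω).integralOp (fun k => (Real.exp k : ℂ) * φ k) x) ∈ M.modularGraph Ω := by
  have hG := h.isPositiveSelfAdjointGraph
  have hE := hG.isSpectralMeasureOf_spectralMeasure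
  have hφl : IsBddMeasurable fun k => φ (Real.log k) := hφ.comp Real.measurable_log
  have hkφ : IsBddMeasurable fun k => (k : ℂ) * φ (Real.log k) := by
    obtain ⟨C, hC⟩ := hφe.exists_bound
    refine ⟨Complex.measurable_ofReal.mul hφl.measurable, C, fun k => ?_⟩
    by_cases hk : k = 0
    · rw [hk, Complex.ofReal_zero, zero_mul, norm_zero]
      exact (norm_nonneg _).trans (hC 0)
    · have := hC (Real.log k)
      rw [norm_mul, Complex.norm_real, Real.norm_of_nonneg (Real.exp_nonneg _),
        Real.exp_log_eq_abs hk] at this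
      rwa [norm_mul, Complex.norm_real, Real.norm_eq_abs]
  have h1 := hE.integralOp_mem hG hφl hkφ x
  rw [logModular, ProjValuedMeasure.integralOp_map _ _ hφ,
    ProjValuedMeasure.integralOp_map _ _ hφe]
  convert h1 using 2
  refine ProjValuedMeasure.integralOp_apply_eq_of_ae _ (hφe.comp Real.measurable_log) hkφ ?_
  filter_upwards [hE.ae_pos hG (fun w => h.eq_zero_of_modularGraph) x] with k hk
  rw [Real.exp_log hk]

/-- The indicator function of `(-∞, n]`, used to truncate functions of `log Δ`. -/
noncomputable def cutoff (n : ℕ) : ℝ → ℂ := (Iic (n : ℝ)).indicator fun _ => 1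

lemma cutoff_of_le {n : ℕ} {k : ℝ} (h : k ≤ n) : cutoff n k = 1 :=
  indicator_of_mem (show k ∈ Iic (n : ℝ) from h) _

lemma cutoff_of_lt {n : ℕ} {k : ℝ} (h : (n : ℝ) < k) : cutoff n k = 0 :=
  indicator_of_notMem (show k ∉ Iic (n : ℝ) from not_le.2 h) _

lemma norm_cutoff_le (n : ℕ) (k : ℝ) : ‖cutoff n k‖ ≤ 1 :=
  (norm_indicator_le_norm_self _ _).trans (by simp)

lemma tendsto_cutoff (k : ℝ) : Tendsto (fun n => cutoff n k) atTop (𝓝 1) := by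
  refine tendsto_const_nhds.congr' ?_
  filter_upwards [eventually_ge_atTop ⌈k⌉₊] with n hn
  exact (cutoff_of_le ((Nat.le_ceil _).trans (by exact_mod_cast hn))).symm

lemma isBddMeasurable_cutoff (n : ℕ) : IsBddMeasurable (cutoff n) :=
  (IsBddMeasurable.const 1).indicator measurableSet_Iic

lemma isBddMeasurable_exp_mul_cutoff (n : ℕ) :
    IsBddMeasurable fun k => (Real.exp k : ℂ) * cutoff n k := by
  refine ⟨(Complex.measurable_ofReal.comp Real.measurable_exp).mul
    (isBddMeasurable_cutoff n).measurable, Real.exp n, fun k => ?_⟩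
  rcases le_or_gt k n with hk | hk
  · rw [cutoff_of_le hk, mul_one, Complex.norm_real, Real.norm_of_nonneg (Real.exp_nonneg _)]
    exact Real.exp_le_exp.2 hk
  · rw [cutoff_of_lt hk, mul_zero, norm_zero]
    exact Real.exp_nonneg _

/-- Truncations `z_n = 1_{(-∞, n]}(log Δ) z` have images `y_n` under the Tomita operator `S`, whose
inner products with the range of `S` are those of `S* S z_n`. -/
lemma IsCyclicSeparating.exists_truncation (h : M.IsCyclicSeparating Ω) (z : H) :
    ∃ y : ℕ → H, (∀ n, ((M.logModular Ω).integralOp (cutoff n) z, y n) ∈ M.tomitaGraph Ω) ∧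
      ∀ n, ∀ q ∈ M.tomitaGraph Ω, ⟪q.1, (M.logModular Ω).integralOp
        (fun k => (Real.exp k : ℂ) * cutoff n k) z⟫_ℂ = ⟪y n, q.2⟫_ℂ := by
  choose y hy hq using fun n => h.integralOp_mem_modularGraph (isBddMeasurable_cutoff n)
    (isBddMeasurable_exp_mul_cutoff n) z
  exact ⟨y, hy, hq⟩

/-- If `∫ eᵏ ⟨z, E(dk) z⟩ < ∞` then `z` is in the domain of the Tomita operator `S` and
`‖S z‖² = ∫ eᵏ ⟨z, E(dk) z⟩`. -/
lemma IsCyclicSeparating.exists_mem_tomitaGraph (h : M.IsCyclicSeparating Ω) {z : H}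
    (hz : Integrable Real.exp (M.logModularMeasure Ω z)) :
    ∃ y, (z, y) ∈ M.tomitaGraph Ω ∧ ‖y‖ ^ 2 = ∫ k, Real.exp k ∂(M.logModularMeasure Ω z) := by
  obtain ⟨y, hy, hq⟩ := h.exists_truncation z
  set L := M.logModular Ω with hL
  change Integrable Real.exp (L.scalar z) at hz
  change ∃ y, (z, y) ∈ M.tomitaGraph Ω ∧ ‖y‖ ^ 2 = ∫ k, Real.exp k ∂(L.scalar z)
  have hc := isBddMeasurable_cutoff
  have hce := isBddMeasurable_exp_mul_cutoff
  -- the square root of the truncated exponential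
  set f : ℕ → ℝ → ℂ := fun n k => (Real.exp (k / 2) : ℂ) * cutoff n k with hf
  have hfm : ∀ n, AEStronglyMeasurable (f n) (L.scalar z) := fun n =>
    ((Complex.measurable_ofReal.comp (Real.measurable_exp.comp (measurable_id.div_const 2))).mul
      (hc n).measurable).aestronglyMeasurable
  have hexp : ∀ k : ℝ, Real.exp (k / 2) ^ 2 = Real.exp k := fun k => by
    rw [← Real.exp_nat_mul]
    congr 1
    push_cast
    ring
  have hfb : ∀ n k, ‖f n k‖ ≤ Real.exp (k / 2) := fun n k => by
    rw [hf, norm_mul, Complex.norm_real, Real.norm_of_nonneg (Real.exp_nonneg _)]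
    exact mul_le_of_le_one_right (Real.exp_nonneg _) (norm_cutoff_le n k)
  have hflim : ∀ k, Tendsto (fun n => f n k) atTop (𝓝 (Real.exp (k / 2) : ℂ)) := fun k => by
    have := (tendsto_cutoff k).const_mul (Real.exp (k / 2) : ℂ)
    rwa [mul_one] at this
  have hbint : Integrable (fun k => Real.exp (k / 2) ^ 2) (L.scalar z) := by
    simp_rw [hexp]
    exact hz
  have hnorm : ∀ c : ℝ → ℂ, ∀ k, conj (c k) * ((Real.exp k : ℂ) * c k) =
      ((‖(Real.exp (k / 2) : ℂ) * c k‖ ^ 2 : ℝ) : ℂ) := fun c k => by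
    rw [norm_mul, Complex.norm_real, Real.norm_of_nonneg (Real.exp_nonneg _), mul_pow, hexp,
      Complex.ofReal_mul, Complex.ofReal_pow, ← Complex.conj_mul']
    ring
  have hcs : CauchySeq y := by
    refine cauchySeq_of_normSq_sub_le_integral (μ := L.scalar z) hfm hbint hfb hflim
      fun n m => le_of_eq ?_
    have hmem := tomitaGraph_sub_mem (hy n) (hy m)
    have h1 : ⟪y n - y m, y n - y m⟫_ℂ = ⟪L.integralOp (fun k => cutoff n k - cutoff m k) z,
        L.integralOp (fun k => (Real.exp k : ℂ) * (cutoff n k - cutoff m k)) z⟫_ℂ := by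
      have e1 := hq n _ hmem
      have e2 := hq m _ hmem
      simp only [Prod.mk_sub_mk] at e1 e2
      simp_rw [mul_sub]
      rw [L.integralOp_sub (hc n) (hc m), L.integralOp_sub (hce n) (hce m), sub_apply, sub_apply,
        inner_sub_left, ← e1, ← e2, ← inner_sub_right]
    have hsub : IsBddMeasurable fun k => (Real.exp k : ℂ) * (cutoff n k - cutoff m k) := by
      simp_rw [mul_sub]
      exact (hce n).sub (hce m)
    rw [L.inner_integralOp_integralOp ((hc n).sub (hc m)) hsub, inner_self_eq_ofReal_normSq] at h1
    simp_rw [hnorm (fun k => cutoff n k - cutoff m k)] at h1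
    rw [integral_complex_ofReal, Complex.ofReal_inj] at h1
    rw [h1]
    simp_rw [hf, mul_sub]
  obtain ⟨v, hv⟩ := cauchySeq_tendsto_of_complete hcs
  refine ⟨v, ?_, ?_⟩
  · have hzlim := L.tendsto_integralOp hc (.const 1) norm_cutoff_le tendsto_cutoff z
    rw [L.integralOp_one, one_apply_eq_self] at hzlim
    exact isClosed_tomitaGraph.mem_of_tendsto (hzlim.prodMk_nhds hv) (Eventually.of_forall hy)
  · refine tendsto_nhds_unique (hv.norm.pow 2) ?_
    have h1 : ∀ n, ‖y n‖ ^ 2 = ∫ k, ‖f n k‖ ^ 2 ∂(L.scalar z) := fun n => by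
      have e1 := hq n _ (hy n)
      simp only at e1
      rw [L.inner_integralOp_integralOp (hc n) (hce n), inner_self_eq_ofReal_normSq] at e1
      simp_rw [hnorm (cutoff n)] at e1
      rw [integral_complex_ofReal, Complex.ofReal_inj] at e1
      exact e1.symm
    simp_rw [h1]
    refine tendsto_integral_of_dominated_convergence (fun k => Real.exp (k / 2) ^ 2)
      (fun n => (hfm n).norm.pow 2) hbint (fun n => Eventually.of_forall fun k => ?_)
      (Eventually.of_forall fun k => ?_)
    · rw [Real.norm_of_nonneg (by positivity)]
      exact pow_le_pow_left₀ (norm_nonneg _) (hfb n k) 2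
    · have := (hflim k).norm.pow 2
      rwa [Complex.norm_real, Real.norm_of_nonneg (Real.exp_nonneg _), hexp] at this

/-- If `z` is in the domain of the Tomita operator `S` then `∫ eᵏ ⟨z, E(dk) z⟩ ≤ ‖S z‖²`. -/
lemma IsCyclicSeparating.integrable_exp (h : M.IsCyclicSeparating Ω) {z y : H}
    (hzy : (z, y) ∈ M.tomitaGraph Ω) :
    Integrable Real.exp (M.logModularMeasure Ω z) ∧
      ∫ k, Real.exp k ∂(M.logModularMeasure Ω z) ≤ ‖y‖ ^ 2 := by
  obtain ⟨w, hw, hq⟩ := h.exists_truncation z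
  set L := M.logModular Ω with hL
  change Integrable Real.exp (L.scalar z) ∧ ∫ k, Real.exp k ∂(L.scalar z) ≤ ‖y‖ ^ 2
  have hc := isBddMeasurable_cutoff
  have hce := isBddMeasurable_exp_mul_cutoff
  have hind : ∀ n : ℕ, (fun k => (Real.exp k : ℂ) * cutoff n k) =
      fun k => (((Iic (n : ℝ)).indicator Real.exp k : ℝ) : ℂ) := fun n => by
    funext k
    by_cases hk : k ∈ Iic (n : ℝ) <;> simp [cutoff, hk]
  have hind' : ∀ n : ℕ, (fun k => conj (cutoff n k) * ((Real.exp k : ℂ) * cutoff n k)) =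
      fun k => (((Iic (n : ℝ)).indicator Real.exp k : ℝ) : ℂ) := fun n => by
    funext k
    by_cases hk : k ∈ Iic (n : ℝ) <;> simp [cutoff, hk]
  have hle : ∀ n : ℕ, ∫ k in Iic (n : ℝ), Real.exp k ∂(L.scalar z) ≤ ‖y‖ ^ 2 := fun n => by
    have e1 := hq n _ hzy
    simp only at e1
    rw [L.inner_integralOp (hce n), hind, integral_complex_ofReal,
      integral_indicator measurableSet_Iic] at e1
    have e2 := hq n _ (hw n)
    simp only at e2
    rw [L.inner_integralOp_integralOp (hc n) (hce n), hind', integral_complex_ofReal,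
      integral_indicator measurableSet_Iic, inner_self_eq_ofReal_normSq, Complex.ofReal_inj] at e2
    have e3 : ‖w n‖ ^ 2 ≤ ‖w n‖ * ‖y‖ := by
      have := norm_inner_le_norm (𝕜 := ℂ) (w n) y
      rw [← e1, e2, Complex.norm_real, Real.norm_of_nonneg (by positivity)] at this
      exact this
    rw [e2]
    nlinarith [norm_nonneg (w n), norm_nonneg y, sq_nonneg (‖w n‖ - ‖y‖)]
  have hcov : AECover (L.scalar z) atTop fun n : ℕ => Iic (n : ℝ) :=
    aecover_Iic tendsto_natCast_atTop_atTop
  have hon : ∀ n : ℕ, IntegrableOn Real.exp (Iic (n : ℝ)) (L.scalar z) := fun n => by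
    refine Integrable.of_bound (C := Real.exp n) Real.measurable_exp.aestronglyMeasurable ?_
    filter_upwards [ae_restrict_mem measurableSet_Iic] with k hk
    rw [Real.norm_of_nonneg (Real.exp_nonneg _)]
    exact Real.exp_le_exp.2 hk
  have hint : Integrable Real.exp (L.scalar z) :=
    hcov.integrable_of_integral_bounded_of_nonneg_ae (‖y‖ ^ 2) hon
      (Eventually.of_forall fun k => Real.exp_nonneg k) (Eventually.of_forall hle)
  exact ⟨hint, le_of_tendsto (hcov.integral_tendsto_of_countably_generated hint)
    (Eventually.of_forall hle)⟩

/-- `Δ Ω = Ω`, so that `log Δ` has spectral measure `δ₀` in the vector `Ω`. -/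
lemma IsCyclicSeparating.ae_eq_zero (h : M.IsCyclicSeparating Ω) :
    ∀ᵐ k ∂((M.logModular Ω).scalar Ω), k = 0 := by
  set L := M.logModular Ω with hL
  have hc := isBddMeasurable_cutoff
  have hce := isBddMeasurable_exp_mul_cutoff
  have key : ∀ n : ℕ, ∀ᵐ k : ℝ ∂(L.scalar Ω), k ≤ (n : ℝ) → k = 0 := fun n => by
    have hφ : IsBddMeasurable fun k => ((Real.exp k : ℂ) - 1) * cutoff n k := by
      simp_rw [sub_mul, one_mul]
      exact (hce n).sub (hc n)
    have hφe : IsBddMeasurable fun k => (Real.exp k : ℂ) * (((Real.exp k : ℂ) - 1) * cutoff n k) := by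
      convert (hce n).mul hφ using 2 with k
      rcases le_or_gt k n with hk | hk
      · simp [cutoff_of_le hk]
      · simp [cutoff_of_lt hk]
    have e := h.isPositiveSelfAdjointGraph.symm _ self_mem_modularGraph _
      (h.integralOp_mem_modularGraph hφ hφe Ω)
    simp only at e
    rw [← hL, L.inner_integralOp hφe, L.inner_integralOp hφ, ← sub_eq_zero,
      ← integral_sub (hφe.integrable _) (hφ.integrable _)] at e
    have hfun : (fun k => (Real.exp k : ℂ) * (((Real.exp k : ℂ) - 1) * cutoff n k) -
        ((Real.exp k : ℂ) - 1) * cutoff n k) =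
        fun k => (((Iic (n : ℝ)).indicator (fun k => (Real.exp k - 1) ^ 2) k : ℝ) : ℂ) := by
      funext k
      rcases le_or_gt k n with hk | hk
      · rw [cutoff_of_le hk, indicator_of_mem (show k ∈ Iic (n : ℝ) from hk)]
        push_cast
        ring
      · rw [cutoff_of_lt hk, indicator_of_notMem (show k ∉ Iic (n : ℝ) from not_le.2 hk)]
        simp
    have hint := (hφe.sub hφ).integrable (L.scalar Ω)
    rw [hfun] at e hint
    rw [integral_complex_ofReal, Complex.ofReal_eq_zero, integral_eq_zero_iff_of_nonneg
      (fun k => indicator_nonneg (fun _ _ => sq_nonneg _) k) (by simpa using hint.re)] at e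
    filter_upwards [e] with k hk hkn
    rw [indicator_of_mem (show k ∈ Iic (n : ℝ) from hkn)] at hk
    have : Real.exp k = 1 := by simpa [sub_eq_zero] using hk
    simpa using this
  filter_upwards [ae_all_iff.2 key] with k hk
  exact hk _ (Nat.le_ceil k)

lemma isBddMeasurable_exp_I (t : ℝ) :
    IsBddMeasurable fun k : ℝ => Complex.exp (Complex.I * t * k) := by
  refine ⟨by fun_prop, 1, fun k => le_of_eq ?_⟩
  rw [mul_assoc, ← Complex.ofReal_mul, mul_comm, Complex.norm_exp_ofReal_mul_I]

lemma IsCyclicSeparating.modularUnitary_apply_self (h : M.IsCyclicSeparating Ω) (t : ℝ) :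
    M.modularUnitary Ω t Ω = Ω := by
  rw [modularUnitary, ProjValuedMeasure.integralOp_apply_eq_of_ae _ (isBddMeasurable_exp_I t)
    (.const 1) (g := fun _ => 1), ProjValuedMeasure.integralOp_one, one_apply_eq_self]
  filter_upwards [h.ae_eq_zero] with k hk
  simp [hk]

lemma IsCyclicSeparating.modularFlow_apply_self (h : M.IsCyclicSeparating Ω) (t : ℝ)
    (a : H →L[ℂ] H) : M.modularFlow Ω t a Ω =
      (M.logModular Ω).integralOp (fun k => Complex.exp (Complex.I * t * k)) (a Ω) := by
  rw [modularFlow, mul_apply_eq_comp, mul_apply_eq_comp, h.modularUnitary_apply_self]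
  rfl

end VonNeumannAlgebra

/-! ### Comparison of the resolvents of the two modular operators -/

/-- The function `κ ↦ 1 / (1 + e^κ)`. With `s = e^{-u}` it expresses the resolvent of `Δ` as
`s (s + Δ)⁻¹ = fermi (log Δ + u)`. -/
noncomputable def fermi (κ : ℝ) : ℝ := (1 + Real.exp κ)⁻¹

lemma fermi_pos (κ : ℝ) : 0 < fermi κ := inv_pos.2 (by positivity)

lemma fermi_le_one (κ : ℝ) : fermi κ ≤ 1 :=
  inv_le_one_of_one_le₀ (by linarith [Real.exp_pos κ])

lemma continuous_fermi : Continuous fermi :=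
  (by fun_prop : Continuous fun κ => 1 + Real.exp κ).inv₀ fun κ => by positivity

lemma exp_mul_fermi (κ : ℝ) : Real.exp κ * fermi κ = 1 - fermi κ := by
  have : 1 + Real.exp κ ≠ 0 := by positivity
  rw [fermi]
  field_simp
  ring

lemma isBddMeasurable_fermi (u : ℝ) : IsBddMeasurable fun k => (fermi (k + u) : ℂ) := by
  refine ⟨(Complex.continuous_ofReal.comp
    (continuous_fermi.comp (continuous_add_const u))).measurable, 1, fun k => ?_⟩
  rw [Complex.norm_real, Real.norm_of_nonneg (fermi_pos _).le]
  exact fermi_le_one _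

lemma integrable_fermi (u : ℝ) (μ : Measure ℝ) [IsFiniteMeasure μ] :
    Integrable (fun k => fermi (k + u)) μ := by
  simpa using ((isBddMeasurable_fermi u).integrable μ).re

namespace VonNeumannAlgebra

variable {H : Type u} [NormedAddCommGroup H] [InnerProductSpace ℂ H] [CompleteSpace H]
  {M M₁ M₂ : VonNeumannAlgebra H} {Ω x : H}

instance isFiniteMeasure_logModularMeasure : IsFiniteMeasure (M.logModularMeasure Ω x) :=
  ProjValuedMeasure.isFiniteMeasure_scalar _ _

lemma integrable_normSq_mul_exp (hx : Integrable Real.exp (M.logModularMeasure Ω x)) {f : ℝ → ℂ}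
    (hf : IsBddMeasurable f) :
    Integrable (fun k => ‖f k‖ ^ 2 * Real.exp k) (M.logModularMeasure Ω x) := by
  obtain ⟨C, hC⟩ := hf.exists_bound
  refine hx.bdd_mul (c := C ^ 2) (hf.measurable.norm.pow_const 2).aestronglyMeasurable
    (Eventually.of_forall fun k => ?_)
  rw [Real.norm_of_nonneg (by positivity)]
  exact pow_le_pow_left₀ (norm_nonneg _) (hC k) 2

/-- For bounded `f`, the vector `f(log Δ) x` is in the domain of the Tomita operator as soon as `x`
is, and the norm of its image is computed by the spectral measure of `x`. -/
lemma IsCyclicSeparating.exists_integralOp_mem (h : M.IsCyclicSeparating Ω)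
    (hx : Integrable Real.exp (M.logModularMeasure Ω x)) {f : ℝ → ℂ} (hf : IsBddMeasurable f) :
    ∃ y, ((M.logModular Ω).integralOp f x, y) ∈ M.tomitaGraph Ω ∧
      ‖y‖ ^ 2 = ∫ k, ‖f k‖ ^ 2 * Real.exp k ∂(M.logModularMeasure Ω x) := by
  have hd := (M.logModular Ω).scalar_integralOp hf x
  have hm : Measurable fun k => ENNReal.ofReal (‖f k‖ ^ 2) :=
    (hf.measurable.norm.pow_const 2).ennreal_ofReal
  have htr : ∀ k, (ENNReal.ofReal (‖f k‖ ^ 2)).toReal = ‖f k‖ ^ 2 := fun k =>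
    ENNReal.toReal_ofReal (by positivity)
  have hint : Integrable Real.exp (M.logModularMeasure Ω ((M.logModular Ω).integralOp f x)) := by
    rw [logModularMeasure, hd, integrable_withDensity_iff hm
      (Eventually.of_forall fun k => ENNReal.ofReal_lt_top)]
    simp_rw [htr, mul_comm (Real.exp _)]
    exact integrable_normSq_mul_exp hx hf
  obtain ⟨y, hy, hnorm⟩ := h.exists_mem_tomitaGraph hint
  refine ⟨y, hy, ?_⟩
  rw [hnorm, logModularMeasure, hd, integral_withDensity_eq_integral_toReal_smul hm
    (Eventually.of_forall fun k => ENNReal.ofReal_lt_top)]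
  simp_rw [htr, smul_eq_mul]
  rfl

lemma exp_mul_fermi_add (u : ℝ) : (fun k : ℝ => (Real.exp k : ℂ) * fermi (k + u)) =
    fun k => (Real.exp (-u) : ℂ) * (1 - fermi (k + u)) := by
  funext k
  rw [← Complex.ofReal_mul, ← Complex.ofReal_one, ← Complex.ofReal_sub, ← exp_mul_fermi,
    ← Complex.ofReal_mul, ← mul_assoc, ← Real.exp_add]
  congr 3
  ring_nf

lemma integralOp_exp_mul_fermi (u : ℝ) (x : H) :
    (M.logModular Ω).integralOp (fun k => (Real.exp k : ℂ) * fermi (k + u)) x =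
      (Real.exp (-u) : ℂ) • (x - (M.logModular Ω).integralOp (fun k => (fermi (k + u) : ℂ)) x) := by
  rw [exp_mul_fermi_add, ProjValuedMeasure.integralOp_const_mul _ _ ((IsBddMeasurable.const 1).sub
    (isBddMeasurable_fermi u)), ProjValuedMeasure.integralOp_sub _ (.const 1)
    (isBddMeasurable_fermi u), ProjValuedMeasure.integralOp_one]
  rfl

lemma isBddMeasurable_exp_mul_fermi (u : ℝ) :
    IsBddMeasurable fun k => (Real.exp k : ℂ) * fermi (k + u) := by
  rw [exp_mul_fermi_add]
  exact ((IsBddMeasurable.const 1).sub (isBddMeasurable_fermi u)).const_mul _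

/-- The resolvent vector `R = (Δ + s)⁻¹ s x`, `s = e^{-u}`, and its image under the Tomita operator,
characterised by the weak equation `S* S R = s (x - R)`. -/
lemma IsCyclicSeparating.exists_resolvent_mem (h : M.IsCyclicSeparating Ω) (u : ℝ) (x : H) :
    ∃ y, ((M.logModular Ω).integralOp (fun k => (fermi (k + u) : ℂ)) x, y) ∈ M.tomitaGraph Ω ∧
      (∀ q ∈ M.tomitaGraph Ω, (Real.exp (-u) : ℂ) *
        ⟪q.1, x - (M.logModular Ω).integralOp (fun k => (fermi (k + u) : ℂ)) x⟫_ℂ = ⟪y, q.2⟫_ℂ) ∧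
      Real.exp (-u) * ∫ k, fermi (k + u) ∂(M.logModularMeasure Ω x) = Real.exp (-u) *
        ‖(M.logModular Ω).integralOp (fun k => (fermi (k + u) : ℂ)) x‖ ^ 2 + ‖y‖ ^ 2 := by
  obtain ⟨y, hy, hq⟩ := h.integralOp_mem_modularGraph (isBddMeasurable_fermi u)
    (isBddMeasurable_exp_mul_fermi u) x
  simp only at hy hq
  rw [integralOp_exp_mul_fermi] at hq
  simp_rw [inner_smul_right] at hq
  refine ⟨y, hy, hq, ?_⟩
  have h1 := hq _ hy
  have h2 := (M.logModular Ω).inner_integralOp (isBddMeasurable_fermi u) x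
  rw [integral_complex_ofReal] at h2
  rw [inner_sub_right, inner_self_eq_ofReal_normSq, inner_self_eq_ofReal_normSq,
    ← inner_conj_symm, h2, Complex.conj_ofReal] at h1
  have h3 : Real.exp (-u) * (∫ k, fermi (k + u) ∂(M.logModularMeasure Ω x) -
      ‖(M.logModular Ω).integralOp (fun k => (fermi (k + u) : ℂ)) x‖ ^ 2) = ‖y‖ ^ 2 := by
    exact_mod_cast h1
  linarith

/-- The resolvent vector of the smaller algebra is the orthogonal projection, in the graph norm, of
that of the larger algebra onto the domain of the smaller Tomita operator. Hence the difference of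
the expectation values of the resolvents is nonnegative, and any vector `φ(log Δ₁) x` in that domain
gives an upper bound. -/
lemma fermi_integral_sub_bounds (hM : M₂ ≤ M₁) (h₁ : M₁.IsCyclicSeparating Ω)
    (h₂ : M₂.IsCyclicSeparating Ω) (hx : Integrable Real.exp (M₁.logModularMeasure Ω x)) (u : ℝ)
    {φ : ℝ → ℂ} (hφ : IsBddMeasurable φ) {y : H}
    (hy : ((M₁.logModular Ω).integralOp φ x, y) ∈ M₂.tomitaGraph Ω) :
    0 ≤ ∫ k, fermi (k + u) ∂(M₁.logModularMeasure Ω x) -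
        ∫ k, fermi (k + u) ∂(M₂.logModularMeasure Ω x) ∧
    ∫ k, fermi (k + u) ∂(M₁.logModularMeasure Ω x) -
        ∫ k, fermi (k + u) ∂(M₂.logModularMeasure Ω x) ≤
      ∫ k, ‖fermi (k + u) - φ k‖ ^ 2 * (1 + Real.exp (k + u)) ∂(M₁.logModularMeasure Ω x) := by
  obtain ⟨y₁, hy₁, hq₁, he₁⟩ := h₁.exists_resolvent_mem u x
  obtain ⟨y₂, hy₂, hq₂, he₂⟩ := h₂.exists_resolvent_mem u x
  set L₁ := M₁.logModular Ω with hL₁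
  set s := Real.exp (-u) with hs
  have hs0 : 0 < s := Real.exp_pos _
  set R₁ := L₁.integralOp (fun k => (fermi (k + u) : ℂ)) x with hR₁
  set R₂ := (M₂.logModular Ω).integralOp (fun k => (fermi (k + u) : ℂ)) x with hR₂
  set I₁ := ∫ k, fermi (k + u) ∂(M₁.logModularMeasure Ω x) with hI₁
  set I₂ := ∫ k, fermi (k + u) ∂(M₂.logModularMeasure Ω x) with hI₂
  -- Pythagoras in the graph norm
  have hpyth : ∀ q ∈ M₂.tomitaGraph Ω, s * ‖q.1 + (R₁ - R₂)‖ ^ 2 + ‖(y₁ - y₂) + q.2‖ ^ 2 =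
      (s * ‖R₁ - R₂‖ ^ 2 + ‖y₁ - y₂‖ ^ 2) + (s * ‖q.1‖ ^ 2 + ‖q.2‖ ^ 2) := fun q hq => by
    have e1 := hq₁ q (tomitaGraph_mono hM hq)
    have e2 := hq₂ q hq
    have e3 : (s : ℂ) * ⟪q.1, R₁ - R₂⟫_ℂ = -⟪y₁ - y₂, q.2⟫_ℂ := by
      rw [inner_sub_left, ← e1, ← e2, ← mul_sub, ← inner_sub_right, neg_mul_eq_mul_neg,
        ← inner_neg_right]
      congr 2
      abel
    have e4 := congrArg Complex.re e3
    rw [Complex.re_ofReal_mul, Complex.neg_re] at e4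
    rw [@norm_add_sq ℂ, @norm_add_sq ℂ, RCLike.re_to_complex, RCLike.re_to_complex]
    linear_combination 2 * e4
  have hmain : s * (I₁ - I₂) = s * ‖R₁ - R₂‖ ^ 2 + ‖y₁ - y₂‖ ^ 2 := by
    have := hpyth _ hy₂
    simp only [add_sub_cancel, sub_add_cancel] at this
    linarith
  constructor
  · have : 0 ≤ s * (I₁ - I₂) := hmain ▸ by positivity
    exact nonneg_of_mul_nonneg_right this hs0
  · have hle : s * (I₁ - I₂) ≤ s * ‖R₁ - L₁.integralOp φ x‖ ^ 2 + ‖y₁ - y‖ ^ 2 := by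
      have := hpyth _ (tomitaGraph_sub_mem hy₂ hy)
      simp only [Prod.mk_sub_mk] at this
      rw [show R₂ - L₁.integralOp φ x + (R₁ - R₂) = R₁ - L₁.integralOp φ x by abel,
        show y₁ - y₂ + (y₂ - y) = y₁ - y by abel] at this
      rw [this, hmain]
      exact le_add_of_nonneg_right (by positivity)
    have hsub := (isBddMeasurable_fermi u).sub hφ
    have hRsub : R₁ - L₁.integralOp φ x = L₁.integralOp (fun k => fermi (k + u) - φ k) x := by
      rw [L₁.integralOp_sub (isBddMeasurable_fermi u) hφ, sub_apply]
    obtain ⟨z, hz, hznorm⟩ := h₁.exists_integralOp_mem hx hsub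
    have hzy : z = y₁ - y := by
      refine h₁.tomitaGraph_unique hz ?_
      rw [← hL₁, ← hRsub]
      exact tomitaGraph_sub_mem hy₁ (tomitaGraph_mono hM hy)
    rw [← hzy, hznorm, hRsub, L₁.normSq_integralOp hsub] at hle
    have hint : ∫ k, ‖fermi (k + u) - φ k‖ ^ 2 * (1 + Real.exp (k + u))
        ∂(M₁.logModularMeasure Ω x) = ∫ k, ‖fermi (k + u) - φ k‖ ^ 2 ∂(L₁.scalar x) +
          Real.exp u * ∫ k, ‖fermi (k + u) - φ k‖ ^ 2 * Real.exp k
            ∂(M₁.logModularMeasure Ω x) := by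
      rw [← integral_const_mul]
      change _ = ∫ k, ‖fermi (k + u) - φ k‖ ^ 2 ∂(M₁.logModularMeasure Ω x) + _
      rw [← integral_add (hsub.integrable_normSq _)
        ((integrable_normSq_mul_exp hx hsub).const_mul _)]
      congr 1
      funext k
      rw [Real.exp_add]
      ring
    rw [hint]
    have hsu : s * Real.exp u = 1 := by rw [hs, ← Real.exp_add]; simp
    refine le_of_mul_le_mul_left (hle.trans_eq ?_) hs0
    rw [mul_add, ← mul_assoc, hsu, one_mul]

/-- The bounded functions `φ` for which `φ(log Δ₁) x` is in the domain of the Tomita operator of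
`M₂`. -/
structure IsAdmissible (M₁ M₂ : VonNeumannAlgebra H) (Ω x : H) (φ : ℝ → ℂ) : Prop where
  isBddMeasurable : IsBddMeasurable φ
  exists_mem : ∃ y, ((M₁.logModular Ω).integralOp φ x, y) ∈ M₂.tomitaGraph Ω

namespace IsAdmissible

variable {φ χ : ℝ → ℂ}

lemma add (hφ : IsAdmissible M₁ M₂ Ω x φ) (hχ : IsAdmissible M₁ M₂ Ω x χ) :
    IsAdmissible M₁ M₂ Ω x fun k => φ k + χ k := by
  obtain ⟨y, hy⟩ := hφ.exists_mem
  obtain ⟨z, hz⟩ := hχ.exists_mem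
  refine ⟨hφ.isBddMeasurable.add hχ.isBddMeasurable, y + z, ?_⟩
  rw [ProjValuedMeasure.integralOp_add _ hφ.isBddMeasurable hχ.isBddMeasurable]
  exact tomitaGraph_add_mem hy hz

lemma const_mul (c : ℂ) (hφ : IsAdmissible M₁ M₂ Ω x φ) :
    IsAdmissible M₁ M₂ Ω x fun k => c * φ k := by
  obtain ⟨y, hy⟩ := hφ.exists_mem
  refine ⟨hφ.isBddMeasurable.const_mul c, conj c • y, ?_⟩
  rw [ProjValuedMeasure.integralOp_const_mul _ _ hφ.isBddMeasurable]
  exact tomitaGraph_smul_mem c hy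

lemma zero : IsAdmissible M₁ M₂ Ω x fun _ => 0 := by
  refine ⟨.const 0, 0, ?_⟩
  rw [ProjValuedMeasure.integralOp_const, zero_smul]
  simpa using mem_tomitaGraph (M := M₂) (Ω := Ω) (zero_mem M₂)

lemma sum {ι : Type*} (s : Finset ι) {φ : ι → ℝ → ℂ}
    (h : ∀ i ∈ s, IsAdmissible M₁ M₂ Ω x (φ i)) :
    IsAdmissible M₁ M₂ Ω x fun k => ∑ i ∈ s, φ i k := by
  classical
  induction s using Finset.induction_on with
  | empty => simpa using zero
  | insert a s ha ih =>
    simp_rw [Finset.sum_insert ha]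
    exact (h a (Finset.mem_insert_self a s)).add
      (ih fun i hi => h i (Finset.mem_insert_of_mem hi))

/-- Admissibility is preserved by bounded pointwise limits, since the Tomita operator of `M₂` is
closed. -/
lemma of_tendsto (hM : M₂ ≤ M₁) (h₁ : M₁.IsCyclicSeparating Ω)
    (hx : Integrable Real.exp (M₁.logModularMeasure Ω x)) {φ : ℕ → ℝ → ℂ}
    (hφ : ∀ n, IsAdmissible M₁ M₂ Ω x (φ n)) {C : ℝ} (hC : ∀ n k, ‖φ n k‖ ≤ C)
    (hlim : ∀ k, Tendsto (fun n => φ n k) atTop (𝓝 (χ k))) : IsAdmissible M₁ M₂ Ω x χ := by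
  have hφm : ∀ n, IsBddMeasurable (φ n) := fun n => (hφ n).isBddMeasurable
  have hCχ : ∀ k, ‖χ k‖ ≤ C := fun k => le_of_tendsto (hlim k).norm (Eventually.of_forall (hC · k))
  have hχ : IsBddMeasurable χ :=
    ⟨measurable_of_tendsto_metrizable (fun n => (hφm n).measurable) (tendsto_pi_nhds.2 hlim),
      C, hCχ⟩
  refine ⟨hχ, ?_⟩
  choose y hy using fun n => (hφ n).exists_mem
  obtain ⟨z, hz, -⟩ := h₁.exists_integralOp_mem hx hχ
  refine ⟨z, isClosed_tomitaGraph.mem_of_tendsto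
    (((M₁.logModular Ω).tendsto_integralOp hφm hχ hC hlim x).prodMk_nhds ?_)
    (Eventually.of_forall hy)⟩
  have h0 : Tendsto (fun n => ∫ k, ‖φ n k - χ k‖ ^ 2 * Real.exp k ∂(M₁.logModularMeasure Ω x))
      atTop (𝓝 (∫ _, (0 : ℝ) ∂(M₁.logModularMeasure Ω x))) := by
    refine tendsto_integral_of_dominated_convergence (fun k => (C + C) ^ 2 * Real.exp k)
      (fun n => (((hφm n).sub hχ).measurable.norm.pow_const 2).mul
        Real.measurable_exp |>.aestronglyMeasurable) (hx.const_mul _)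
      (fun n => Eventually.of_forall fun k => ?_) (Eventually.of_forall fun k => ?_)
    · rw [Real.norm_of_nonneg (by positivity)]
      gcongr
      exact (norm_sub_le _ _).trans (add_le_add (hC n k) (hCχ k))
    · simpa using (((hlim k).sub_const (χ k)).norm.pow 2).mul_const (Real.exp k)
  rw [tendsto_iff_norm_sub_tendsto_zero]
  have h1 : ∀ n, ‖y n - z‖ =
      Real.sqrt (∫ k, ‖φ n k - χ k‖ ^ 2 * Real.exp k ∂(M₁.logModularMeasure Ω x)) := fun n => by
    obtain ⟨w, hw, hwn⟩ := h₁.exists_integralOp_mem hx ((hφm n).sub hχ)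
    have : w = y n - z := by
      refine h₁.tomitaGraph_unique hw ?_
      rw [ProjValuedMeasure.integralOp_sub _ (hφm n) hχ, sub_apply]
      exact tomitaGraph_sub_mem (tomitaGraph_mono hM (hy n)) hz
    rw [← hwn, Real.sqrt_sq (norm_nonneg _), this]
  simp_rw [h1]
  simpa using h0.sqrt

/-- If the modular flow of `M₁` at time `t` maps `a` into `M₂`, then `Δ₁^{it} a Ω` is in the domain of
the Tomita operator of `M₂`. -/
lemma exp_I (h₁ : M₁.IsCyclicSeparating Ω) {a : H →L[ℂ] H} {t : ℝ}
    (ha : M₁.modularFlow Ω t a ∈ M₂) :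
    IsAdmissible M₁ M₂ Ω (a Ω) fun k => Complex.exp (Complex.I * t * k) :=
  ⟨isBddMeasurable_exp_I t, _, by
    rw [← h₁.modularFlow_apply_self]
    exact mem_tomitaGraph ha⟩

end IsAdmissible

end VonNeumannAlgebra

/-! ### Band-limited approximation of the resolvent function -/

section MittagLeffler

lemma cot_eq_fermi (κ : ℝ) :
    Complex.cot (Real.pi * (1 / 2 + Complex.I * κ / (2 * Real.pi))) =
      -Complex.I * ((1 - 2 * fermi κ : ℝ) : ℂ) := by
  have hpi : (Real.pi : ℂ) ≠ 0 := Complex.ofReal_ne_zero.2 Real.pi_ne_zero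
  have h1 : (Real.pi : ℂ) * (1 / 2 + Complex.I * κ / (2 * Real.pi)) =
      ((κ / 2 : ℝ) : ℂ) * Complex.I + Real.pi / 2 := by
    push_cast
    field_simp
    ring
  have hcosh : Real.cosh (κ / 2) ≠ 0 := (Real.cosh_pos _).ne'
  have h2 : (1 - 2 * fermi κ) = Real.sinh (κ / 2) / Real.cosh (κ / 2) := by
    rw [eq_div_iff hcosh, Real.cosh_eq, Real.sinh_eq, fermi, Real.exp_neg]
    have h3 : Real.exp κ = Real.exp (κ / 2) * Real.exp (κ / 2) := by
      rw [← Real.exp_add, add_halves]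
    rw [h3]
    have h4 : 0 < Real.exp (κ / 2) := Real.exp_pos _
    field_simp
    ring
  rw [h1, Complex.cot, Complex.cos_add_pi_div_two, Complex.sin_add_pi_div_two, Complex.sin_mul_I,
    Complex.cos_mul_I, h2, ← Complex.ofReal_sinh, ← Complex.ofReal_cosh]
  push_cast
  ring

/-- The partial fraction expansion of `1 / (1 + e^κ)`, obtained from that of the cotangent. -/
lemma tendsto_fermi_partialFractions (κ : ℝ) :
    Tendsto (fun N : ℕ => 1 / 2 - 2 * ∑ m ∈ Finset.range N,
      κ / (κ ^ 2 + ((2 * m + 1) * Real.pi) ^ 2)) atTop (𝓝 (fermi κ)) := by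
  have hpi : (Real.pi : ℂ) ≠ 0 := Complex.ofReal_ne_zero.2 Real.pi_ne_zero
  set z : ℂ := 1 / 2 + Complex.I * κ / (2 * Real.pi) with hz
  have hre : z.re = 1 / 2 := by
    have : Complex.I * κ / (2 * Real.pi) = ((κ / (2 * Real.pi) : ℝ) : ℂ) * Complex.I := by
      push_cast
      ring
    rw [hz, this, Complex.add_re, Complex.re_ofReal_mul, Complex.I_re]
    norm_num
  have hzc : z ∈ Complex.integerComplement := by
    rw [Complex.mem_integerComplement_iff]
    rintro ⟨n, hn⟩
    have h1 := congrArg Complex.re hn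
    rw [hre, Complex.intCast_re] at h1
    have h2 : (2 * n : ℝ) = 1 := by linarith
    have h3 : (2 * n : ℤ) = 1 := by exact_mod_cast h2
    omega
  -- regroup the terms of the cotangent series around `1 / 2`
  have hsum : ∀ N : ℕ, ∑ j ∈ Finset.range N, cotTerm z j + 1 / z =
      ∑ m ∈ Finset.range N, (1 / (z + m) + 1 / (z - (m + 1))) + 1 / (z + N) := fun N => by
    induction N with
    | zero => simp
    | succ N ih =>
      rw [Finset.sum_range_succ, Finset.sum_range_succ, add_right_comm, ih, cotTerm]
      push_cast
      ring
  have hterm : ∀ m : ℕ, 1 / (z + m) + 1 / (z - (m + 1)) =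
      (-4 * Real.pi * Complex.I) * ((κ / (κ ^ 2 + ((2 * m + 1) * Real.pi) ^ 2) : ℝ) : ℂ) :=
    fun m => by
      have e1 : z + m ≠ 0 := fun h => by
        have := congrArg Complex.re h
        rw [Complex.add_re, hre, Complex.natCast_re, Complex.zero_re] at this
        linarith [(Nat.cast_nonneg m : (0 : ℝ) ≤ m)]
      have e2 : z - (m + 1) ≠ 0 := fun h => by
        have := congrArg Complex.re h
        rw [Complex.sub_re, hre, Complex.add_re, Complex.natCast_re, Complex.one_re,
          Complex.zero_re] at this
        linarith [(Nat.cast_nonneg m : (0 : ℝ) ≤ m)]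
      have e3 : ((κ ^ 2 + ((2 * m + 1) * Real.pi) ^ 2 : ℝ) : ℂ) ≠ 0 := by
        refine Complex.ofReal_ne_zero.2 (ne_of_gt ?_)
        have : 0 < Real.pi := Real.pi_pos
        positivity
      have e4 : ((κ ^ 2 + ((2 * m + 1) * Real.pi) ^ 2 : ℝ) : ℂ) =
          -(4 * Real.pi ^ 2) * ((z + m) * (z - (m + 1))) := by
        rw [hz]
        push_cast
        field_simp
        linear_combination (4 * (κ : ℂ) ^ 2) * Complex.I_sq
      rw [one_div_add_one_div e1 e2, Complex.ofReal_div, e4, div_eq_iff (mul_ne_zero e1 e2)]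
      have e5 : (z + m) + (z - (m + 1)) = Complex.I * κ / Real.pi := by
        rw [hz]
        field_simp
        ring
      rw [e5]
      field_simp
  have hlim := (tendsto_logDeriv_euler_cot_sub hzc).add_const (1 / z)
  simp_rw [hsum, hterm, ← Finset.mul_sum] at hlim
  rw [sub_add_cancel, cot_eq_fermi] at hlim
  have h0 : Tendsto (fun N : ℕ => 1 / (z + N)) atTop (𝓝 0) := by
    simp_rw [one_div]
    refine tendsto_inv₀_cobounded.comp ?_
    exact (tendsto_const_add_cobounded z).comp tendsto_natCast_atTop_cobounded
  have h1 := (hlim.sub h0)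
  simp only [add_sub_cancel_right, sub_zero] at h1
  have h2 := (Complex.continuous_re.tendsto _).comp
    ((h1.const_mul (Complex.I / (-2 * Real.pi))).const_add (1 / 2))
  convert h2 using 1
  · funext N
    rw [Function.comp, ← Complex.ofReal_sum]
    generalize ∑ m ∈ Finset.range N, κ / (κ ^ 2 + ((2 * m + 1) * Real.pi) ^ 2) = S
    rw [← Complex.ofReal_re (1 / 2 - 2 * S)]
    congr 1
    push_cast
    field_simp
    linear_combination (-4 * (S : ℂ)) * Complex.I_sq
  · congr 1
    rw [← Complex.ofReal_re (fermi κ)]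
    congr 1
    push_cast
    field_simp
    linear_combination (2 * (fermi κ : ℂ) - 1) * Complex.I_sq

end MittagLeffler

/-- The band-limited function `κ ↦ ∫_0^τ e^{(iκ - a) t} dt`. -/
noncomputable def expIntegral (a τ κ : ℝ) : ℂ :=
  (Complex.exp ((Complex.I * κ - a) * τ) - 1) / (Complex.I * κ - a)

/-- The band-limited function `κ ↦ ∫_0^τ sin(κ t) e^{-a t} dt`. -/
noncomputable def sinIntegral (a τ κ : ℝ) : ℂ :=
  (expIntegral a τ κ - expIntegral a τ (-κ)) / (2 * Complex.I)

lemma norm_exp_sub_mul (a τ κ : ℝ) :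
    ‖Complex.exp ((Complex.I * κ - a) * τ)‖ = Real.exp (-(a * τ)) := by
  rw [Complex.norm_exp]
  congr 1
  simp

lemma le_norm_I_mul_sub (a κ : ℝ) : a ≤ ‖Complex.I * κ - a‖ := by
  have h := Complex.abs_re_le_norm (Complex.I * κ - a)
  have h2 : (Complex.I * κ - a : ℂ).re = -a := by simp
  rw [h2, abs_neg] at h
  exact (le_abs_self a).trans h

lemma I_mul_sub_ne_zero {a : ℝ} (ha : 0 < a) (κ : ℝ) : (Complex.I * κ - a : ℂ) ≠ 0 :=
  norm_pos_iff.1 (ha.trans_le (le_norm_I_mul_sub a κ))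

/-- Extending the integral of `sin(κ t) e^{-a t}` to infinity gives `κ / (κ² + a²)`, with an error
bounded by the tail `e^{-aτ} / a`. -/
lemma norm_sub_sinIntegral_le {a : ℝ} (ha : 0 < a) (τ κ : ℝ) :
    ‖((κ / (κ ^ 2 + a ^ 2) : ℝ) : ℂ) - sinIntegral a τ κ‖ ≤ Real.exp (-(a * τ)) / a := by
  have h1 := I_mul_sub_ne_zero ha κ
  have h2 := I_mul_sub_ne_zero ha (-κ)
  have h3 : (κ : ℂ) ^ 2 + a ^ 2 = (Complex.I * κ - a) * (Complex.I * (-κ : ℝ) - a) := by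
    push_cast
    linear_combination ((κ : ℂ) ^ 2) * Complex.I_sq
  set A := Complex.exp ((Complex.I * κ - a) * τ) with hA
  set B := Complex.exp ((Complex.I * (-κ : ℝ) - a) * τ) with hB
  have hI : Complex.I ≠ 0 := Complex.I_ne_zero
  have key : ((κ / (κ ^ 2 + a ^ 2) : ℝ) : ℂ) - sinIntegral a τ κ =
      (B / (Complex.I * (-κ : ℝ) - a) - A / (Complex.I * κ - a)) / (2 * Complex.I) := by
    rw [sinIntegral, expIntegral, expIntegral, ← hA, ← hB]
    have e1 : ((κ / (κ ^ 2 + a ^ 2) : ℝ) : ℂ) =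
        (1 / (Complex.I * (-κ : ℝ) - a) - 1 / (Complex.I * κ - a)) / (2 * Complex.I) := by
      rw [Complex.ofReal_div, Complex.ofReal_add, Complex.ofReal_pow, Complex.ofReal_pow, h3,
        div_sub_div _ _ h2 h1, div_div, div_eq_div_iff (mul_ne_zero h1 h2)
        (mul_ne_zero (mul_ne_zero h2 h1) (mul_ne_zero two_ne_zero hI))]
      push_cast
      ring
    rw [e1]
    ring
  have hA1 : ‖A / (Complex.I * κ - a)‖ ≤ Real.exp (-(a * τ)) / a := by
    rw [norm_div, hA, norm_exp_sub_mul]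
    gcongr
    exact le_norm_I_mul_sub a κ
  have hB1 : ‖B / (Complex.I * (-κ : ℝ) - a)‖ ≤ Real.exp (-(a * τ)) / a := by
    rw [norm_div, hB, norm_exp_sub_mul]
    gcongr
    exact le_norm_I_mul_sub a (-κ)
  rw [key, norm_div, norm_mul, Complex.norm_I, mul_one, Complex.norm_two, div_le_iff₀ two_pos]
  exact (norm_sub_le _ _).trans (by linarith)

/-- `expIntegral` as a limit of Riemann sums, which are geometric sums of exponentials. -/
lemma tendsto_riemannSum {a τ : ℝ} (ha : 0 < a) (hτ : 0 < τ) (κ : ℝ) :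
    Tendsto (fun n : ℕ => ∑ j ∈ Finset.range (n + 1), ((τ / (n + 1) : ℝ) : ℂ) *
      Complex.exp ((Complex.I * κ - a) * (j * (τ / (n + 1)) : ℝ))) atTop
      (𝓝 (expIntegral a τ κ)) := by
  set z : ℂ := Complex.I * κ - a with hz
  have hz0 : z ≠ 0 := I_mul_sub_ne_zero ha κ
  set δ : ℕ → ℝ := fun n => τ / (n + 1) with hδ
  have hδpos : ∀ n, 0 < δ n := fun n => by positivity
  have hδlim : Tendsto δ atTop (𝓝 0) := by
    have := (tendsto_one_div_add_atTop_nhds_zero_nat (𝕜 := ℝ)).const_mul τ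
    simpa [hδ, div_eq_mul_inv] using this
  have hne : ∀ n, Complex.exp (z * δ n) ≠ 1 := fun n h => by
    have h1 := congrArg norm h
    rw [hz, norm_exp_sub_mul, norm_one, Real.exp_eq_one_iff] at h1
    have := mul_pos ha (hδpos n)
    linarith
  have hsum : ∀ n : ℕ, ∑ j ∈ Finset.range (n + 1), (δ n : ℂ) *
      Complex.exp (z * (j * δ n : ℝ)) =
      (Complex.exp (z * τ) - 1) / (((δ n)⁻¹ : ℝ) * (Complex.exp (z * δ n) - 1)) := fun n => by
    have h1 : ∀ j : ℕ, Complex.exp (z * (j * δ n : ℝ)) = Complex.exp (z * δ n) ^ j := fun j => by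
      rw [← Complex.exp_nat_mul]
      congr 1
      push_cast
      ring
    simp_rw [← Finset.mul_sum, h1]
    rw [geom_sum_eq (hne n), ← Complex.exp_nat_mul]
    have h2 : ((n + 1 : ℕ) : ℂ) * (z * δ n) = z * τ := by
      have h3 : ((n : ℂ) + 1) ≠ 0 := Nat.cast_add_one_ne_zero n
      rw [hδ]
      push_cast
      field_simp
    rw [h2]
    have h4 : (δ n : ℂ) ≠ 0 := Complex.ofReal_ne_zero.2 (hδpos n).ne'
    have h5 := sub_ne_zero.2 (hne n)
    push_cast
    field_simp
  have hder : HasDerivAt (fun t : ℝ => Complex.exp (z * t)) z 0 := by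
    have h1 : HasDerivAt (fun t : ℝ => z * (t : ℂ)) z 0 := by
      simpa using (Complex.ofRealCLM.hasDerivAt (x := (0 : ℝ))).const_mul z
    simpa using h1.cexp
  have hslope := hder.tendsto_slope_zero.comp (tendsto_nhdsWithin_iff.2
    ⟨hδlim, Eventually.of_forall fun n => (hδpos n).ne'⟩)
  have h1 : Tendsto (fun n => ((δ n)⁻¹ : ℝ) * (Complex.exp (z * δ n) - 1)) atTop (𝓝 z) := by
    convert hslope using 2 with n
    simp
  have h2 := (tendsto_const_nhds (x := Complex.exp (z * τ) - 1)).div h1 hz0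
  exact h2.congr fun n => (hsum n).symm

lemma norm_riemannSum_le {a τ : ℝ} (ha : 0 < a) (hτ : 0 < τ) (κ : ℝ) (n : ℕ) :
    ‖∑ j ∈ Finset.range (n + 1), ((τ / (n + 1) : ℝ) : ℂ) *
      Complex.exp ((Complex.I * κ - a) * (j * (τ / (n + 1)) : ℝ))‖ ≤ τ := by
  have hn : (0 : ℝ) < n + 1 := by positivity
  refine (norm_sum_le_of_le (Finset.range (n + 1)) (f := fun j => ((τ / (n + 1) : ℝ) : ℂ) *
      Complex.exp ((Complex.I * κ - a) * (j * (τ / (n + 1)) : ℝ)))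
      (n := fun _ => τ / (n + 1)) fun j _ => ?_).trans_eq ?_
  · rw [norm_mul, norm_exp_sub_mul, Complex.norm_real, Real.norm_of_nonneg (by positivity)]
    refine mul_le_of_le_one_right (by positivity) ?_
    rw [Real.exp_le_one_iff]
    have : 0 ≤ a * (j * (τ / (n + 1))) := by positivity
    linarith
  · rw [Finset.sum_const, Finset.card_range, nsmul_eq_mul]
    push_cast
    field_simp

namespace VonNeumannAlgebra.IsAdmissible

variable {H : Type u} [NormedAddCommGroup H] [InnerProductSpace ℂ H] [CompleteSpace H]
  {M₁ M₂ : VonNeumannAlgebra H} {Ω x : H} {τ : ℝ}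

lemma expIntegral (hM : M₂ ≤ M₁) (h₁ : M₁.IsCyclicSeparating Ω)
    (hx : Integrable Real.exp (M₁.logModularMeasure Ω x))
    (hexp : ∀ t : ℝ, |t| ≤ τ → IsAdmissible M₁ M₂ Ω x fun k => Complex.exp (Complex.I * t * k))
    {a : ℝ} (ha : 0 < a) (hτ : 0 < τ) (u : ℝ) {σ : ℝ} (hσ : |σ| ≤ 1) :
    IsAdmissible M₁ M₂ Ω x fun k => expIntegral a τ (σ * (k + u)) := by
  refine of_tendsto hM h₁ hx (C := τ) (φ := fun n k => ∑ j ∈ Finset.range (n + 1),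
    ((τ / (n + 1) : ℝ) : ℂ) * Complex.exp ((Complex.I * (σ * (k + u) : ℝ) - a) *
      (j * (τ / (n + 1)) : ℝ))) (fun n => ?_)
    (fun n k => norm_riemannSum_le ha hτ _ n) (fun k => tendsto_riemannSum ha hτ _)
  refine sum _ fun j hj => ?_
  have hn : (0 : ℝ) < n + 1 := by positivity
  have ht : |σ * (j * (τ / (n + 1)))| ≤ τ := by
    have h1 : (j : ℝ) ≤ n + 1 := by
      exact_mod_cast (Finset.mem_range.1 hj).le
    rw [abs_mul, abs_of_nonneg (by positivity : (0 : ℝ) ≤ j * (τ / (n + 1)))]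
    calc |σ| * (j * (τ / (n + 1))) ≤ 1 * ((n + 1) * (τ / (n + 1))) := by gcongr
      _ = τ := by field_simp
  have h2 := (hexp _ ht).const_mul (((τ / (n + 1) : ℝ) : ℂ) *
    Complex.exp ((Complex.I * (σ * u : ℝ) - a) * (j * (τ / (n + 1)) : ℝ)))
  convert h2 using 2 with k
  rw [mul_assoc, ← Complex.exp_add]
  congr 2
  push_cast
  ring

lemma sinIntegral (hM : M₂ ≤ M₁) (h₁ : M₁.IsCyclicSeparating Ω)
    (hx : Integrable Real.exp (M₁.logModularMeasure Ω x))
    (hexp : ∀ t : ℝ, |t| ≤ τ → IsAdmissible M₁ M₂ Ω x fun k => Complex.exp (Complex.I * t * k))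
    {a : ℝ} (ha : 0 < a) (hτ : 0 < τ) (u : ℝ) :
    IsAdmissible M₁ M₂ Ω x fun k => sinIntegral a τ (k + u) := by
  have e1 := expIntegral hM h₁ hx hexp ha hτ u (σ := 1) (by simp)
  have e2 := (expIntegral hM h₁ hx hexp ha hτ u (σ := -1) (by simp)).const_mul (-1)
  convert (e1.add e2).const_mul (2 * Complex.I)⁻¹ using 2 with k
  rw [_root_.sinIntegral, one_mul, neg_one_mul]
  ring_nf

/-- The resolvent function `fermi (· + u)` is approximated uniformly by admissible functions with an
error of order `e^{-πτ}`: the truncation to times `|t| ≤ τ` of its Fourier representation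
`1/2 - ∫₀^∞ sin(κ t) / sinh(π t) dt`, where `1 / (2 sinh(π t))` is expanded into the exponentials
`e^{-(2n+1)πt}`. -/
lemma exists_approx (hM : M₂ ≤ M₁) (h₁ : M₁.IsCyclicSeparating Ω)
    (hx : Integrable Real.exp (M₁.logModularMeasure Ω x)) (hτ : 0 ≤ τ)
    (hexp : ∀ t : ℝ, |t| ≤ τ → IsAdmissible M₁ M₂ Ω x fun k => Complex.exp (Complex.I * t * k))
    (u : ℝ) : ∃ φ, IsAdmissible M₁ M₂ Ω x φ ∧
      ∀ k : ℝ, ‖fermi (k + u) - φ k‖ ≤ (Real.exp Real.pi + 4) * Real.exp (-(Real.pi * τ)) := by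
  have hpi := Real.pi_pos
  rcases lt_or_ge τ 1 with hτ1 | hτ1
  · refine ⟨fun _ => 0, zero, fun k => ?_⟩
    rw [sub_zero, Complex.norm_real, Real.norm_of_nonneg (fermi_pos _).le]
    have h1 : 1 ≤ Real.exp Real.pi * Real.exp (-(Real.pi * τ)) := by
      rw [← Real.exp_add]
      exact Real.one_le_exp (by nlinarith)
    have h2 := Real.exp_pos (-(Real.pi * τ))
    linarith [fermi_le_one (k + u)]
  have hτ0 : 0 < τ := one_pos.trans_le hτ1
  set a : ℕ → ℝ := fun n => (2 * n + 1) * Real.pi with hadef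
  have ha : ∀ n, 0 < a n := fun n => by positivity
  set e : ℕ → ℝ → ℂ := fun n κ =>
    ((κ / (κ ^ 2 + a n ^ 2) : ℝ) : ℂ) - _root_.sinIntegral (a n) τ κ with hedef
  set ε := Real.exp (-(Real.pi * τ)) with hε
  have he : ∀ n κ, ‖e n κ‖ ≤ ε * (1 / 2) ^ n := fun n κ => by
    refine (norm_sub_sinIntegral_le (ha n) τ κ).trans ?_
    have h1 : 1 ≤ a n := by
      have : (0 : ℝ) ≤ n := Nat.cast_nonneg n
      have := Real.pi_gt_three
      rw [hadef]
      nlinarith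
    have h2 : Real.exp (-(a n * τ)) ≤ ε * Real.exp (-1) ^ n := by
      rw [hε, ← Real.exp_nat_mul, ← Real.exp_add, Real.exp_le_exp, hadef]
      have : (0 : ℝ) ≤ n := Nat.cast_nonneg n
      have h3 : (n : ℝ) ≤ n * (2 * (Real.pi * τ)) :=
        le_mul_of_one_le_right this (by nlinarith [Real.pi_gt_three])
      nlinarith
    have h4 : Real.exp (-1) ≤ 1 / 2 := by
      rw [Real.exp_neg, one_div]
      exact inv_anti₀ two_pos (by linarith [Real.add_one_le_exp (1 : ℝ)])
    calc Real.exp (-(a n * τ)) / a n ≤ Real.exp (-(a n * τ)) := div_le_self (Real.exp_nonneg _) h1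
      _ ≤ ε * Real.exp (-1) ^ n := h2
      _ ≤ _ := by gcongr
  have hgeo : Summable fun n : ℕ => ε * (1 / 2 : ℝ) ^ n :=
    (summable_geometric_of_lt_one (by norm_num) (by norm_num)).mul_left ε
  have hgeosum : ∑' n : ℕ, ε * (1 / 2 : ℝ) ^ n = 2 * ε := by
    rw [tsum_mul_left, tsum_geometric_of_lt_one (by norm_num) (by norm_num)]
    ring
  have hes : ∀ κ, Summable fun n => e n κ := fun κ => .of_norm_bounded hgeo fun n => he n κ
  have hfin : ∀ N κ, ‖∑ n ∈ Finset.range N, e n κ‖ ≤ 2 * ε := fun N κ =>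
    (norm_sum_le_of_le _ fun n _ => he n κ).trans
      ((hgeo.sum_le_tsum _ fun n _ => by positivity).trans_eq hgeosum)
  have htsum : ∀ κ, ‖∑' n, e n κ‖ ≤ 2 * ε := fun κ =>
    (tsum_of_norm_bounded hgeo.hasSum fun n => he n κ).trans_eq hgeosum
  -- partial sums of the partial fraction expansion are bounded, being monotone
  set F : ℕ → ℝ → ℝ := fun N κ => 1 / 2 - 2 * ∑ m ∈ Finset.range N, κ / (κ ^ 2 + a m ^ 2) with hF
  have hFlim : ∀ κ, Tendsto (fun N => F N κ) atTop (𝓝 (fermi κ)) := tendsto_fermi_partialFractions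
  have hFsucc : ∀ N κ, F (N + 1) κ = F N κ - 2 * (κ / (κ ^ 2 + a N ^ 2)) := fun N κ => by
    simp only [hF, Finset.sum_range_succ]
    ring
  have hF0 : ∀ κ, F 0 κ = 1 / 2 := fun κ => by simp [hF]
  have hFb : ∀ N κ, |F N κ| ≤ 1 := fun N κ => by
    rw [abs_le]
    rcases le_total 0 κ with hκ | hκ
    · have hanti : Antitone fun N => F N κ := antitone_nat_of_succ_le fun N => by
        rw [hFsucc]
        have : 0 ≤ κ / (κ ^ 2 + a N ^ 2) := by positivity
        linarith
      have e1 := hanti.le_of_tendsto (hFlim κ) N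
      have e2 := hanti (Nat.zero_le N)
      simp only [hF0] at e2
      exact ⟨by linarith [fermi_pos κ], by linarith⟩
    · have hmono : Monotone fun N => F N κ := monotone_nat_of_le_succ fun N => by
        rw [hFsucc]
        have : κ / (κ ^ 2 + a N ^ 2) ≤ 0 := div_nonpos_of_nonpos_of_nonneg hκ (by positivity)
        linarith
      have e1 := hmono.ge_of_tendsto (hFlim κ) N
      have e2 := hmono (Nat.zero_le N)
      simp only [hF0] at e2
      exact ⟨by linarith, e1.trans (fermi_le_one κ)⟩
  have hφN : ∀ N κ, 1 / 2 - 2 * ∑ n ∈ Finset.range N, _root_.sinIntegral (a n) τ κ =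
      (F N κ : ℂ) + 2 * ∑ n ∈ Finset.range N, e n κ := fun N κ => by
    simp only [hF, hedef, Finset.sum_sub_distrib]
    push_cast
    ring
  refine ⟨fun k => fermi (k + u) + 2 * ∑' n, e n (k + u), ?_, fun k => ?_⟩
  · refine of_tendsto hM h₁ hx (C := 1 + 2 * (2 * ε)) (φ := fun N k =>
      1 / 2 - 2 * ∑ n ∈ Finset.range N, _root_.sinIntegral (a n) τ (k + u)) (fun N => ?_)
      (fun N k => ?_) (fun k => ?_)
    · have e1 := (hexp 0 (by simpa using hτ)).const_mul (1 / 2)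
      have e2 := (sum (Finset.range N) fun n _ =>
        sinIntegral hM h₁ hx hexp (ha n) hτ0 u).const_mul (-2)
      convert e1.add e2 using 2 with k
      simp only [Complex.ofReal_zero, mul_zero, zero_mul, Complex.exp_zero]
      ring
    · rw [hφN]
      refine (norm_add_le _ _).trans (add_le_add ?_ ?_)
      · rw [Complex.norm_real, Real.norm_eq_abs]
        exact hFb _ _
      · rw [norm_mul, Complex.norm_two]
        exact mul_le_mul_of_nonneg_left (hfin _ _) two_pos.le
    · simp_rw [hφN]
      exact ((Complex.continuous_ofReal.tendsto _).comp (hFlim _)).add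
        ((hes _).hasSum.tendsto_sum_nat.const_mul 2)
  · rw [sub_add_cancel_left, norm_neg, norm_mul, Complex.norm_two]
    have h1 := htsum (k + u)
    have h2 : 0 < Real.exp Real.pi * ε := by positivity
    linarith

end VonNeumannAlgebra.IsAdmissible

/-! ### The logarithm as an integral of resolvents -/

lemma one_sub_fermi_nonneg (κ : ℝ) : 0 ≤ 1 - fermi κ := sub_nonneg.2 (fermi_le_one κ)

lemma one_sub_fermi_le_exp (κ : ℝ) : 1 - fermi κ ≤ Real.exp κ := by
  rw [← exp_mul_fermi]
  exact mul_le_of_le_one_right (Real.exp_nonneg _) (fermi_le_one κ)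

/-- The integrand of `k = ∫ (1_{u ≤ 0} - fermi (k + u)) du`. -/
noncomputable def logKernel (u k : ℝ) : ℝ := (Iic (0 : ℝ)).indicator (fun _ => 1) u - fermi (k + u)

lemma logKernel_of_le {u : ℝ} (hu : u ≤ 0) (k : ℝ) : logKernel u k = 1 - fermi (k + u) := by
  rw [logKernel, indicator_of_mem (show u ∈ Iic (0 : ℝ) from hu)]

lemma logKernel_of_lt {u : ℝ} (hu : 0 < u) (k : ℝ) : logKernel u k = -fermi (k + u) := by
  rw [logKernel, indicator_of_notMem (show u ∉ Iic (0 : ℝ) from not_le.2 hu), zero_sub]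

lemma measurable_logKernel : Measurable fun p : ℝ × ℝ => logKernel p.1 p.2 := by
  refine ((measurable_const.indicator measurableSet_Iic).comp measurable_fst).sub ?_
  exact (continuous_fermi.comp (continuous_snd.add continuous_fst)).measurable

lemma hasDerivAt_log_one_add_exp (k u : ℝ) :
    HasDerivAt (fun u => Real.log (1 + Real.exp (k + u))) (1 - fermi (k + u)) u := by
  have h1 : HasDerivAt (fun u => 1 + Real.exp (k + u)) (Real.exp (k + u)) u := by
    simpa using (((hasDerivAt_id u).const_add k).exp).const_add 1
  convert h1.log (by positivity) using 1
  rw [← exp_mul_fermi, fermi, div_eq_mul_inv]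

lemma hasDerivAt_log_one_add_exp_neg (k u : ℝ) :
    HasDerivAt (fun u => Real.log (1 + Real.exp (-(k + u)))) (-fermi (k + u)) u := by
  have h1 : HasDerivAt (fun u => 1 + Real.exp (-(k + u))) (-Real.exp (-(k + u))) u := by
    simpa using ((((hasDerivAt_id u).const_add k).neg).exp).const_add 1
  convert h1.log (by positivity) using 1
  rw [fermi, Real.exp_neg]
  have := Real.exp_pos (k + u)
  field_simp
  ring

/-- `log Δ` as an integral of resolvents, on the level of the spectral parameter. -/
lemma integral_logKernel {k : ℝ} (hk : Integrable fun u => logKernel u k) :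
    ∫ u, logKernel u k = k := by
  have hIic : IntegrableOn (fun u => 1 - fermi (k + u)) (Iic 0) :=
    hk.integrableOn.congr_fun (fun u hu => logKernel_of_le hu k) measurableSet_Iic
  have hIoi : IntegrableOn (fun u => -fermi (k + u)) (Ioi 0) :=
    hk.integrableOn.congr_fun (fun u hu => logKernel_of_lt hu k) measurableSet_Ioi
  have hbot : Tendsto (fun u => k + u) atBot atBot := tendsto_atBot_add_const_left _ _ tendsto_id
  have htop : Tendsto (fun u => k + u) atTop atTop := tendsto_atTop_add_const_left _ _ tendsto_id
  have hlog : Tendsto (fun e : ℝ => Real.log (1 + e)) (𝓝 0) (𝓝 0) := by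
    have : ContinuousAt (fun e : ℝ => Real.log (1 + e)) 0 := by
      refine ContinuousAt.log (by fun_prop) (by norm_num)
    simpa using this.tendsto
  have h1 := integral_Iic_of_hasDerivAt_of_tendsto' (a := 0)
    (fun u _ => hasDerivAt_log_one_add_exp k u) hIic
    (hlog.comp (Real.tendsto_exp_atBot.comp hbot))
  have h2 := integral_Ioi_of_hasDerivAt_of_tendsto' (a := 0)
    (fun u _ => hasDerivAt_log_one_add_exp_neg k u) hIoi
    (hlog.comp (Real.tendsto_exp_neg_atTop_nhds_zero.comp htop))
  rw [← integral_add_compl measurableSet_Iic hk, compl_Iic,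
    setIntegral_congr_fun measurableSet_Iic (fun u hu => logKernel_of_le hu k),
    setIntegral_congr_fun measurableSet_Ioi (fun u hu => logKernel_of_lt hu k), h1, h2,
    add_zero, Real.exp_neg]
  have h3 : 1 + (Real.exp k)⁻¹ = (1 + Real.exp k) / Real.exp k := by
    have := Real.exp_pos k
    field_simp
    ring
  rw [h3, Real.log_div (by positivity) (by positivity), Real.log_exp]
  ring

lemma integrable_one_sub_fermi (u : ℝ) (μ : Measure ℝ) [IsFiniteMeasure μ] :
    Integrable (fun k => 1 - fermi (k + u)) μ :=
  (integrable_const 1).sub (integrable_fermi u μ)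

section Expectation

variable {μ : Measure ℝ} [IsProbabilityMeasure μ]

lemma integral_one_sub_fermi_le (hμ : Integrable Real.exp μ) (hμ1 : ∫ k, Real.exp k ∂μ ≤ 1)
    (u : ℝ) : 1 - ∫ k, fermi (k + u) ∂μ ≤ Real.exp u := by
  have h1 : 1 - ∫ k, fermi (k + u) ∂μ = ∫ k, (1 - fermi (k + u)) ∂μ := by
    rw [integral_sub (integrable_const 1) (integrable_fermi u μ)]
    simp
  calc _ = ∫ k, (1 - fermi (k + u)) ∂μ := h1
    _ ≤ ∫ k, Real.exp k * Real.exp u ∂μ := by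
      refine integral_mono (integrable_one_sub_fermi u μ) (hμ.mul_const _) fun k => ?_
      rw [← Real.exp_add]
      exact one_sub_fermi_le_exp _
    _ = (∫ k, Real.exp k ∂μ) * Real.exp u := integral_mul_const _ _
    _ ≤ Real.exp u := mul_le_of_le_one_left (Real.exp_nonneg _) hμ1

/-- The kernel is jointly integrable if `∫ eᵏ μ(dk) ≤ 1`, which controls `u ≤ 0`, and the resolvent
expectations are integrable over `u > 0`. -/
lemma integrable_logKernel (hμ : Integrable Real.exp μ) (hμ1 : ∫ k, Real.exp k ∂μ ≤ 1)
    (hfin : ∫⁻ u in Ioi (0 : ℝ), ENNReal.ofReal (∫ k, fermi (k + u) ∂μ) ≠ ∞) :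
    Integrable (fun p : ℝ × ℝ => logKernel p.1 p.2) (volume.prod μ) := by
  have hm := measurable_logKernel.aestronglyMeasurable (μ := volume.prod μ)
  rw [integrable_prod_iff hm]
  refine ⟨Eventually.of_forall fun u => ?_, ?_⟩
  · simp only [logKernel]
    exact (integrable_const _).sub (integrable_fermi u μ)
  · have hm' := hm.norm.integral_prod_right'
    rw [← integrableOn_univ, ← Iic_union_Ioi (a := (0 : ℝ))]
    refine IntegrableOn.union ?_ ?_
    · refine Integrable.mono' (integrableOn_exp_Iic 0) hm'.restrict ?_
      filter_upwards [ae_restrict_mem measurableSet_Iic] with u hu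
      rw [Real.norm_of_nonneg (integral_nonneg fun _ => norm_nonneg _)]
      refine le_trans (le_of_eq ?_) (integral_one_sub_fermi_le hμ hμ1 u)
      have h1 : ∀ k, ‖logKernel u k‖ = 1 - fermi (k + u) := fun k => by
        rw [logKernel_of_le hu, Real.norm_of_nonneg (one_sub_fermi_nonneg _)]
      simp_rw [h1]
      rw [integral_sub (integrable_const 1) (integrable_fermi u μ)]
      simp
    · refine ⟨hm'.restrict, ?_⟩
      rw [hasFiniteIntegral_iff_norm]
      refine lt_of_le_of_lt (lintegral_mono_ae ?_) hfin.lt_top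
      filter_upwards [ae_restrict_mem measurableSet_Ioi] with u hu
      have h1 : ∀ k, ‖logKernel u k‖ = fermi (k + u) := fun k => by
        rw [logKernel_of_lt hu, norm_neg, Real.norm_of_nonneg (fermi_pos _).le]
      simp_rw [h1]
      rw [Real.norm_of_nonneg (integral_nonneg fun k => (fermi_pos _).le)]

/-- The expectation value of `k` is finite and is the integral of the resolvent expectations. -/
lemma integrable_id_and_integral_eq (hμ : Integrable Real.exp μ) (hμ1 : ∫ k, Real.exp k ∂μ ≤ 1)
    (hfin : ∫⁻ u in Ioi (0 : ℝ), ENNReal.ofReal (∫ k, fermi (k + u) ∂μ) ≠ ∞) :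
    Integrable (fun k : ℝ => k) μ ∧
      Integrable (fun u => (Iic (0 : ℝ)).indicator (fun _ => 1) u - ∫ k, fermi (k + u) ∂μ) ∧
      ∫ k, k ∂μ = ∫ u, ((Iic (0 : ℝ)).indicator (fun _ => 1) u - ∫ k, fermi (k + u) ∂μ) := by
  have hint := integrable_logKernel hμ hμ1 hfin
  have hae : ∀ᵐ k ∂μ, ∫ u, logKernel u k = k := by
    filter_upwards [hint.prod_left_ae] with k hk using integral_logKernel hk
  have hin : ∀ u, ∫ k, logKernel u k ∂μ =
      (Iic (0 : ℝ)).indicator (fun _ => 1) u - ∫ k, fermi (k + u) ∂μ := fun u => by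
    simp only [logKernel]
    rw [integral_sub (integrable_const _) (integrable_fermi u μ)]
    simp
  refine ⟨hint.integral_prod_right.congr hae, ?_, ?_⟩
  · exact hint.integral_prod_left.congr (Eventually.of_forall hin)
  · rw [← integral_congr_ae hae, ← integral_integral_swap hint]
    exact integral_congr_ae (Eventually.of_forall hin)

/-- If the resolvent expectations for `μ₁` dominate those for `μ₂`, the expectation values of `k`
differ by the integral of the difference of the resolvent expectations. -/
lemma integral_sub_integral_eq {μ₁ μ₂ : Measure ℝ} [IsProbabilityMeasure μ₁]
    [IsProbabilityMeasure μ₂] (hμ₁ : Integrable Real.exp μ₁) (hμ₁1 : ∫ k, Real.exp k ∂μ₁ ≤ 1)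
    (hμ₂ : Integrable Real.exp μ₂) (hμ₂1 : ∫ k, Real.exp k ∂μ₂ ≤ 1)
    (hle : ∀ u, ∫ k, fermi (k + u) ∂μ₂ ≤ ∫ k, fermi (k + u) ∂μ₁)
    (hfin : ∫⁻ u in Ioi (0 : ℝ), ENNReal.ofReal (∫ k, fermi (k + u) ∂μ₁) ≠ ∞) :
    Integrable (fun k : ℝ => k) μ₁ ∧ Integrable (fun k : ℝ => k) μ₂ ∧
      Integrable (fun u => ∫ k, fermi (k + u) ∂μ₁ - ∫ k, fermi (k + u) ∂μ₂) ∧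
      ∫ k, k ∂μ₂ - ∫ k, k ∂μ₁ = ∫ u, (∫ k, fermi (k + u) ∂μ₁ - ∫ k, fermi (k + u) ∂μ₂) := by
  have hfin₂ : ∫⁻ u in Ioi (0 : ℝ), ENNReal.ofReal (∫ k, fermi (k + u) ∂μ₂) ≠ ∞ :=
    ((lintegral_mono fun u => ENNReal.ofReal_le_ofReal (hle u)).trans_lt hfin.lt_top).ne
  obtain ⟨h1, h2, h3⟩ := integrable_id_and_integral_eq hμ₁ hμ₁1 hfin
  obtain ⟨h4, h5, h6⟩ := integrable_id_and_integral_eq hμ₂ hμ₂1 hfin₂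
  refine ⟨h1, h4, ?_, ?_⟩
  · refine (h5.sub h2).congr (Eventually.of_forall fun u => ?_)
    simp only [Pi.sub_apply]
    ring
  · rw [h3, h6, ← integral_sub h5 h2]
    congr 1
    funext u
    ring

end Expectation

/-! ### The weight function -/

section Weight

variable {η : ℝ → ℝ}

lemma etaInf_le {k : ℝ} (hk : k ≤ 0) (u : ℝ) :
    etaInf η u ≤ ENNReal.ofReal ((1 + Real.exp (u + k)) * η k) := by
  have := iInf₂_le (f := fun (k : ℝ) (_ : 0 ≤ k) =>
    ENNReal.ofReal ((1 + Real.exp (u - k)) * η (-k))) (-k) (neg_nonneg.2 hk)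
  simpa [etaInf] using this

lemma etaInf_mono (hη : ∀ k ≤ 0, 0 ≤ η k) : Monotone (etaInf η) := fun u v huv =>
  iInf₂_mono fun k hk => ENNReal.ofReal_le_ofReal (by
    have := hη (-k) (neg_nonpos.2 hk)
    gcongr)

lemma etaInf_ne_zero (hη : ∀ k ≤ 0, 0 ≤ η k) (hint : ∫⁻ u in Ioi (0 : ℝ), (etaInf η u)⁻¹ < ∞)
    {u : ℝ} (hu : 0 < u) : etaInf η u ≠ 0 := by
  intro h0
  refine hint.ne (top_unique ?_)
  calc ∞ = ∫⁻ _ in Ioo (0 : ℝ) u, ∞ := by simp [hu]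
    _ = ∫⁻ v in Ioo (0 : ℝ) u, (etaInf η v)⁻¹ := by
      refine setLIntegral_congr_fun measurableSet_Ioo fun v hv => ?_
      have : etaInf η v = 0 := le_antisymm (h0 ▸ etaInf_mono hη hv.2.le) bot_le
      rw [this, ENNReal.inv_zero]
    _ ≤ _ := lintegral_mono_set Ioo_subset_Ioi_self

lemma fermi_le_inv_etaInf_mul (hη : ∀ k ≤ 0, 0 ≤ η k)
    (hint : ∫⁻ u in Ioi (0 : ℝ), (etaInf η u)⁻¹ < ∞) {u : ℝ} (hu : 0 < u) (k : ℝ) :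
    ENNReal.ofReal (fermi (k + u)) ≤ (etaInf η u)⁻¹ * ENNReal.ofReal (η (min k 0)) := by
  have hk : min k 0 ≤ 0 := min_le_right _ _
  have htop : etaInf η u ≠ ∞ := ((etaInf_le hk u).trans_lt ENNReal.ofReal_lt_top).ne
  rw [mul_comm, ← div_eq_mul_inv,
    ENNReal.le_div_iff_mul_le (Or.inl (etaInf_ne_zero hη hint hu)) (Or.inl htop)]
  have hpos : 0 < 1 + Real.exp (u + min k 0) := by positivity
  calc ENNReal.ofReal (fermi (k + u)) * etaInf η u
      ≤ ENNReal.ofReal (1 + Real.exp (u + min k 0))⁻¹ *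
        ENNReal.ofReal ((1 + Real.exp (u + min k 0)) * η (min k 0)) := by
        refine mul_le_mul' (ENNReal.ofReal_le_ofReal ?_) (etaInf_le hk u)
        rw [fermi]
        refine inv_anti₀ hpos ?_
        have : u + min k 0 ≤ k + u := by linarith [min_le_left k 0]
        gcongr
    _ = ENNReal.ofReal (η (min k 0)) := by
        rw [← ENNReal.ofReal_mul (by positivity), ← mul_assoc, inv_mul_cancel₀ hpos.ne', one_mul]

/-- The tail `u > T` of the resolvent expectations is controlled by the weight. -/
lemma lintegral_fermi_le (hη : ∀ k ≤ 0, 0 ≤ η k)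
    (hint : ∫⁻ u in Ioi (0 : ℝ), (etaInf η u)⁻¹ < ∞) {μ : Measure ℝ} [IsFiniteMeasure μ]
    (hημ : Integrable (fun k => η (min k 0)) μ) {T : ℝ} (hT : 0 ≤ T) :
    ∫⁻ u in Ioi T, ENNReal.ofReal (∫ k, fermi (k + u) ∂μ) ≤
      (∫⁻ u in Ioi T, (etaInf η u)⁻¹) * ENNReal.ofReal (∫ k, η (min k 0) ∂μ) := by
  rw [← lintegral_mul_const' _ _ ENNReal.ofReal_ne_top]
  refine lintegral_mono_ae ?_
  filter_upwards [ae_restrict_mem measurableSet_Ioi] with u hu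
  have hu0 : 0 < u := hT.trans_lt hu
  rw [ofReal_integral_eq_lintegral_ofReal (integrable_fermi u μ)
      (Eventually.of_forall fun k => (fermi_pos _).le),
    ofReal_integral_eq_lintegral_ofReal hημ
      (Eventually.of_forall fun k => hη _ (min_le_right _ _)),
    ← lintegral_const_mul' _ _ (ENNReal.inv_ne_top.2 (etaInf_ne_zero hη hint hu0))]
  exact lintegral_mono fun k => fermi_le_inv_etaInf_mul hη hint hu0 k

lemma eta_zero_pos (hη : ∀ k ≤ 0, 0 ≤ η k) (hint : ∫⁻ u in Ioi (0 : ℝ), (etaInf η u)⁻¹ < ∞) :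
    0 < η 0 := by
  refine lt_of_le_of_ne (hη 0 le_rfl) fun h0 => ?_
  refine etaInf_ne_zero hη hint one_pos (le_antisymm ?_ bot_le)
  refine (etaInf_le le_rfl 1).trans ?_
  rw [← h0]
  simp

lemma lintegral_Ioi_inv_etaInf_ne_top (hint : ∫⁻ u in Ioi (0 : ℝ), (etaInf η u)⁻¹ < ∞) {T : ℝ}
    (hT : 0 ≤ T) : ∫⁻ u in Ioi T, (etaInf η u)⁻¹ ≠ ∞ :=
  ((lintegral_mono_set (Ioi_subset_Ioi hT)).trans_lt hint).ne

/-- The tail of the weight decays at most exponentially, because of the value of `η` at `0`. -/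
lemma exp_neg_le_etaTail (hη : ∀ k ≤ 0, 0 ≤ η k)
    (hint : ∫⁻ u in Ioi (0 : ℝ), (etaInf η u)⁻¹ < ∞) {τ : ℝ} (hτ : 0 ≤ τ) :
    Real.exp (-(Real.pi * τ)) ≤ 2 * η 0 * etaTail η τ := by
  have h0 := eta_zero_pos hη hint
  set T := Real.pi * τ with hT
  have hT0 : 0 ≤ T := mul_nonneg Real.pi_pos.le hτ
  have h1 : ENNReal.ofReal ((2 * η 0)⁻¹ * Real.exp (-T)) ≤ ∫⁻ u in Ioi T, (etaInf η u)⁻¹ := by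
    rw [← integral_exp_neg_Ioi T, ← integral_const_mul, ofReal_integral_eq_lintegral_ofReal
      ((exp_neg_integrableOn_Ioi T one_pos).congr_fun (fun u _ => by simp)
        measurableSet_Ioi |>.const_mul _)
      (Eventually.of_forall fun u => by positivity)]
    refine lintegral_mono_ae ?_
    filter_upwards [ae_restrict_mem measurableSet_Ioi] with u hu
    have hu0 : 0 ≤ u := hT0.trans (le_of_lt hu)
    rw [Real.exp_neg, ← mul_inv, ENNReal.ofReal_inv_of_pos (by positivity), ENNReal.inv_le_inv]
    refine (etaInf_le le_rfl u).trans (ENNReal.ofReal_le_ofReal ?_)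
    rw [add_zero]
    have := Real.one_le_exp hu0
    nlinarith
  have h2 := ENNReal.toReal_mono (lintegral_Ioi_inv_etaInf_ne_top hint hT0) h1
  rw [ENNReal.toReal_ofReal (by positivity), inv_mul_le_iff₀ (by positivity)] at h2
  exact h2

end Weight

/-- The integral over `u` of the difference of resolvent expectations: the tails are controlled by
the weight for `u > πτ` and by `eᵘ` for `u ≤ -πτ`, the range between by `e^{-2πτ} (1 + eᵘ)`. -/
lemma integral_le_of_bounds {d : ℝ → ℝ} (hd : Integrable d) {T A B : ℝ} (hT : 0 ≤ T) (hA : 0 ≤ A)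
    (hlow : ∀ u, d u ≤ Real.exp u) (hmid : ∀ u, d u ≤ A * Real.exp (-T) ^ 2 * (1 + Real.exp u))
    (htail : ∫ u in Ioi T, d u ≤ B) : ∫ u, d u ≤ (1 + 3 * A) * Real.exp (-T) + B := by
  have hTT : -T ≤ T := by linarith
  have h1 : ∫ u in Iic (-T), d u ≤ Real.exp (-T) := by
    rw [← integral_exp_Iic]
    exact integral_mono_ae hd.integrableOn (integrableOn_exp_Iic _) (Eventually.of_forall hlow)
  have h2 : ∫ u in Ioc (-T) T, d u ≤ 3 * A * Real.exp (-T) := by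
    have hle : ∫ u in (-T)..T, d u ≤ ∫ u in (-T)..T, A * Real.exp (-T) ^ 2 * (1 + Real.exp u) :=
      intervalIntegral.integral_mono hTT hd.intervalIntegrable
        (Continuous.intervalIntegrable (by fun_prop) _ _) hmid
    rw [intervalIntegral.integral_const_mul, intervalIntegral.integral_add (by simp)
      (Continuous.intervalIntegrable (by fun_prop) _ _), integral_exp,
      intervalIntegral.integral_const, smul_eq_mul, mul_one,
      intervalIntegral.integral_of_le hTT] at hle
    refine hle.trans ?_
    have e1 : Real.exp (-T) * Real.exp T = 1 := by rw [← Real.exp_add]; simp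
    have e2 : T * Real.exp (-T) ≤ 1 := by
      have := Real.add_one_le_exp T
      have h := Real.exp_pos (-T)
      nlinarith
    have e3 := Real.exp_pos (-T)
    have e4 : Real.exp (-T) ^ 2 * (T - -T + (Real.exp T - Real.exp (-T))) ≤ 3 * Real.exp (-T) := by
      have : Real.exp (-T) ^ 2 * (T - -T + (Real.exp T - Real.exp (-T))) =
          Real.exp (-T) * (2 * (T * Real.exp (-T)) + Real.exp (-T) * Real.exp T -
            Real.exp (-T) ^ 2) := by ring
      rw [this, e1, mul_comm 3]
      refine mul_le_mul_of_nonneg_left ?_ e3.le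
      nlinarith [sq_nonneg (Real.exp (-T))]
    calc _ = A * (Real.exp (-T) ^ 2 * (T - -T + (Real.exp T - Real.exp (-T)))) := by ring
      _ ≤ A * (3 * Real.exp (-T)) := mul_le_mul_of_nonneg_left e4 hA
      _ = _ := by ring
  have h3 : ∫ u, d u =
      (∫ u in Iic (-T), d u) + ((∫ u in Ioc (-T) T, d u) + ∫ u in Ioi T, d u) := by
    rw [← setIntegral_union (Ioc_disjoint_Ioi le_rfl) measurableSet_Ioi hd.integrableOn
      hd.integrableOn, Ioc_union_Ioi_eq_Ioi hTT, ← compl_Iic,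
      integral_add_compl measurableSet_Iic hd]
  rw [h3]
  linarith

namespace VonNeumannAlgebra

variable {H : Type u} [NormedAddCommGroup H] [InnerProductSpace ℂ H] [CompleteSpace H]

lemma norm_apply_of_mem_unitary {U : H →L[ℂ] H} (hU : U ∈ unitary (H →L[ℂ] H)) (x : H) :
    ‖U x‖ = ‖x‖ := by
  have h1 : ⟪U x, U x⟫_ℂ = ⟪x, x⟫_ℂ := by
    rw [← ContinuousLinearMap.adjoint_inner_right, ← ContinuousLinearMap.star_eq_adjoint,
      ← mul_apply_eq_comp, Unitary.star_mul_self_of_mem hU, one_apply_eq_self]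
  rw [inner_self_eq_ofReal_normSq, inner_self_eq_ofReal_normSq, Complex.ofReal_inj] at h1
  exact (sq_eq_sq₀ (norm_nonneg _) (norm_nonneg _)).1 h1

variable {M : VonNeumannAlgebra H} {Ω : H} {U : H →L[ℂ] H}

lemma isProbabilityMeasure_logModularMeasure {x : H} (hx : ‖x‖ = 1) :
    IsProbabilityMeasure (M.logModularMeasure Ω x) :=
  ⟨by rw [logModularMeasure, ProjValuedMeasure.scalar_univ, hx]; simp⟩

/-- For a unitary `U` in the algebra, `⟨U Ω, Δ U Ω⟩ = ‖U* Ω‖² = 1`; the upper bound suffices. -/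
lemma IsCyclicSeparating.integral_exp_unitary_le (h : M.IsCyclicSeparating Ω)
    (hU : U ∈ unitary (H →L[ℂ] H)) (hUM : U ∈ M) :
    Integrable Real.exp (M.logModularMeasure Ω (U Ω)) ∧
      ∫ k, Real.exp k ∂(M.logModularMeasure Ω (U Ω)) ≤ 1 := by
  have h1 := h.integrable_exp (mem_tomitaGraph hUM)
  rw [norm_apply_of_mem_unitary (Unitary.star_mem hU), h.norm_eq_one, one_pow] at h1
  exact h1

/-- If the modular flow of `M₁` keeps `U` in `M₂` for times `|t| ≤ τ`, the resolvent expectations of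
the two modular operators differ at most by `O(e^{-2πτ}) (1 + eᵘ)`. -/
lemma fermi_integral_sub_le {M₁ M₂ : VonNeumannAlgebra H} (hM : M₂ ≤ M₁)
    (h₁ : M₁.IsCyclicSeparating Ω) (h₂ : M₂.IsCyclicSeparating Ω)
    (hU : U ∈ unitary (H →L[ℂ] H)) (hUM : U ∈ M₂) {τ : ℝ} (hτ : 0 ≤ τ)
    (hflow : ∀ t : ℝ, |t| ≤ τ → M₁.modularFlow Ω t U ∈ M₂) (u : ℝ) :
    ∫ k, fermi (k + u) ∂(M₁.logModularMeasure Ω (U Ω)) -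
        ∫ k, fermi (k + u) ∂(M₂.logModularMeasure Ω (U Ω)) ≤
      (Real.exp Real.pi + 4) ^ 2 * Real.exp (-(Real.pi * τ)) ^ 2 * (1 + Real.exp u) := by
  obtain ⟨hx, hx1⟩ := h₁.integral_exp_unitary_le hU (hM hUM)
  have : IsProbabilityMeasure (M₁.logModularMeasure Ω (U Ω)) :=
    isProbabilityMeasure_logModularMeasure
      ((norm_apply_of_mem_unitary hU Ω).trans h₁.norm_eq_one)
  obtain ⟨φ, hφ, happ⟩ := IsAdmissible.exists_approx hM h₁ hx hτ
    (fun t ht => IsAdmissible.exp_I h₁ (hflow t ht)) u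
  obtain ⟨y, hy⟩ := hφ.exists_mem
  refine (fermi_integral_sub_bounds hM h₁ h₂ hx u hφ.isBddMeasurable hy).2.trans ?_
  set c := (Real.exp Real.pi + 4) * Real.exp (-(Real.pi * τ)) with hc
  have hint : Integrable (fun k => c ^ 2 * (1 + Real.exp u * Real.exp k))
      (M₁.logModularMeasure Ω (U Ω)) :=
    ((integrable_const 1).add (hx.const_mul _)).const_mul _
  calc _ ≤ ∫ k, c ^ 2 * (1 + Real.exp u * Real.exp k) ∂(M₁.logModularMeasure Ω (U Ω)) := by
        refine integral_mono_of_nonneg (Eventually.of_forall fun k => by positivity) hint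
          (Eventually.of_forall fun k => ?_)
        simp only
        rw [add_comm k u, Real.exp_add, add_comm u k]
        gcongr
        exact happ k
    _ = c ^ 2 * (1 + Real.exp u * ∫ k, Real.exp k ∂(M₁.logModularMeasure Ω (U Ω))) := by
        rw [integral_const_mul, integral_add (integrable_const 1) (hx.const_mul _),
          integral_const_mul]
        simp
    _ ≤ c ^ 2 * (1 + Real.exp u * 1) := by gcongr
    _ = _ := by rw [hc]; ring

end VonNeumannAlgebra

theorem theorem2 {H : Type*} [NormedAddCommGroup H] [InnerProductSpace ℂ H] [CompleteSpace H]
    [TopologicalSpace.SeparableSpace H]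
    (M₁ M₂ : VonNeumannAlgebra H) (Ω : H) (hM : M₂ ≤ M₁)
    (hΩ₁ : M₁.IsCyclicSeparating Ω) (hΩ₂ : M₂.IsCyclicSeparating Ω)
    (η : ℝ → ℝ) (hη_cont : ContinuousOn η (Set.Iic 0)) (hη_nonneg : ∀ k ≤ 0, 0 ≤ η k)
    (hη_int : ∫⁻ u in Set.Ioi (0 : ℝ), (etaInf η u)⁻¹ < ∞) :
    ∃ C : ℝ, ∀ τ : ℝ, 0 ≤ τ → ∀ U : H →L[ℂ] H, U ∈ unitary (H →L[ℂ] H) → U ∈ M₂ →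
      (∀ t : ℝ, |t| ≤ τ → M₁.modularFlow Ω t U ∈ M₂) →
      -- `U Ω` lies in the form domain of `η(E₁⁻ log Δ₁)`, where `E₁⁻ log Δ₁ = ∫ min(k, 0) E₁(dk)`
      Integrable (fun k : ℝ => η (min k 0)) (M₁.logModularMeasure Ω (U Ω)) →
      -- both expectation values of `log Δ₁`, `log Δ₂` are finite, and the bound holds
      Integrable (fun k : ℝ => k) (M₁.logModularMeasure Ω (U Ω)) ∧
      Integrable (fun k : ℝ => k) (M₂.logModularMeasure Ω (U Ω)) ∧
      |(∫ k, k ∂(M₁.logModularMeasure Ω (U Ω))) - ∫ k, k ∂(M₂.logModularMeasure Ω (U Ω))| ≤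
        C * etaTail η τ * (1 + ∫ k, η (min k 0) ∂(M₁.logModularMeasure Ω (U Ω))) := by
  set A : ℝ := (Real.exp Real.pi + 4) ^ 2 with hA
  have hA0 : 0 ≤ A := sq_nonneg _
  -- `K_η(τ)` dominates the error `e^{-πτ}` up to the factor `2 η(0)`, and the tail `u > πτ` is
  -- at most `K_η(τ)` times the expectation value of `η`.
  refine ⟨(1 + 3 * A) * (2 * η 0) + 1, fun τ hτ U hU hUM hflow hηint => ?_⟩
  set μ₁ := M₁.logModularMeasure Ω (U Ω) with hμ₁
  set μ₂ := M₂.logModularMeasure Ω (U Ω) with hμ₂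
  have hnorm : ‖U Ω‖ = 1 :=
    (VonNeumannAlgebra.norm_apply_of_mem_unitary hU Ω).trans hΩ₁.norm_eq_one
  have hp₁ : IsProbabilityMeasure μ₁ :=
    VonNeumannAlgebra.isProbabilityMeasure_logModularMeasure hnorm
  have hp₂ : IsProbabilityMeasure μ₂ :=
    VonNeumannAlgebra.isProbabilityMeasure_logModularMeasure hnorm
  obtain ⟨he₁, he₁1⟩ := hΩ₁.integral_exp_unitary_le hU (hM hUM)
  obtain ⟨he₂, he₂1⟩ := hΩ₂.integral_exp_unitary_le hU hUM
  have hd0 : ∀ u, 0 ≤ ∫ k, fermi (k + u) ∂μ₁ - ∫ k, fermi (k + u) ∂μ₂ := fun u => by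
    -- For positivity any admissible comparison function will do, for instance `0`.
    obtain ⟨y, hy⟩ := (VonNeumannAlgebra.IsAdmissible.zero
      (M₁ := M₁) (M₂ := M₂) (Ω := Ω) (x := U Ω)).exists_mem
    exact (VonNeumannAlgebra.fermi_integral_sub_bounds hM hΩ₁ hΩ₂ he₁ u (.const 0) hy).1
  have htail := fun {T : ℝ} (hT : 0 ≤ T) => lintegral_fermi_le hη_nonneg hη_int hηint hT
  have hfin := ((htail le_rfl).trans_lt (ENNReal.mul_lt_top hη_int ENNReal.ofReal_lt_top)).ne
  obtain ⟨hint₁, hint₂, hdint, hdeq⟩ := integral_sub_integral_eq he₁ he₁1 he₂ he₂1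
    (fun u => sub_nonneg.1 (hd0 u)) hfin
  refine ⟨hint₁, hint₂, ?_⟩
  set d : ℝ → ℝ := fun u => ∫ k, fermi (k + u) ∂μ₁ - ∫ k, fermi (k + u) ∂μ₂ with hd
  set T := Real.pi * τ with hT
  have hT0 : 0 ≤ T := mul_nonneg Real.pi_pos.le hτ
  set Eη := ∫ k, η (min k 0) ∂μ₁ with hEη
  have hEη0 : 0 ≤ Eη := integral_nonneg fun k => hη_nonneg _ (min_le_right _ _)
  have hf0 : ∀ (μ : Measure ℝ) u, 0 ≤ ∫ k, fermi (k + u) ∂μ := fun μ u =>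
    integral_nonneg fun k => (fermi_pos _).le
  have hB : ∫ u in Ioi T, d u ≤ etaTail η τ * Eη := by
    rw [integral_eq_lintegral_of_nonneg_ae (Eventually.of_forall hd0)
      hdint.aestronglyMeasurable.restrict]
    have h1 : ∫⁻ u in Ioi T, ENNReal.ofReal (d u) ≤
        (∫⁻ u in Ioi T, (etaInf η u)⁻¹) * ENNReal.ofReal Eη :=
      (lintegral_mono fun u => ENNReal.ofReal_le_ofReal
        (sub_le_self _ (hf0 μ₂ u))).trans (htail hT0)
    have h2 := ENNReal.toReal_mono (ENNReal.mul_ne_top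
      (lintegral_Ioi_inv_etaInf_ne_top hη_int hT0) ENNReal.ofReal_ne_top) h1
    rwa [ENNReal.toReal_mul, ENNReal.toReal_ofReal hEη0] at h2
  have hlow : ∀ u, d u ≤ Real.exp u := fun u => by
    refine le_trans ?_ (integral_one_sub_fermi_le he₂ he₂1 u)
    refine sub_le_sub_right ?_ _
    have := integral_mono (integrable_fermi u μ₁) (integrable_const 1) fun k => fermi_le_one (k + u)
    simpa using this
  have hmain := integral_le_of_bounds hdint hT0 hA0 hlow
    (fun u => VonNeumannAlgebra.fermi_integral_sub_le hM hΩ₁ hΩ₂ hU hUM hτ hflow u) hB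
  have hexp := exp_neg_le_etaTail hη_nonneg hη_int hτ
  have hK : 0 ≤ etaTail η τ := ENNReal.toReal_nonneg
  have h0 := (eta_zero_pos hη_nonneg hη_int).le
  rw [abs_sub_comm, abs_of_nonneg (hdeq ▸ integral_nonneg hd0), hdeq]
  calc ∫ u, d u ≤ (1 + 3 * A) * Real.exp (-T) + etaTail η τ * Eη := hmain
    _ ≤ (1 + 3 * A) * (2 * η 0 * etaTail η τ) + etaTail η τ * Eη := by gcongr
    _ ≤ ((1 + 3 * A) * (2 * η 0) + 1) * etaTail η τ * (1 + Eη) := by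
      have h3 : 0 ≤ (1 + 3 * A) * (2 * η 0) * etaTail η τ * Eη := by positivity
      nlinarith
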